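/- **Setting.** There are $n\ge 1$ workers holding datasets $\mathcal D_1,\dots,\mathcal D_n\in\mathcal X^m$, and a loss $\ell(\theta;x)$, differentiable in $\theta\in\mathbb R^d$, $d\ge 1$. A set $\mathcal H$ of $n-f$ workers is honest, the other $f$ are malicious and may send arbitrary messages. Put $\mathcal L_i(\theta)=\frac1m\sum_{x\in\mathcal D_i}\ell(\theta;x)$, $\mathcal L_{\mathcal H}=\frac1{n-f}\sum_{i\in\mathcal H}\mathcal L_i$, $\mathcal L_\star=\inf\mathcal L_{\mathcal H}$. **Algorithm.** CafCor with batch size $1\le b\le m$, clipping threshold $C>0$, $T$ rounds $t=0,\dots,T-1$ and constants $L,\mu>0$: the server broadcasts $\theta_t$; an honest worker $i$ sends the momentum $m_t^{(i)}$, where $m_0^{(i)}=0$ and $m_t^{(i)}=\beta_{t-1}m_{t-1}^{(i)}+(1-\beta_{t-1})\big(g_t^{(i)}+\sum_{j\ne i}v_t^{(ij)}+\bar v_t^{(i)}\big)$; here $g_t^{(i)}$ is the mean over a uniform mini-batch of size $b$ (drawn without replacement) of the per-example gradients $\nabla\ell(\theta_t;x)$, each scaled by $\min\{1,C/\|\nabla\ell(\theta_t;x)\|\}$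 (clipping); $v_t^{(ij)}=-v_t^{(ji)}\sim\mathcal N(0,\sigma_{\rm cor}^2I_d)$ is derived from the secret shared by $i$ and $j$, and $\bar v_t^{(i)}\sim\mathcal N(0,\sigma_{\rm ind}^2I_d)$; all of these and the mini-batches are independent. The server sets $\theta_{t+1}=\theta_t-\gamma_t\,\mathrm{CAF}(\text{messages})$ and outputs $\theta_T$. The schedules are $\gamma_t=\frac{10}{\mu(t+240L/\mu)}$ and $\beta_t=1-24L\gamma_t$. $\mathrm{CAF}(x_1,\dots,x_n)$ starts with weights $c_i=1$; while $\sum_ic_i\ge n-2f$ it computes the weighted mean $\hat\mu$, the weighted covariance, its largest eigenvalue $\hat\sigma^2$ with a unit eigenvector $\hat v$, and replaces $c_i$ by $c_i(1-\tau_i/\max_{c_j\neq 0}\tau_j)$, $\tau_i=\langle\hat v,x_i-\hat\mu\rangle^2$ (it stops if $\hat\sigma^2=0$); it returns the $\hat\mu$ with the smallest $\hat\sigma^2$ met. **Statement.** For every $\eta>0$ there is a constant $K$ depending only on $\eta$ such that the following holds whenever $n\ge(2+\eta)f$, $0<\delta<1$, $0<\varepsilon\le\log(1/\delta)$ and $\sigma_{\rm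 cor}^2=\sigma_{\rm ind}^2=\frac{32C^2T\log(1/\delta)}{\varepsilon^2(n-f)}$. 1. *Privacy.* For every $T$, CafCor is $(\varepsilon,\delta)$-SecLDP against a curious server colluding with all malicious workers: given any values of the secrets shared with malicious workers, and for any behaviour of the malicious workers based on what they and the server see, the transcript of all communications satisfies $\mathbb P[\mathcal A(\mathcal D)\in Y]\le e^{\varepsilon}\,\mathbb P[\mathcal A(\mathcal D')\in Y]+\delta$ for all measurable $Y$ and all $\mathcal D,\mathcal D'$ differing in one worker's dataset. 2. *Robustness.* Let $\mathcal L_{\mathcal H}$ be $L$-smooth and $\mu$-strongly convex, $\frac1{n-f}\sum_{i\in\mathcal H}\langle v,\nabla\mathcal L_i(\theta)-\nabla\mathcal L_{\mathcal H}(\theta)\rangle^2\le G_{\rm cov}^2$ for all $\theta$ and $\|v\|\le1$, and $\frac1m\sum_{x\in\mathcal D_i}\|\nabla\ell(\theta;x)-\nabla\mathcal L_i(\theta)\|^2\le\sigma^2$ for all $\theta$ and $i\in\mathcal H$. Put $$\varrho=K\left(\frac{fG_{\rm cov}^2}{n\mu}+\frac{L}{\mu^2}\left[\frac{C^2d\log(1/\delta)}{\varepsilon^2n}\cdot\frac{f+1}{n}+\frac{C^2\log(1/\delta)}{\varepsilon^2}\cdot\frac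 fn\right]\right).$$ Then there is $T_0$ such that for all $T\ge T_0$ and every adversary, which may use all the randomness of the rounds so far: (a) if no clipping is applied, $\mathbb E[\mathcal L_{\mathcal H}(\theta_T)-\mathcal L_\star]\le\varrho$, that is, the algorithm is $(f,\varrho)$-robust; (b) for CafCor with clipping, $\mathbb E\big[(\mathcal L_{\mathcal H}(\theta_T)-\mathcal L_\star)\mathbf 1_E\big]\le\varrho$, where $E$ is the event that clipping never changes a gradient of an honest worker. -/

import Mathlib

open MeasureTheory ProbabilityTheory
open scoped NNReal ENNReal

universe u

noncomputable section

/-- The parameter space `ℝ^d` with its Euclidean norm. -/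
abbrev Vec (d : ℕ) : Type := EuclideanSpace ℝ (Fin d)

/-! ### Losses and the assumptions on them -/

/-- The empirical loss `L_i(θ) = (1/m) ∑_{x ∈ D_i} ℓ(θ; x)` of a worker with data `Di`. -/
def localLoss {X : Type u} {d m : ℕ} (loss : Vec d → X → ℝ) (Di : Fin m → X) (θ : Vec d) : ℝ :=
  (m : ℝ)⁻¹ * ∑ k, loss θ (Di k)

/-- The global honest loss `L_H(θ) = (1/|H|) ∑_{i ∈ H} L_i(θ)`. -/
def honestLoss {X : Type u} {d n m : ℕ} (loss : Vec d → X → ℝ) (H : Finset (Fin n))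
    (D : Fin n → Fin m → X) (θ : Vec d) : ℝ :=
  (H.card : ℝ)⁻¹ * ∑ i ∈ H, localLoss loss (D i) θ

/-- `L`-smoothness of a differentiable function. -/
def IsSmooth {d : ℕ} (L : ℝ) (F : Vec d → ℝ) : Prop :=
  ∀ θ θ' : Vec d, F θ' - F θ - inner ℝ (gradient F θ) (θ' - θ) ≤ L / 2 * ‖θ' - θ‖ ^ 2

/-- `μ`-strong convexity of a differentiable function. -/
def IsStronglyConvex {d : ℕ} (μ : ℝ) (F : Vec d → ℝ) : Prop :=
  ∀ θ θ' : Vec d, μ / 2 * ‖θ' - θ‖ ^ 2 ≤ F θ' - F θ - inner ℝ (gradient F θ) (θ' - θ)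

/-- Bounded heterogeneity: in every direction, the variance of the honest workers' local
gradients is at most `G²`, at every parameter. -/
def BoundedHeterogeneity {X : Type u} {d n m : ℕ} (loss : Vec d → X → ℝ) (H : Finset (Fin n))
    (D : Fin n → Fin m → X) (G : ℝ) : Prop :=
  ∀ θ v : Vec d, ‖v‖ ≤ 1 →
    (H.card : ℝ)⁻¹ * ∑ i ∈ H,
      (inner ℝ v (gradient (localLoss loss (D i)) θ - gradient (honestLoss loss H D) θ)) ^ 2
      ≤ G ^ 2

/-- Bounded variance: for every honest worker, the variance of the gradient at a uniformly drawn
data point is at most `σ²`, at every parameter. -/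
def BoundedVariance {X : Type u} {d n m : ℕ} (loss : Vec d → X → ℝ) (H : Finset (Fin n))
    (D : Fin n → Fin m → X) (σ : ℝ) : Prop :=
  ∀ i ∈ H, ∀ θ : Vec d,
    (m : ℝ)⁻¹ * ∑ k, ‖gradient (fun z => loss z (D i k)) θ - gradient (localLoss loss (D i)) θ‖ ^ 2
      ≤ σ ^ 2

/-! ### The aggregation CAF (covariance-bound-agnostic filter) -/

/-- The mean of `x` with respect to the weights `c`. -/
def weightedMean {d n : ℕ} (c : Fin n → ℝ) (x : Fin n → Vec d) : Vec d :=
  (∑ i, c i)⁻¹ • ∑ i, c i • x i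

/-- The covariance matrix of `x` with respect to the weights `c`. -/
def weightedCov {d n : ℕ} (c : Fin n → ℝ) (x : Fin n → Vec d) : Matrix (Fin d) (Fin d) ℝ :=
  (∑ i, c i)⁻¹ • ∑ i, c i •
    Matrix.vecMulVec (x i - weightedMean c x).ofLp (x i - weightedMean c x).ofLp

/-- `eig` is an eigensolver: it sends every positive semidefinite matrix to a unit eigenvector
for its largest eigenvalue (measurably in the matrix). Which one it returns when the
largest eigenvalue is not simple, or which sign, is left to the implementation. -/
structure IsTopEigensolver {d : ℕ} (eig : Matrix (Fin d) (Fin d) ℝ → Vec d) : Prop where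
  measurable : Measurable fun a : Fin d → Fin d → ℝ => eig (Matrix.of a)
  norm_eq_one : ∀ A : Matrix (Fin d) (Fin d) ℝ, A.PosSemidef → ‖eig A‖ = 1
  isTop : ∀ A : Matrix (Fin d) (Fin d) ℝ, A.PosSemidef →
    ∃ lam : ℝ, Matrix.toEuclideanLin A (eig A) = lam • eig A ∧
      ∀ lam' : ℝ, Module.End.HasEigenvalue (Matrix.toEuclideanLin A) lam' → lam' ≤ lam

/-- The loop of CAF. The state consists of the current weights `c` and of the pair `best` holding
the smallest top eigenvalue met so far (`⊤` at the start) and the weighted mean that came with it.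
While the total weight is at least `n - 2f`, the loop computes the weighted mean and covariance,
a top eigenvector `v` and the top eigenvalue `s`, updates `best`, and multiplies the
weight `c i` by `1 - τ i / max {τ j : c j ≠ 0}`, where `τ i = ⟨v, x i - mean⟩²`. It also stops at
`s = 0`, when all points of nonzero weight coincide and `best` cannot improve. The
first argument bounds the number of iterations: as each iteration with `s ≠ 0` makes at least one
nonzero weight vanish, the loop always ends by itself within `n` iterations. -/
def cafLoop {d n : ℕ} (eig : Matrix (Fin d) (Fin d) ℝ → Vec d) (f : ℕ) (x : Fin n → Vec d) :
    ℕ → (Fin n → ℝ) → WithTop ℝ × Vec d → Vec d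
  | 0, _, best => best.2
  | k + 1, c, best =>
    if ∑ i, c i < (n : ℝ) - 2 * f then best.2
    else
      let v : Vec d := eig (weightedCov c x)
      let s : ℝ := inner ℝ v (Matrix.toEuclideanLin (weightedCov c x) v)
      let best' : WithTop ℝ × Vec d :=
        if (s : WithTop ℝ) < best.1 then ((s : WithTop ℝ), weightedMean c x) else best
      let τ : Fin n → ℝ := fun i => (inner ℝ v (x i - weightedMean c x)) ^ 2
      let τmax : ℝ := ⨆ j, if c j = 0 then 0 else τ j
      if s = 0 then best'.2
      else cafLoop eig f x k (fun i => c i * (1 - τ i / τmax)) best'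

/-- `CAF(x_1, …, x_n)`, with at most `f` corrupt inputs. -/
def caf {d n : ℕ} (eig : Matrix (Fin d) (Fin d) ℝ → Vec d) (f : ℕ) (x : Fin n → Vec d) : Vec d :=
  cafLoop eig f x n (fun _ => 1) (⊤, 0)

/-! ### The randomness of the honest workers -/

/-- The pairs of distinct workers, each listed once. -/
abbrev WorkerPair (n : ℕ) : Type := {p : Fin n × Fin n // p.1 < p.2}

/-- The randomness of one round: the secret shared by every pair of workers, the individual
noise of every worker, and the mini-batch of every worker. -/
abbrev Round (d n m : ℕ) : Type :=
  (WorkerPair n → Vec d) × (Fin n → Vec d) × (Fin n → Finset (Fin m))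

/-- The Gaussian law `N(0, s² I_d)`, given through its variance `s² = var`. -/
def isoGaussian (d : ℕ) (var : ℝ) : Measure (Vec d) :=
  (stdGaussian (Vec d)).map fun z => Real.sqrt var • z

/-- A mini-batch of size `b`, uniform among the subsets of size `b` of the `m` data points. -/
def batchLaw {m b : ℕ} (hb : b ≤ m) : Measure (Finset (Fin m)) :=
  (PMF.uniformOfFinset (Finset.powersetCard b Finset.univ)
    (Finset.powersetCard_nonempty.2 (by simpa using hb))).toMeasure

/-- The noise `v^(ij)` that worker `i` adds because of its secret with worker `j`; it is
antisymmetric in `i, j`. -/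
def pairNoise {d n : ℕ} (S : WorkerPair n → Vec d) (i j : Fin n) : Vec d :=
  if h : i < j then S ⟨(i, j), h⟩ else if h : j < i then -S ⟨(j, i), h⟩ else 0

/-! ### The algorithm CafCor -/

/-- The inputs of CafCor. -/
structure CafCor (X : Type u) (d n m : ℕ) where
  /-- the loss `ℓ(θ; x)` -/
  loss : Vec d → X → ℝ
  /-- the bound on the number of malicious workers, used by the aggregation -/
  f : ℕ
  /-- the size of the mini-batches -/
  b : ℕ
  b_le : b ≤ m
  /-- the clipping threshold for gradients at data points; `none` means no clipping -/
  clip : Option ℝ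
  /-- the variances of the correlated and of the individual noise -/
  varCor : ℝ
  varInd : ℝ
  /-- the learning rates and the momentum coefficients -/
  γ : ℕ → ℝ
  β : ℕ → ℝ
  /-- the number of rounds -/
  T : ℕ
  /-- the initial model -/
  θ₀ : Vec d
  /-- the eigensolver inside CAF -/
  eig : Matrix (Fin d) (Fin d) ℝ → Vec d

/-- Clipping: `g` is scaled by `min {1, C / ‖g‖}`. -/
def clipGrad {d : ℕ} : Option ℝ → Vec d → Vec d
  | none, g => g
  | some C, g => min 1 (C / ‖g‖) • g

/-- The situation at the start of a round `t`: the model `θ_t`, the momenta `m_t^(i)`, and the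
messages sent by all workers in the rounds before `t` (with `0` in the later rows). -/
structure RoundState (d n : ℕ) where
  θ : Vec d
  mom : Fin n → Vec d
  log : ℕ → Fin n → Vec d

namespace CafCor

variable {X : Type u} {d n m : ℕ}

/-- The law of the randomness: all secrets, individual noises and mini-batches are independent,
over the workers and over the rounds. -/
def law (A : CafCor X d n m) : Measure (ℕ → Round d n m) :=
  Measure.infinitePi fun _ : ℕ =>
    (Measure.pi fun _ : WorkerPair n => isoGaussian d A.varCor).prod
      ((Measure.pi fun _ : Fin n => isoGaussian d A.varInd).prod
        (Measure.pi fun _ : Fin n => batchLaw A.b_le))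

/-- The noisy mini-batch gradient of a worker `i` with data `Di` at the model `θ`. -/
def noisyGrad (A : CafCor X d n m) (Di : Fin m → X) (i : Fin n) (r : Round d n m)
    (θ : Vec d) : Vec d :=
  (A.b : ℝ)⁻¹ • ∑ k ∈ r.2.2 i, clipGrad A.clip (gradient (fun z => A.loss z (Di k)) θ)
    + ∑ j, pairNoise r.1 i j + r.2.1 i

/-- The messages that reach the server in a round: the momenta of the honest workers, and
whatever the malicious workers send. A malicious worker may use the messages of the earlier rounds
and the honest messages of the current round (row `t` of the first argument of `adv t`,
with `0` for the malicious workers). -/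
def messages (H : Finset (Fin n)) (adv : ℕ → (ℕ → Fin n → Vec d) → Fin n → Vec d) (t : ℕ)
    (s : RoundState d n) : Fin n → Vec d :=
  fun i => if i ∈ H then s.mom i
    else adv t (Function.update s.log t fun j => if j ∈ H then s.mom j else 0) i

/-- An execution of CafCor on the data `D` with honest workers `H`, strategy `adv` of the
malicious workers, and randomness `ω`. The momenta start at `m_0 = 0`; in round `t` the server
broadcasts `θ_t`, the workers send `m_t`, the server moves to `θ_{t+1} = θ_t - γ_t CAF(messages)`,
and then `m_{t+1} = β_t m_t + (1 - β_t) g̃_{t+1}`, where `g̃_{t+1}` is the noisy gradient at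
`θ_{t+1}`. -/
def run (A : CafCor X d n m) (H : Finset (Fin n)) (D : Fin n → Fin m → X)
    (adv : ℕ → (ℕ → Fin n → Vec d) → Fin n → Vec d) (ω : ℕ → Round d n m) :
    ℕ → RoundState d n
  | 0 => ⟨A.θ₀, 0, 0⟩
  | t + 1 =>
    let s := run A H D adv ω t
    let msg := messages H adv t s
    let θ' := s.θ - A.γ t • caf A.eig A.f msg
    ⟨θ', fun i => A.β t • s.mom i + (1 - A.β t) • A.noisyGrad (D i) i (ω (t + 1)) θ',
      Function.update s.log t msg⟩

/-- The transcript of all communications: the models broadcast by the server (and the output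
`θ_T`), and the messages sent by the workers. -/
def transcript (A : CafCor X d n m) (H : Finset (Fin n)) (D : Fin n → Fin m → X)
    (adv : ℕ → (ℕ → Fin n → Vec d) → Fin n → Vec d) (ω : ℕ → Round d n m) :
    (Fin (A.T + 1) → Vec d) × (Fin A.T → Fin n → Vec d) :=
  (fun t => (A.run H D adv ω t).θ, fun t => (A.run H D adv ω A.T).log t)

/-! ### Privacy -/

/-- Overwrite the secrets of the pairs in `known` by the values `s`. As all secrets are
independent, applying this to the randomness turns its law into the conditional law given that
the secrets in `known` take the values `s`. -/
def reveal (known : Set (WorkerPair n)) (s : ℕ → WorkerPair n → Vec d)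
    (ω : ℕ → Round d n m) : ℕ → Round d n m :=
  open Classical in
  fun t => (fun p => if p ∈ known then s t p else (ω t).1 p, (ω t).2)

/-- Two datasets are adjacent if they differ in the local data of at most one worker. -/
def Adjacent (D D' : Fin n → Fin m → X) : Prop :=
  ∃ i, ∀ j, j ≠ i → D j = D' j

/-- The secrets shared with at least one malicious worker. -/
def maliciousSecrets (H : Finset (Fin n)) : Set (WorkerPair n) :=
  {p | p.1.1 ∉ H ∨ p.1.2 ∉ H}

/-- `(ε, δ)`-SecLDP against a curious server that knows the secrets in `known`: given any values
`s` of these secrets, the transcript is `(ε, δ)`-differentially private. The strategy `adv` of the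
malicious workers is arbitrary and may depend on everything that they and the server see;
it may depend on `s` (and on private coins, which are then conditioned upon) since it is
quantified after `s`. -/
def SecLDP (A : CafCor X d n m) (H : Finset (Fin n)) (known : Set (WorkerPair n))
    (ε δ : ℝ) : Prop :=
  ∀ s : ℕ → WorkerPair n → Vec d,
  ∀ adv : ℕ → (ℕ → Fin n → Vec d) → Fin n → Vec d, (∀ t, Measurable (adv t)) →
  ∀ D D' : Fin n → Fin m → X, Adjacent D D' →
  ∀ Y : Set ((Fin (A.T + 1) → Vec d) × (Fin A.T → Fin n → Vec d)), MeasurableSet Y →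
    A.law {ω | A.transcript H D adv (reveal known s ω) ∈ Y}
      ≤ ENNReal.ofReal (Real.exp ε) * A.law {ω | A.transcript H D' adv (reveal known s ω) ∈ Y}
        + ENNReal.ofReal δ

/-! ### Robustness -/

/-- An omniscient adversary: its messages in round `t` are arbitrary (measurable) functions of
all the randomness of the rounds up to `t`, and hence of everything that happened so far; they
cannot depend on the randomness of later rounds. -/
structure Adversary (d n m : ℕ) where
  msg : ℕ → (ℕ → Round d n m) → Fin n → Vec d
  measurable : ∀ t, Measurable (msg t)
  nonanticipating : ∀ t ω ω', (∀ s ≤ t, ω s = ω' s) → msg t ω = msg t ω'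

/-- The execution of CafCor against an omniscient adversary. -/
def runAgainst (A : CafCor X d n m) (H : Finset (Fin n)) (D : Fin n → Fin m → X)
    (a : Adversary d n m) (ω : ℕ → Round d n m) (t : ℕ) : RoundState d n :=
  A.run H D (fun t _ => a.msg t ω) ω t

/-- The excess honest loss `L_H(θ_T) - inf L_H` of the output. -/
def excessLoss (A : CafCor X d n m) (H : Finset (Fin n)) (D : Fin n → Fin m → X)
    (a : Adversary d n m) (ω : ℕ → Round d n m) : ℝ :=
  honestLoss A.loss H D (A.runAgainst H D a ω A.T).θ - ⨅ θ : Vec d, honestLoss A.loss H D θ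

/-- `(f, ϱ)`-robustness, with honest workers `H` and data `D`: against every adversary, the
expected excess honest loss of the output is at most `ϱ`. -/
def IsRobust (A : CafCor X d n m) (H : Finset (Fin n)) (D : Fin n → Fin m → X) (ϱ : ℝ) : Prop :=
  ∀ a : Adversary d n m,
    Integrable (A.excessLoss H D a) A.law ∧ ∫ ω, A.excessLoss H D a ω ∂A.law ≤ ϱ

/-- The executions in which the clipping never changes a gradient of an honest worker. If
all gradients of the loss at honest data points are bounded by the threshold, these are all
executions. -/
def unclipped (A : CafCor X d n m) (H : Finset (Fin n)) (D : Fin n → Fin m → X)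
    (a : Adversary d n m) : Set (ℕ → Round d n m) :=
  {ω | ∀ t, 1 ≤ t → t < A.T → ∀ i ∈ H, ∀ k ∈ (ω t).2.2 i,
    clipGrad A.clip (gradient (fun z => A.loss z (D i k)) (A.runAgainst H D a ω t).θ)
      = gradient (fun z => A.loss z (D i k)) (A.runAgainst H D a ω t).θ}

/-- `(f, ϱ)`-robustness as far as the executions without active clipping are concerned. -/
def IsRobustWhenUnclipped (A : CafCor X d n m) (H : Finset (Fin n)) (D : Fin n → Fin m → X)
    (ϱ : ℝ) : Prop :=
  ∀ a : Adversary d n m,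
    IntegrableOn (A.excessLoss H D a) (A.unclipped H D a) A.law ∧
      ∫ ω in A.unclipped H D a, A.excessLoss H D a ω ∂A.law ≤ ϱ

end CafCor

/-- The noise variance `32 C² T log(1/δ) / (ε² (n - f))`. -/
def noiseVar (C : ℝ) (T : ℕ) (δ ε : ℝ) (n f : ℕ) : ℝ :=
  32 * C ^ 2 * T * Real.log (1 / δ) / (ε ^ 2 * ((n : ℝ) - f))

/-- The learning rates `γ_t = 10 / (μ (t + 240 L / μ))` of the strongly convex setting. -/
def stepSize (L μ : ℝ) (t : ℕ) : ℝ := 10 / (μ * (t + 240 * (L / μ)))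

/-- CafCor with `σ_cor² = σ_ind² = noiseVar`, learning rates `stepSize` and momentum coefficients
`β_t = 1 - 24 L γ_t`. -/
def tunedCafCor {X : Type u} {d n m : ℕ} (loss : Vec d → X → ℝ) (f b : ℕ) (hb : b ≤ m)
    (clip : Option ℝ) (C ε δ L μ : ℝ) (T : ℕ) (θ₀ : Vec d)
    (eig : Matrix (Fin d) (Fin d) ℝ → Vec d) : CafCor X d n m where
  loss := loss
  f := f
  b := b
  b_le := hb
  clip := clip
  varCor := noiseVar C T δ ε n f
  varInd := noiseVar C T δ ε n f
  γ := stepSize L μ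
  β := fun t => 1 - 24 * L * stepSize L μ t
  T := T
  θ₀ := θ₀
  eig := eig

/-- The error `f G²/(n μ) + (L/μ²) (C² d log(1/δ)/(ε² n) · (f+1)/n + C² log(1/δ)/ε² · f/n)`. -/
def tradeoffError (d n f : ℕ) (C ε δ L μ G : ℝ) : ℝ :=
  f * G ^ 2 / (n * μ)
    + L / μ ^ 2 * (C ^ 2 * d * Real.log (1 / δ) / (ε ^ 2 * n) * ((f + 1) / n)
        + C ^ 2 * Real.log (1 / δ) / ε ^ 2 * (f / n))

end

/-! Write h for the number of honest workers and v for the common noise variance.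

Privacy. For fixed values of the revealed secrets, the transcript is a function of a Markov process
driven by independent rounds, so it suffices to compare one round on the two datasets and to
compose. If the clipped gradient of an honest worker i changes by Δ, with ‖Δ‖ ≤ 2C, the Gaussian
noise of all honest workers can be translated to hide the change: with a_j = (1 + 1_{j=i})/(h+1),
move the secret of honest j, k by (a_j - a_k)Δ and the individual noise of j by a_jΔ. The total
noise of j then moves by Δ if j = i and by 0 otherwise (`dpNoise_shift`), at squared length
2‖Δ‖²/(h+1) (`norm_shift_sq`). The moments of the Gaussian likelihood ratio are explicit and their
bounds multiply over the rounds (`exists_density_markovPath`). The inequality z ≤ e^ε + e^{-aε}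
z^{1+a} with a = 2 log(1/δ)/ε converts the moment of order 1+a into (ε, δ).

Aggregation. CAF keeps the invariant that honest inputs have lost no more weight than the others. As
long as the top eigenvalue exceeds a constant multiple of the honest variance bound S, at least half
of the variance in that direction comes from outside H, because there the total weight is smaller by
a factor 1+η; hence a filter step keeps the invariant and removes an input. Once the eigenvalue is
small, the weighted mean of every later admissible weight is good: weight at most 2f has been
removed in all and at most f lies outside H, and Cauchy–Schwarz gives a squared error of order (f/n)
S (`norm_caf_sub_sq_le`).

Noise. The joint covariance of the workers' noises is v((n+1)I - 11ᵀ) in every coordinate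
(`lintegral_exp_inner_dpNoise`). Thus it is at most v(n+1) in any direction, but only v h(f+1) for
the sum over H: the correlated noises cancel in the honest mean, apart from those shared with the f
others. The honest mean therefore has noise of order d v (f+1)/n, while the scatter seen by CAF is a
top eigenvalue of expected order (n+d) v n (`exists_integral_sum_inner_sq_le`), damped by momentum.

Convergence. With F the honest loss and m̄ the honest mean momentum, F(θ) - inf F + L⁻¹‖m̄ - ∇F(θ)‖²
contracts by 1 - μγ_t in each round, up to γ_t times the squared aggregation error and γ_t² times
the variance of the mean noise (`lyapunov_step`). Heterogeneity contributes a constant (f/n)G² to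
the aggregation error; the random parts carry an additional factor γ_t, by the averaging of momentum
(`momentumWeight_le`). The resulting recursion (`recursion_le`) leaves (f/n)G²/μ plus a term of
order B/(μ²T). As B contains v, which is proportional to T, the privacy noise leaves a nonvanishing
error, whereas the initial error and σ² disappear for large T.

Clipping. On the event that clipping is inactive, the clipped and the unclipped executions coincide;
since the excess loss is nonnegative, restricting its integral to this event can only decrease it.
-/

/-! ### Changes of variables with a density -/

/-- The image of `μ` under `T` has density `ζ` with respect to `μ`. -/
structure HasImageDensity {E : Type*} [MeasurableSpace E] (μ : Measure E) (T : E → E)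
    (ζ : E → ℝ≥0∞) : Prop where
  measurable_map : Measurable T
  measurable_density : Measurable ζ
  map_eq : μ.map T = μ.withDensity ζ

namespace HasImageDensity

variable {E E' : Type*} [MeasurableSpace E] [MeasurableSpace E'] {μ : Measure E} {T : E → E}
  {ζ : E → ℝ≥0∞}

theorem lintegral_comp (h : HasImageDensity μ T ζ) {F : E → ℝ≥0∞} (hF : Measurable F) :
    ∫⁻ x, F (T x) ∂μ = ∫⁻ x, ζ x * F x ∂μ := by
  rw [← lintegral_map hF h.measurable_map, h.map_eq,
    lintegral_withDensity_eq_lintegral_mul _ h.measurable_density hF]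
  rfl

/-- A change of variables descends along φ when φ intertwines the two maps and the density factors
through φ. This carries translations from products of real Gaussians to `stdGaussian`, and from
there to its rescalings. -/
theorem map {φ : E → E'} (hφ : Measurable φ) {T' : E' → E'} (hT' : Measurable T')
    {ζ' : E' → ℝ≥0∞} (hζ' : Measurable ζ') (h : HasImageDensity μ T fun x => ζ' (φ x))
    (hT : ∀ x, φ (T x) = T' (φ x)) : HasImageDensity (μ.map φ) T' ζ' := by
  refine ⟨hT', hζ', ?_⟩
  rw [Measure.map_map hT' hφ, show T' ∘ φ = φ ∘ T from funext fun x => (hT x).symm,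
    ← Measure.map_map hφ h.measurable_map, h.map_eq]
  ext s hs
  rw [Measure.map_apply hφ hs, withDensity_apply _ (hφ hs), withDensity_apply _ hs,
    setLIntegral_map hs hζ' hφ]

end HasImageDensity

theorem lintegral_pi_prod {ι : Type*} [Fintype ι] {E : ι → Type*} [∀ i, MeasurableSpace (E i)]
    (μ : ∀ i, Measure (E i)) [∀ i, IsProbabilityMeasure (μ i)] {f : ∀ i, E i → ℝ≥0∞}
    (hf : ∀ i, Measurable (f i)) :
    ∫⁻ x, ∏ i, f i (x i) ∂Measure.pi μ = ∏ i, ∫⁻ x, f i x ∂μ i := by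
  rw [lintegral_prod_eq_prod_lintegral_of_indepFun Finset.univ
    (fun i (x : ∀ i, E i) => f i (x i)) (iIndepFun_pi fun i => (hf i).aemeasurable)
    fun i => (hf i).comp (measurable_pi_apply i)]
  exact Finset.prod_congr rfl fun i _ => (measurePreserving_eval μ i).lintegral_comp (hf i)

theorem HasImageDensity.pi {ι : Type*} [Fintype ι] {E : ι → Type*} [∀ i, MeasurableSpace (E i)]
    {μ : ∀ i, Measure (E i)} [∀ i, IsProbabilityMeasure (μ i)] {T : ∀ i, E i → E i}
    {ζ : ∀ i, E i → ℝ≥0∞} (h : ∀ i, HasImageDensity (μ i) (T i) (ζ i)) :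
    HasImageDensity (Measure.pi μ) (fun x i => T i (x i)) fun x => ∏ i, ζ i (x i) := by
  have hT := fun i => (h i).measurable_map
  have hζ := fun i => (h i).measurable_density
  have (i : ι) : IsProbabilityMeasure ((μ i).map (T i)) :=
    Measure.isProbabilityMeasure_map (hT i).aemeasurable
  refine ⟨by fun_prop, by fun_prop, ?_⟩
  rw [Measure.pi_map_pi fun i => (hT i).aemeasurable]
  refine Measure.pi_eq fun s hs => ?_
  rw [withDensity_apply _ (.univ_pi hs), ← lintegral_indicator (.univ_pi hs)]
  have (x : ∀ i, E i) : (Set.univ.pi s).indicator (fun x => ∏ i, ζ i (x i)) x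
      = ∏ i, (s i).indicator (ζ i) (x i) := by
    classical
    by_cases hx : x ∈ Set.univ.pi s
    · rw [Set.indicator_of_mem hx]
      exact Finset.prod_congr rfl fun i _ =>
        (Set.indicator_of_mem (hx i (Set.mem_univ i)) _).symm
    · rw [Set.indicator_of_notMem hx]
      simp only [Set.mem_pi, Set.mem_univ, true_imp_iff, not_forall] at hx
      obtain ⟨i, hi⟩ := hx
      exact (Finset.prod_eq_zero (Finset.mem_univ i) (Set.indicator_of_notMem hi _)).symm
  simp_rw [this]
  rw [lintegral_pi_prod μ fun i => (hζ i).indicator (hs i)]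
  refine Finset.prod_congr rfl fun i _ => ?_
  rw [lintegral_indicator (hs i), ← withDensity_apply _ (hs i), (h i).map_eq]

/-! ### Translations of Gaussian laws -/

theorem hasImageDensity_gaussianReal (u : ℝ) :
    HasImageDensity (gaussianReal 0 1) (fun x => x + u)
      fun x => ENNReal.ofReal (Real.exp (u * x - u ^ 2 / 2)) := by
  refine ⟨by fun_prop, by fun_prop, ?_⟩
  rw [gaussianReal_map_add_const, gaussianReal_of_var_ne_zero _ one_ne_zero,
    gaussianReal_of_var_ne_zero _ one_ne_zero, ← withDensity_mul _ (measurable_gaussianPDF _ _)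
      (by fun_prop)]
  congr 1
  ext x
  simp only [Pi.mul_apply, gaussianPDF, gaussianPDFReal]
  rw [← ENNReal.ofReal_mul (by positivity), mul_assoc (Real.sqrt _)⁻¹, ← Real.exp_add]
  congr 3
  simp
  ring

theorem hasImageDensity_stdGaussian {d : ℕ} (u : Vec d) :
    HasImageDensity (stdGaussian (Vec d)) (fun x => x + u)
      fun x => ENNReal.ofReal (Real.exp (inner ℝ u x - ‖u‖ ^ 2 / 2)) := by
  rw [← map_pi_eq_stdGaussian]
  have h := HasImageDensity.pi fun i : Fin d => hasImageDensity_gaussianReal (u i)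
  refine HasImageDensity.map (T := fun x i => x i + u i) (by fun_prop) (by fun_prop)
    (by fun_prop) ?_ (fun x => ?_)
  · convert h using 2 with x
    rw [← ENNReal.ofReal_prod_of_nonneg fun i _ => (Real.exp_pos _).le, ← Real.exp_sum,
      Finset.sum_sub_distrib, ← Finset.sum_div, EuclideanSpace.real_norm_sq_eq]
    simp [PiLp.inner_apply, mul_comm]
  · ext i
    simp

instance isProbabilityMeasure_isoGaussian (d : ℕ) (v : ℝ) :
    IsProbabilityMeasure (isoGaussian d v) :=
  Measure.isProbabilityMeasure_map (by fun_prop)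

instance isGaussian_isoGaussian (d : ℕ) (v : ℝ) : IsGaussian (isoGaussian d v) := by
  have : (fun z : Vec d => Real.sqrt v • z)
      = ⇑(Real.sqrt v • ContinuousLinearMap.id ℝ (Vec d) : Vec d →L[ℝ] Vec d) := by
    ext; simp
  rw [isoGaussian, this]
  infer_instance

theorem integral_id_isoGaussian (d : ℕ) (v : ℝ) : ∫ x, x ∂isoGaussian d v = 0 := by
  rw [isoGaussian, integral_map (by fun_prop) (by fun_prop), integral_smul,
    integral_id_stdGaussian, smul_zero]

theorem hasImageDensity_isoGaussian {d : ℕ} {v : ℝ} (hv : 0 < v) (u : Vec d) :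
    HasImageDensity (isoGaussian d v) (fun x => x + u)
      fun x => ENNReal.ofReal (Real.exp (inner ℝ u x / v - ‖u‖ ^ 2 / (2 * v))) := by
  have hs := Real.sqrt_pos.2 hv
  have hsq := Real.sq_sqrt hv.le
  refine HasImageDensity.map (T := fun x => x + (Real.sqrt v)⁻¹ • u) (by fun_prop) (by fun_prop)
    (by fun_prop) ?_ (fun x => ?_)
  · convert hasImageDensity_stdGaussian ((Real.sqrt v)⁻¹ • u) using 5 with x
    · rw [inner_smul_left, inner_smul_right]
      simp only [conj_trivial]
      rw [div_eq_iff hv.ne']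
      nth_rw 3 [← hsq]
      field_simp
    · rw [norm_smul, mul_pow, norm_inv, Real.norm_of_nonneg hs.le, inv_pow, hsq]
      field_simp
  · simp [smul_smul, hs.ne']

theorem hasImageDensity_pi_isoGaussian {ι : Type*} [Fintype ι] {d : ℕ} {v : ℝ} (hv : 0 < v)
    (u : ι → Vec d) :
    HasImageDensity (Measure.pi fun _ : ι => isoGaussian d v) (fun x => x + u)
      fun x => ENNReal.ofReal
        (Real.exp ((∑ i, inner ℝ (u i) (x i)) / v - (∑ i, ‖u i‖ ^ 2) / (2 * v))) := by
  refine ⟨by fun_prop, by fun_prop, ?_⟩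
  convert (HasImageDensity.pi fun i => hasImageDensity_isoGaussian hv (u i)).map_eq using 3 with x
  · rfl
  rw [← ENNReal.ofReal_prod_of_nonneg fun i _ => (Real.exp_pos _).le, ← Real.exp_sum,
    Finset.sum_sub_distrib, ← Finset.sum_div, ← Finset.sum_div]

/-- The density of the translation by v w has total mass one, and it is the exponential in question
up to a constant. -/
theorem lintegral_exp_inner_pi_isoGaussian {ι : Type*} [Fintype ι] {d : ℕ} {v : ℝ} (hv : 0 < v)
    (w : ι → Vec d) :
    ∫⁻ x, ENNReal.ofReal (Real.exp (∑ i, inner ℝ (w i) (x i)))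
        ∂Measure.pi (fun _ : ι => isoGaussian d v)
      = ENNReal.ofReal (Real.exp (v / 2 * ∑ i, ‖w i‖ ^ 2)) := by
  have h := (hasImageDensity_pi_isoGaussian hv fun i => v • w i).lintegral_comp
    (F := fun _ => ENNReal.ofReal (Real.exp (v / 2 * ∑ i, ‖w i‖ ^ 2))) (by fun_prop)
  simp only [lintegral_const, measure_univ, mul_one] at h
  rw [h]
  refine lintegral_congr fun x => ?_
  rw [← ENNReal.ofReal_mul (Real.exp_pos _).le, ← Real.exp_add]
  congr 2
  simp only [inner_smul_left, norm_smul, conj_trivial, mul_pow, ← Finset.mul_sum,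
    Real.norm_of_nonneg hv.le]
  field_simp
  ring

/-! ### Resampling one coordinate of an i.i.d. sequence -/

theorem measurePreserving_update_infinitePi {R : Type*} [MeasurableSpace R] (ν : Measure R)
    [IsProbabilityMeasure ν] (k : ℕ) :
    MeasurePreserving (fun p : (ℕ → R) × R => Function.update p.1 k p.2)
      ((Measure.infinitePi fun _ : ℕ => ν).prod ν) (Measure.infinitePi fun _ : ℕ => ν) := by
  have hm : Measurable (fun p : (ℕ → R) × R => Function.update p.1 k p.2) :=
    measurable_pi_iff.2 fun j => by
      by_cases h : j = k
      · subst h; simpa using measurable_snd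
      · simp only [Function.update_of_ne h]
        fun_prop
  refine ⟨hm, Measure.eq_infinitePi _ fun s t ht => ?_⟩
  rw [Measure.map_apply hm (.pi s.countable_toSet fun i _ => ht i)]
  have : (fun p : (ℕ → R) × R => Function.update p.1 k p.2) ⁻¹' (s : Set ℕ).pi t
      = ((s.erase k : Finset ℕ) : Set ℕ).pi t ×ˢ (if k ∈ s then t k else Set.univ) := by
    ext ⟨ω, r⟩
    simp only [Set.mem_preimage, Set.mem_pi, Finset.mem_coe, Set.mem_prod, Finset.mem_erase]
    constructor
    · intro h
      refine ⟨fun i hi => by simpa [Function.update_of_ne hi.1] using h i hi.2, ?_⟩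
      split_ifs with hk
      · simpa using h k hk
      · trivial
    · rintro ⟨h1, h2⟩ i hi
      by_cases hik : i = k
      · subst hik; simpa [hi] using h2
      · simpa [Function.update_of_ne hik] using h1 i ⟨hik, hi⟩
  rw [this, Measure.prod_prod, Measure.infinitePi_pi _ fun i _ => ht i]
  split_ifs with hk
  · exact Finset.prod_erase_mul _ _ hk
  · simp [Finset.erase_eq_of_notMem hk]

/-- Integrates out one round while all others are frozen. It takes the place of conditional
expectations given the past, both in the privacy and in the convergence argument. -/
theorem lintegral_update_infinitePi {R : Type*} [MeasurableSpace R] (ν : Measure R)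
    [IsProbabilityMeasure ν] (k : ℕ) {F : (ℕ → R) → ℝ≥0∞} (hF : Measurable F) :
    ∫⁻ ω, F ω ∂Measure.infinitePi (fun _ : ℕ => ν)
      = ∫⁻ ω, ∫⁻ r, F (Function.update ω k r) ∂ν ∂Measure.infinitePi (fun _ : ℕ => ν) := by
  have h := measurePreserving_update_infinitePi ν k
  have hm : Measurable fun p : (ℕ → R) × R => F (Function.update p.1 k p.2) :=
    hF.comp h.measurable
  rw [← h.lintegral_comp hF, lintegral_prod _ hm.aemeasurable]

/-! ### Adaptive composition -/

/-- The path of a Markov process that is driven by the noise `ω 1, ω 2, …`. -/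
def markovPath {S R : Type*} (step : ℕ → S → R → S) (x : S) (ω : ℕ → R) : ℕ → S
  | 0 => x
  | t + 1 => step t (markovPath step x ω t) (ω (t + 1))

theorem measurable_markovPath {S R : Type*} [MeasurableSpace S] [MeasurableSpace R]
    {step : ℕ → S → R → S} (hstep : ∀ t, Measurable fun p : S × R => step t p.1 p.2) (x : S)
    (t : ℕ) : Measurable fun ω => markovPath step x ω t := by
  induction t with
  | zero => exact measurable_const
  | succ t ih => exact (hstep t).comp (ih.prodMk (measurable_pi_apply (t + 1)))

theorem markovPath_update {S R : Type*} (step : ℕ → S → R → S) (x : S) (ω : ℕ → R) (r : R)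
    {t k : ℕ} (h : t < k) :
    markovPath step x (Function.update ω k r) t = markovPath step x ω t := by
  induction t with
  | zero => rfl
  | succ t ih =>
    simp only [markovPath, ih (Nat.lt_of_succ_lt h), Function.update_of_ne h.ne]

/-- If each step of a process is absolutely continuous with respect to the step of another one,
with density `z` whose moment of order `α` is at most `c`, then so are the processes, and the
moments multiply. -/
theorem exists_density_markovPath {S R : Type*} [MeasurableSpace S] [MeasurableSpace R]
    (ν : Measure R) [IsProbabilityMeasure ν] {step step' : ℕ → S → R → S}
    (hstep : ∀ t, Measurable fun p : S × R => step t p.1 p.2)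
    (hstep' : ∀ t, Measurable fun p : S × R => step' t p.1 p.2)
    {z : ℕ → S → R → ℝ≥0∞} (hz : ∀ t, Measurable fun p : S × R => z t p.1 p.2)
    (hdens : ∀ t s (F : S → ℝ≥0∞), Measurable F →
      ∫⁻ r, F (step t s r) ∂ν = ∫⁻ r, z t s r * F (step' t s r) ∂ν)
    {α : ℝ} (hα : 0 ≤ α) {c : ℝ≥0∞} (hc : ∀ t s, ∫⁻ r, z t s r ^ α ∂ν ≤ c) (x : S) (N : ℕ) :
    ∃ Z : (ℕ → R) → ℝ≥0∞, Measurable Z ∧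
      (∀ ω k r, N < k → Z (Function.update ω k r) = Z ω) ∧
      (∀ F : S → ℝ≥0∞, Measurable F →
        ∫⁻ ω, F (markovPath step x ω N) ∂Measure.infinitePi (fun _ : ℕ => ν)
          = ∫⁻ ω, Z ω * F (markovPath step' x ω N) ∂Measure.infinitePi (fun _ : ℕ => ν)) ∧
      ∫⁻ ω, Z ω ^ α ∂Measure.infinitePi (fun _ : ℕ => ν) ≤ c ^ N := by
  induction N with
  | zero =>
    refine ⟨fun _ => 1, measurable_const, fun _ _ _ _ => rfl, fun F _ => ?_, ?_⟩
    · simp [markovPath]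
    · simp
  | succ N ih =>
    obtain ⟨Z, hZm, hZu, hZF, hZc⟩ := ih
    have hp := measurable_markovPath hstep x N
    have hp' := measurable_markovPath hstep' x N
    have hzN : Measurable fun ω : ℕ → R => z N (markovPath step' x ω N) (ω (N + 1)) :=
      (hz N).comp (hp'.prodMk (measurable_pi_apply (N + 1)))
    -- The new factor is evaluated along the path of `step'`, which is the one carrying the density.
    -- It is the only factor that sees ω (N+1), so resampling that coordinate separates it from `Z`.
    refine ⟨fun ω => Z ω * z N (markovPath step' x ω N) (ω (N + 1)), hZm.mul hzN,
      fun ω k r hk => ?_, fun F hF => ?_, ?_⟩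
    · beta_reduce
      rw [hZu ω k r (Nat.lt_of_succ_lt hk), markovPath_update _ _ _ _ (Nat.lt_of_succ_lt hk),
        Function.update_of_ne hk.ne]
    · have hG : Measurable fun s => ∫⁻ r, F (step N s r) ∂ν :=
        (hF.comp (hstep N)).lintegral_prod_right'
      have h1 : Measurable fun ω => F (markovPath step x ω (N + 1)) :=
        hF.comp (measurable_markovPath hstep x (N + 1))
      have h2 : Measurable fun ω => F (markovPath step' x ω (N + 1)) :=
        hF.comp (measurable_markovPath hstep' x (N + 1))
      rw [lintegral_update_infinitePi ν (N + 1) h1,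
        lintegral_update_infinitePi ν (N + 1) ((hZm.fun_mul hzN).fun_mul h2)]
      simp only [markovPath, markovPath_update _ _ _ _ (Nat.lt_succ_self N),
        Function.update_self, hZu _ _ _ (Nat.lt_succ_self N)]
      rw [hZF _ hG]
      refine lintegral_congr fun ω => ?_
      rw [hdens N _ F hF, ← lintegral_const_mul]
      · simp only [mul_assoc]
      · have hz1 : Measurable fun r => z N (markovPath step' x ω N) r :=
          (hz N).comp measurable_prodMk_left
        have hF1 : Measurable fun r => F (step' N (markovPath step' x ω N) r) :=
          hF.comp ((hstep' N).comp measurable_prodMk_left)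
        exact hz1.mul hF1
    · rw [lintegral_update_infinitePi ν (N + 1) ((hZm.fun_mul hzN).pow_const α)]
      simp only [markovPath_update _ _ _ _ (Nat.lt_succ_self N), Function.update_self,
        hZu _ _ _ (Nat.lt_succ_self N), ENNReal.mul_rpow_of_nonneg _ _ hα]
      calc ∫⁻ ω, ∫⁻ r, Z ω ^ α * z N (markovPath step' x ω N) r ^ α ∂ν
              ∂Measure.infinitePi (fun _ : ℕ => ν)
          ≤ ∫⁻ ω, Z ω ^ α * c ∂Measure.infinitePi (fun _ : ℕ => ν) := by
            refine lintegral_mono fun ω => ?_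
            rw [lintegral_const_mul]
            · gcongr
              exact hc N _
            · exact ((hz N).comp measurable_prodMk_left).pow_const α
        _ = (∫⁻ ω, Z ω ^ α ∂Measure.infinitePi (fun _ : ℕ => ν)) * c :=
            lintegral_mul_const _ (hZm.pow_const α)
        _ ≤ c ^ N * c := by gcongr
        _ = c ^ (N + 1) := (pow_succ c N).symm

/-- Where z exceeds e^ε, one has 1 ≤ e^{-aε} z^a. -/
theorem ENNReal.le_exp_add_mul_rpow (z : ℝ≥0∞) (ε : ℝ) {a : ℝ} (ha : 0 < a) :
    z ≤ ENNReal.ofReal (Real.exp ε) + ENNReal.ofReal (Real.exp (-(a * ε))) * z ^ (1 + a) := by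
  rcases le_total z (ENNReal.ofReal (Real.exp ε)) with h | h
  · exact h.trans le_self_add
  · refine le_trans ?_ le_add_self
    have h1 : ENNReal.ofReal (Real.exp (a * ε)) ≤ z ^ a := by
      refine le_trans (le_of_eq ?_) (ENNReal.rpow_le_rpow h ha.le)
      rw [ENNReal.ofReal_rpow_of_pos (Real.exp_pos _), ← Real.exp_mul, mul_comm]
    have h2 : 1 ≤ ENNReal.ofReal (Real.exp (-(a * ε))) * z ^ a := by
      refine le_trans (le_of_eq ?_) (mul_le_mul_right h1 _)
      rw [← ENNReal.ofReal_mul (Real.exp_pos _).le, ← Real.exp_add]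
      simp
    rw [ENNReal.rpow_add_of_nonneg _ _ zero_le_one ha.le, ENNReal.rpow_one]
    calc z = z * 1 := (mul_one z).symm
      _ ≤ z * (ENNReal.ofReal (Real.exp (-(a * ε))) * z ^ a) := by gcongr
      _ = _ := by ring

/-- The bound `ENNReal.le_exp_add_mul_rpow`, applied to the density of the path, is integrated over
the event; its second term is then extended to the whole space. -/
theorem measure_markovPath_le {S R : Type*} [MeasurableSpace S] [MeasurableSpace R]
    (ν : Measure R) [IsProbabilityMeasure ν] {step step' : ℕ → S → R → S}
    (hstep : ∀ t, Measurable fun p : S × R => step t p.1 p.2)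
    (hstep' : ∀ t, Measurable fun p : S × R => step' t p.1 p.2)
    {z : ℕ → S → R → ℝ≥0∞} (hz : ∀ t, Measurable fun p : S × R => z t p.1 p.2)
    (hdens : ∀ t s (F : S → ℝ≥0∞), Measurable F →
      ∫⁻ r, F (step t s r) ∂ν = ∫⁻ r, z t s r * F (step' t s r) ∂ν)
    {a : ℝ} (ha : 0 < a) {c : ℝ≥0∞} (hc : ∀ t s, ∫⁻ r, z t s r ^ (1 + a) ∂ν ≤ c) (x : S) (N : ℕ)
    (ε : ℝ) {Y : Set S} (hY : MeasurableSet Y) :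
    Measure.infinitePi (fun _ : ℕ => ν) {ω | markovPath step x ω N ∈ Y}
      ≤ ENNReal.ofReal (Real.exp ε)
          * Measure.infinitePi (fun _ : ℕ => ν) {ω | markovPath step' x ω N ∈ Y}
        + ENNReal.ofReal (Real.exp (-(a * ε))) * c ^ N := by
  obtain ⟨Z, hZm, -, hZF, hZc⟩ := exists_density_markovPath ν hstep hstep' hz hdens
    (by positivity) hc x N
  have hind (st : ℕ → S → R → S) (hst : ∀ t, Measurable fun p : S × R => st t p.1 p.2) :
      ∫⁻ ω, Y.indicator 1 (markovPath st x ω N) ∂Measure.infinitePi (fun _ : ℕ => ν)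
        = Measure.infinitePi (fun _ : ℕ => ν) {ω | markovPath st x ω N ∈ Y} := by
    exact lintegral_indicator_one (measurable_markovPath hst x N hY)
  have hYm : Measurable (Y.indicator (1 : S → ℝ≥0∞)) := measurable_one.indicator hY
  have hYp : Measurable fun ω => Y.indicator (1 : S → ℝ≥0∞) (markovPath step' x ω N) :=
    hYm.comp (measurable_markovPath hstep' x N)
  rw [← hind step hstep, ← hind step' hstep', hZF _ hYm, ← lintegral_const_mul _ hYp]
  calc ∫⁻ ω, Z ω * Y.indicator 1 (markovPath step' x ω N) ∂Measure.infinitePi (fun _ : ℕ => ν)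
      ≤ ∫⁻ ω, (ENNReal.ofReal (Real.exp ε) * Y.indicator 1 (markovPath step' x ω N)
          + ENNReal.ofReal (Real.exp (-(a * ε))) * Z ω ^ (1 + a))
          ∂Measure.infinitePi (fun _ : ℕ => ν) := by
        refine lintegral_mono fun ω => ?_
        by_cases h : markovPath step' x ω N ∈ Y
        · simpa [h] using ENNReal.le_exp_add_mul_rpow (Z ω) ε ha
        · simp [h]
    _ = _ := by
        rw [lintegral_add_right _ ((hZm.pow_const _).const_mul _),
          lintegral_const_mul _ (hZm.pow_const _)]
    _ ≤ _ := by gcongr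

/-! ### Sums over pairs of workers -/

theorem sum_workerPair {M : Type*} [AddCommMonoid M] {n : ℕ} (g : Fin n → Fin n → M) :
    ∑ p : WorkerPair n, g p.1.1 p.1.2 = ∑ i, ∑ j, if i < j then g i j else 0 := by
  rw [← Fintype.sum_prod_type' (f := fun i j => if i < j then g i j else 0), ← Finset.sum_filter]
  exact (Finset.sum_subtype (Finset.univ.filter fun q : Fin n × Fin n => q.1 < q.2)
    (by simp) fun q : Fin n × Fin n => g q.1 q.2).symm

theorem sum_sum_eq_sum_workerPair {M : Type*} [AddCommMonoid M] {n : ℕ} (g : Fin n → Fin n → M) :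
    ∑ i, ∑ j, g i j = ∑ p : WorkerPair n, (g p.1.1 p.1.2 + g p.1.2 p.1.1) + ∑ i, g i i := by
  rw [Finset.sum_add_distrib, sum_workerPair, sum_workerPair fun i j => g j i,
    Finset.sum_comm (f := fun i j => if i < j then g j i else 0), ← Finset.sum_add_distrib,
    ← Finset.sum_add_distrib]
  refine Finset.sum_congr rfl fun i _ => ?_
  have hi : g i i = ∑ j, if i = j then g i j else 0 := by simp
  rw [hi, ← Finset.sum_add_distrib, ← Finset.sum_add_distrib]
  refine Finset.sum_congr rfl fun j _ => ?_
  rcases lt_trichotomy i j with h | h | h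
  · simp [h, h.not_gt, h.ne]
  · simp [h]
  · simp [h, h.not_gt, h.ne']

/-- The quadratic form of the Laplacian of the complete graph. The negative term is what makes
correlated noise cancel in sums over workers. -/
theorem sum_workerPair_norm_sub_sq {E : Type*} [NormedAddCommGroup E] [InnerProductSpace ℝ E]
    {n : ℕ} (w : Fin n → E) :
    ∑ p : WorkerPair n, ‖w p.1.1 - w p.1.2‖ ^ 2 = n * ∑ i, ‖w i‖ ^ 2 - ‖∑ i, w i‖ ^ 2 := by
  have h1 := sum_sum_eq_sum_workerPair fun i j => ‖w i - w j‖ ^ 2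
  have h2 : ∑ i, ∑ j, ‖w i - w j‖ ^ 2 = 2 * (n * ∑ i, ‖w i‖ ^ 2) - 2 * ‖∑ i, w i‖ ^ 2 := by
    have h3 : ‖∑ i, w i‖ ^ 2 = ∑ i, ∑ j, inner ℝ (w i) (w j) := by
      rw [← real_inner_self_eq_norm_sq, sum_inner]
      simp_rw [inner_sum]
    simp_rw [norm_sub_sq_real, Finset.sum_add_distrib, Finset.sum_sub_distrib, ← Finset.mul_sum]
    rw [h3]
    simp only [Finset.sum_const, Finset.card_univ, Fintype.card_fin, nsmul_eq_mul]
    rw [← Finset.mul_sum]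
    ring
  simp_rw [norm_sub_rev (w (Prod.snd _)), ← two_mul, ← Finset.mul_sum] at h1
  simp only [sub_self, norm_zero, ne_eq, OfNat.ofNat_ne_zero, not_false_eq_true, zero_pow,
    Finset.sum_const_zero, add_zero] at h1
  linarith

/-! ### The noise of one round -/

theorem pairNoise_of_lt {d n : ℕ} (S : WorkerPair n → Vec d) (p : WorkerPair n) :
    pairNoise S p.1.1 p.1.2 = S p := by
  simp [pairNoise, p.2]

theorem pairNoise_of_gt {d n : ℕ} (S : WorkerPair n → Vec d) (p : WorkerPair n) :
    pairNoise S p.1.2 p.1.1 = -S p := by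
  simp [pairNoise, p.2, p.2.not_gt]

theorem pairNoise_self {d n : ℕ} (S : WorkerPair n → Vec d) (i : Fin n) :
    pairNoise S i i = 0 := by
  simp [pairNoise]

theorem measurable_pairNoise {d n : ℕ} (i j : Fin n) :
    Measurable fun S : WorkerPair n → Vec d => pairNoise S i j := by
  unfold pairNoise
  split_ifs <;> fun_prop

/-- The noise that worker `i` adds to its gradient. -/
noncomputable def dpNoise {d n m : ℕ} (i : Fin n) (r : Round d n m) : Vec d :=
  ∑ j, pairNoise r.1 i j + r.2.1 i

theorem measurable_dpNoise {d n m : ℕ} (i : Fin n) :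
    Measurable (dpNoise i : Round d n m → Vec d) := by
  have (j : Fin n) : Measurable fun r : Round d n m => pairNoise r.1 i j :=
    (measurable_pairNoise i j).comp measurable_fst
  unfold dpNoise
  fun_prop

/-- A secret enters the noises of its two owners with opposite signs, so it is tested against the
difference of their weights. -/
theorem sum_inner_dpNoise {d n m : ℕ} (w : Fin n → Vec d) (r : Round d n m) :
    ∑ i, inner ℝ (w i) (dpNoise i r)
      = ∑ p : WorkerPair n, inner ℝ (w p.1.1 - w p.1.2) (r.1 p) + ∑ i, inner ℝ (w i) (r.2.1 i) := by
  simp only [dpNoise, inner_add_right, inner_sum, Finset.sum_add_distrib]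
  rw [sum_sum_eq_sum_workerPair]
  simp only [pairNoise_of_lt, pairNoise_of_gt, pairNoise_self, inner_neg_right, inner_zero_right,
    Finset.sum_const_zero, add_zero, ← sub_eq_add_neg, ← inner_sub_left]

instance isProbabilityMeasure_batchLaw {m b : ℕ} (hb : b ≤ m) :
    IsProbabilityMeasure (batchLaw hb) := by
  unfold batchLaw; infer_instance

namespace CafCor

variable {X : Type u} {d n m : ℕ}

/-- The law of the randomness of one round. -/
noncomputable def roundLaw (A : CafCor X d n m) : Measure (Round d n m) :=
  (Measure.pi fun _ : WorkerPair n => isoGaussian d A.varCor).prod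
    ((Measure.pi fun _ : Fin n => isoGaussian d A.varInd).prod
      (Measure.pi fun _ : Fin n => batchLaw A.b_le))

instance isProbabilityMeasure_roundLaw (A : CafCor X d n m) :
    IsProbabilityMeasure A.roundLaw := by
  unfold roundLaw; infer_instance

theorem law_eq (A : CafCor X d n m) : A.law = Measure.infinitePi fun _ => A.roundLaw := rfl

instance isProbabilityMeasure_law (A : CafCor X d n m) : IsProbabilityMeasure A.law := by
  rw [law_eq]; infer_instance

theorem measurePreserving_secret (A : CafCor X d n m) (p : WorkerPair n) :
    MeasurePreserving (fun r : Round d n m => r.1 p) A.roundLaw (isoGaussian d A.varCor) :=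
  (measurePreserving_eval _ p).comp measurePreserving_fst

theorem measurePreserving_indNoise (A : CafCor X d n m) (i : Fin n) :
    MeasurePreserving (fun r : Round d n m => r.2.1 i) A.roundLaw (isoGaussian d A.varInd) :=
  (measurePreserving_eval _ i).comp (measurePreserving_fst.comp measurePreserving_snd)

theorem measurePreserving_batch (A : CafCor X d n m) (i : Fin n) :
    MeasurePreserving (fun r : Round d n m => r.2.2 i) A.roundLaw (batchLaw A.b_le) :=
  (measurePreserving_eval _ i).comp (measurePreserving_snd.comp measurePreserving_snd)

theorem memLp_dpNoise (A : CafCor X d n m) (i : Fin n) : MemLp (dpNoise i) 2 A.roundLaw := by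
  have h1 (p : WorkerPair n) : MemLp (fun r : Round d n m => r.1 p) 2 A.roundLaw :=
    (IsGaussian.memLp_two_id (μ := isoGaussian d A.varCor)).comp_measurePreserving
      (A.measurePreserving_secret p)
  have h2 : MemLp (fun r : Round d n m => r.2.1 i) 2 A.roundLaw :=
    (IsGaussian.memLp_two_id (μ := isoGaussian d A.varInd)).comp_measurePreserving
      (A.measurePreserving_indNoise i)
  refine MemLp.add (memLp_finsetSum _ fun j _ => ?_) h2
  unfold pairNoise
  split_ifs
  · exact h1 _
  · exact (h1 _).neg
  · exact MemLp.zero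

theorem integral_dpNoise (A : CafCor X d n m) (i : Fin n) :
    ∫ r, dpNoise i r ∂A.roundLaw = 0 := by
  have hi1 (p : WorkerPair n) : Integrable (fun r : Round d n m => r.1 p) A.roundLaw :=
    (A.measurePreserving_secret p).integrable_comp_of_integrable
      (IsGaussian.integrable_id (μ := isoGaussian d A.varCor))
  have hi2 : Integrable (fun r : Round d n m => r.2.1 i) A.roundLaw :=
    (A.measurePreserving_indNoise i).integrable_comp_of_integrable
      (IsGaussian.integrable_id (μ := isoGaussian d A.varInd))
  have h1 (p : WorkerPair n) : ∫ r, r.1 p ∂A.roundLaw = 0 := by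
    rw [← integral_id_isoGaussian d A.varCor, ← (A.measurePreserving_secret p).map_eq,
      integral_map (by fun_prop) (by fun_prop)]
  have h2 : ∫ r, r.2.1 i ∂A.roundLaw = 0 := by
    rw [← integral_id_isoGaussian d A.varInd, ← (A.measurePreserving_indNoise i).map_eq,
      integral_map (by fun_prop) (by fun_prop)]
  have hi3 (j : Fin n) : Integrable (fun r : Round d n m => pairNoise r.1 i j) A.roundLaw := by
    unfold pairNoise
    split_ifs
    · exact hi1 _
    · exact (hi1 _).neg
    · exact integrable_zero _ _ _
  have h3 (j : Fin n) : ∫ r, pairNoise r.1 i j ∂A.roundLaw = 0 := by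
    unfold pairNoise
    split_ifs
    · exact h1 _
    · rw [integral_neg, h1, neg_zero]
    · exact integral_zero _ _
  unfold dpNoise
  rw [integral_add (integrable_finsetSum _ fun j _ => hi3 j) hi2,
    integral_finsetSum _ fun j _ => hi3 j, h2]
  simp [h3]

/-- Identifies the joint covariance v((n+1)I - 11ᵀ) of the noises, in each coordinate. Discarding
the negative term bounds every direction; keeping it gives the cancellation in the sum over honest
workers. -/
theorem lintegral_exp_inner_dpNoise (A : CafCor X d n m) {v : ℝ} (hv : 0 < v)
    (hcor : A.varCor = v) (hind : A.varInd = v) (w : Fin n → Vec d) :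
    ∫⁻ r, ENNReal.ofReal (Real.exp (∑ i, inner ℝ (w i) (dpNoise i r))) ∂A.roundLaw
      = ENNReal.ofReal (Real.exp (v / 2 * ((n + 1) * ∑ i, ‖w i‖ ^ 2 - ‖∑ i, w i‖ ^ 2))) := by
  simp_rw [sum_inner_dpNoise, Real.exp_add, ENNReal.ofReal_mul (Real.exp_pos _).le]
  unfold roundLaw
  rw [lintegral_prod_mul (f := fun S : WorkerPair n → Vec d => ENNReal.ofReal
      (Real.exp (∑ p : WorkerPair n, inner ℝ (w p.1.1 - w p.1.2) (S p))))
    (g := fun q : (Fin n → Vec d) × (Fin n → Finset (Fin m)) => ENNReal.ofReal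
      (Real.exp (∑ i, inner ℝ (w i) (q.1 i))))
    (Measurable.aemeasurable (by fun_prop)) (Measurable.aemeasurable (by fun_prop)), hcor, hind,
    lintegral_exp_inner_pi_isoGaussian hv]
  have := lintegral_exp_inner_pi_isoGaussian hv w
  rw [← measurePreserving_fst (μ := Measure.pi fun _ : Fin n => isoGaussian d v)
    (ν := Measure.pi fun _ : Fin n => batchLaw A.b_le) |>.lintegral_comp (by fun_prop)] at this
  rw [this, ← ENNReal.ofReal_mul (Real.exp_pos _).le, ← Real.exp_add, sum_workerPair_norm_sub_sq]
  congr 2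
  ring

end CafCor

/-! ### The weighted covariance -/

theorem toEuclideanLin_weightedCov {d n : ℕ} (c : Fin n → ℝ) (x : Fin n → Vec d) (v : Vec d) :
    Matrix.toEuclideanLin (weightedCov c x) v
      = (∑ i, c i)⁻¹ • ∑ i, (c i * inner ℝ v (x i - weightedMean c x)) •
          (x i - weightedMean c x) := by
  simp only [weightedCov, map_smul, map_sum, LinearMap.smul_apply, LinearMap.sum_apply]
  congr 1
  refine Finset.sum_congr rfl fun i _ => ?_
  rw [mul_smul]
  congr 1
  ext j
  simp [Matrix.toLpLin_apply, Matrix.vecMulVec_mulVec, PiLp.inner_apply, dotProduct, mul_comm]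

theorem inner_toEuclideanLin_weightedCov {d n : ℕ} (c : Fin n → ℝ) (x : Fin n → Vec d)
    (v : Vec d) :
    inner ℝ v (Matrix.toEuclideanLin (weightedCov c x) v)
      = (∑ i, c i)⁻¹ * ∑ i, c i * inner ℝ v (x i - weightedMean c x) ^ 2 := by
  rw [toEuclideanLin_weightedCov, inner_smul_right, inner_sum]
  simp only [inner_smul_right]
  congr 1
  exact Finset.sum_congr rfl fun i _ => by ring

theorem posSemidef_weightedCov {d n : ℕ} {c : Fin n → ℝ} (hc : ∀ i, 0 ≤ c i)
    (x : Fin n → Vec d) : (weightedCov c x).PosSemidef := by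
  refine Matrix.PosSemidef.smul ?_ (inv_nonneg.2 (Finset.sum_nonneg fun i _ => hc i))
  refine Matrix.posSemidef_sum _ fun i _ => Matrix.PosSemidef.smul ?_ (hc i)
  simpa using Matrix.posSemidef_vecMulVec_self_star (x i - weightedMean c x).ofLp

/-- The supremum of the Rayleigh quotient of a symmetric operator is one of its eigenvalues, hence
at most the top one that the solver attains. -/
theorem IsTopEigensolver.inner_le {d n : ℕ} {eig : Matrix (Fin d) (Fin d) ℝ → Vec d}
    (heig : IsTopEigensolver eig) {c : Fin n → ℝ} (hc : ∀ i, 0 ≤ c i) (x : Fin n → Vec d)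
    {v : Vec d} (hv : ‖v‖ = 1) :
    inner ℝ v (Matrix.toEuclideanLin (weightedCov c x) v)
      ≤ inner ℝ (eig (weightedCov c x))
          (Matrix.toEuclideanLin (weightedCov c x) (eig (weightedCov c x))) := by
  set A := weightedCov c x with hA
  have hps := posSemidef_weightedCov hc x
  obtain ⟨lam, h1, h2⟩ := heig.isTop A hps
  have hn := heig.norm_eq_one A hps
  have hsym : (Matrix.toEuclideanLin A).IsSymmetric :=
    Matrix.isSymmetric_toEuclideanLin_iff.2 hps.isHermitian
  have hv0 : v ≠ 0 := by rintro rfl; simp at hv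
  have : Nontrivial (Vec d) := ⟨v, 0, hv0⟩
  have h3 := h2 _ hsym.hasEigenvalue_iSup_of_finiteDimensional
  have hbdd : BddAbove (Set.range fun y : {y : Vec d // y ≠ 0} =>
      RCLike.re (inner ℝ (Matrix.toEuclideanLin A y) (y : Vec d)) / ‖(y : Vec d)‖ ^ 2) := by
    refine ⟨‖(Matrix.toEuclideanLin A).toContinuousLinearMap‖, ?_⟩
    rintro _ ⟨y, rfl⟩
    have hy : 0 < ‖(y : Vec d)‖ := norm_pos_iff.2 y.2
    rw [div_le_iff₀ (by positivity)]
    calc RCLike.re (inner ℝ (Matrix.toEuclideanLin A y) (y : Vec d))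
        ≤ ‖Matrix.toEuclideanLin A y‖ * ‖(y : Vec d)‖ :=
          real_inner_le_norm (Matrix.toEuclideanLin A (y : Vec d)) (y : Vec d)
      _ ≤ (‖(Matrix.toEuclideanLin A).toContinuousLinearMap‖ * ‖(y : Vec d)‖) * ‖(y : Vec d)‖ := by
          gcongr
          exact (Matrix.toEuclideanLin A).toContinuousLinearMap.le_opNorm y
      _ = _ := by ring
  have h4 := le_ciSup hbdd ⟨v, hv0⟩
  simp only [hv, one_pow, div_one] at h4
  rw [h1, inner_smul_right, real_inner_self_eq_norm_sq, hn, one_pow, mul_one, real_inner_comm]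
  exact h4.trans h3

theorem sum_mul_inner_sub_weightedMean {d n : ℕ} {c : Fin n → ℝ} (hW : ∑ i, c i ≠ 0)
    (x : Fin n → Vec d) (v : Vec d) :
    ∑ i, c i * inner ℝ v (x i - weightedMean c x) = 0 := by
  have : ∑ i, c i • (x i - weightedMean c x) = 0 := by
    simp only [smul_sub, Finset.sum_sub_distrib, ← Finset.sum_smul]
    rw [weightedMean, smul_smul, mul_inv_cancel₀ hW, one_smul, sub_self]
  have h := congrArg (fun z => inner ℝ v z) this
  simpa [inner_sum, inner_smul_right] using h

/-! ### One step of the filter -/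

theorem sq_sum_mul_le {ι : Type*} (s : Finset ι) {c y : ι → ℝ} (hc : ∀ i ∈ s, 0 ≤ c i) :
    (∑ i ∈ s, c i * y i) ^ 2 ≤ (∑ i ∈ s, c i) * ∑ i ∈ s, c i * y i ^ 2 :=
  Finset.sum_sq_le_sum_mul_sum_of_sq_le_mul _ hc
    (fun i hi => mul_nonneg (hc i hi) (sq_nonneg _)) fun i _ => le_of_eq (by ring)

/-- The weights of the honest inputs have decreased less than those of the others. -/
structure IsFilterWeight {n : ℕ} (H : Finset (Fin n)) (c : Fin n → ℝ) : Prop where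
  nonneg : ∀ i, 0 ≤ c i
  le_one : ∀ i, c i ≤ 1
  removed_le : ∑ i ∈ H, (1 - c i) ≤ ∑ i ∈ Hᶜ, (1 - c i)

namespace IsFilterWeight

variable {n f : ℕ} {H : Finset (Fin n)} {c : Fin n → ℝ}

theorem card_compl (hH : H.card + f = n) : Hᶜ.card = f := by
  rw [Finset.card_compl, Fintype.card_fin]; omega

theorem sum_compl (hH : H.card + f = n) : ∑ i ∈ Hᶜ, c i = f - ∑ i ∈ Hᶜ, (1 - c i) := by
  simp [card_compl hH]

theorem sum_honest (hH : H.card + f = n) : ∑ i ∈ H, c i = n - f - ∑ i ∈ H, (1 - c i) := by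
  have : (H.card : ℝ) + f = n := by exact_mod_cast hH
  simp; linarith

theorem removed_compl_le (h : IsFilterWeight H c) (hH : H.card + f = n) :
    ∑ i ∈ Hᶜ, (1 - c i) ≤ f := by
  have := sum_compl (c := c) hH
  have : 0 ≤ ∑ i ∈ Hᶜ, c i := Finset.sum_nonneg fun i _ => h.nonneg i
  linarith

theorem le_sum_honest (h : IsFilterWeight H c) (hH : H.card + f = n) :
    (n : ℝ) - 2 * f ≤ ∑ i ∈ H, c i := by
  have := sum_honest (c := c) hH
  linarith [h.removed_compl_le hH, h.removed_le]

/-- While the invariant holds, the honest weight alone keeps the loop from ending through its test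
on the total weight. -/
theorem le_sum (h : IsFilterWeight H c) (hH : H.card + f = n) :
    (n : ℝ) - 2 * f ≤ ∑ i, c i := by
  rw [← Finset.sum_add_sum_compl H]
  have : 0 ≤ ∑ i ∈ Hᶜ, c i := Finset.sum_nonneg fun i _ => h.nonneg i
  linarith [h.le_sum_honest hH]

/-- When the weighted variance is large, at least half of it comes from the inputs that are not
honest. -/
theorem sum_honest_le_sum_compl (h : IsFilterWeight H c) (hH : H.card + f = n) {η : ℝ}
    (hη : 0 < η) (hn : 0 < n) (hnf : (2 + η) * f ≤ n) {y : Fin n → ℝ} {m S : ℝ}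
    (hm : ∑ i, c i * (y i - m) = 0) (hS : ∑ i ∈ H, y i ^ 2 ≤ S)
    (hbig : 2 * ((1 + η) / η) * S < ∑ i, c i * (y i - m) ^ 2) :
    ∑ i ∈ H, c i * (y i - m) ^ 2 ≤ ∑ i ∈ Hᶜ, c i * (y i - m) ^ 2 := by
  have hn' : (0 : ℝ) < n := by exact_mod_cast hn
  rw [← Finset.sum_add_sum_compl H] at hm hbig
  set P := ∑ i ∈ H, c i * (y i - m) ^ 2
  set B := ∑ i ∈ Hᶜ, c i * (y i - m) ^ 2
  set s := ∑ i ∈ H, c i * (y i - m)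
  set cH := ∑ i ∈ H, c i with hcH
  set cB := ∑ i ∈ Hᶜ, c i with hcB
  by_contra! hlt
  have hB0 : 0 ≤ B := Finset.sum_nonneg fun i _ => mul_nonneg (h.nonneg i) (sq_nonneg _)
  have hcB0 : 0 ≤ cB := Finset.sum_nonneg fun i _ => h.nonneg i
  -- Initially the ratio is (n-f)/f ≥ 1+η, and H loses no more weight than its complement.
  have hratio : (1 + η) * cB ≤ cH := by
    rw [hcH, hcB, sum_honest hH, sum_compl hH]
    have h1 := h.removed_le
    have h2 : 0 ≤ ∑ i ∈ Hᶜ, (1 - c i) := Finset.sum_nonneg fun i _ => by linarith [h.le_one i]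
    nlinarith
  have hcHpos : 0 < cH := by
    have h1 := h.le_sum_honest hH
    have h2 : (0 : ℝ) < n - 2 * f := by
      rcases Nat.eq_zero_or_pos f with rfl | hf
      · simpa using hn
      · have : (0 : ℝ) < f := by exact_mod_cast hf
        nlinarith
    linarith
  -- The total deviation from the weighted mean is zero, so s can be computed on the complement of H
  -- and bounded by Cauchy–Schwarz there.
  have hs : s ^ 2 ≤ cB * B := by
    have : s = -∑ i ∈ Hᶜ, c i * (y i - m) := by linarith
    rw [this, neg_sq]
    exact sq_sum_mul_le _ fun i _ => h.nonneg i
  have hy : P + 2 * m * s + m ^ 2 * cH ≤ S := by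
    refine le_trans (le_of_eq ?_) ((Finset.sum_le_sum fun i _ =>
      mul_le_of_le_one_left (sq_nonneg (y i)) (h.le_one i)).trans hS)
    simp only [P, s, cH, Finset.mul_sum, ← Finset.sum_add_distrib]
    exact Finset.sum_congr rfl fun i _ => by ring
  -- In `hy` the left side is smallest at m = -s/cH, where it equals P - s²/cH; then s² ≤ cB B and B
  -- < P.
  have h1 : cH * P ≤ cH * S + cB * P := by
    nlinarith [sq_nonneg (m * cH + s)]
  have h2 : (1 + η) * (cH * P) ≤ (1 + η) * (cH * S) + cH * P := by
    have hP0 : 0 ≤ P := hB0.trans hlt.le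
    nlinarith
  have h3 : η * P ≤ (1 + η) * S := by
    have : cH * (η * P) ≤ cH * ((1 + η) * S) := by linarith
    exact le_of_mul_le_mul_left this hcHpos
  have h4 : 2 * ((1 + η) / η) * S = 2 * (((1 + η) * S) / η) := by ring
  have h5 : P ≤ (1 + η) * S / η := by rw [le_div_iff₀ hη]; linarith
  linarith

end IsFilterWeight

/-! ### The error of a weighted mean -/

/-- The mean of the vectors `x i` with `i ∈ H`. -/
noncomputable def honestMean {d n : ℕ} (H : Finset (Fin n)) (x : Fin n → Vec d) : Vec d :=
  (H.card : ℝ)⁻¹ • ∑ i ∈ H, x i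

theorem sum_sub_honestMean {d n : ℕ} {H : Finset (Fin n)} (hH : H.Nonempty) (x : Fin n → Vec d) :
    ∑ i ∈ H, (x i - honestMean H x) = 0 := by
  have : (H.card : ℝ) ≠ 0 := by exact_mod_cast hH.card_pos.ne'
  rw [Finset.sum_sub_distrib, Finset.sum_const, honestMean, ← Nat.cast_smul_eq_nsmul ℝ, smul_smul,
    mul_inv_cancel₀ this, one_smul, sub_self]

/-- Deviations from the honest mean cancel over H. So the error of the weighted mean comes only from
removed honest weight, at most 2f, and from weight kept outside H, at most f; Cauchy–Schwarz on each
piece produces the factor f/n. The second weight `c'` is the one whose second moment is controlled,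
and `c` is any later weight of the filter. -/
theorem norm_weightedMean_sub_sq_le {d n f : ℕ} {H : Finset (Fin n)} (hH : H.card + f = n)
    (hHn : H.Nonempty) {c c' : Fin n → ℝ} (hc : ∀ i, 0 ≤ c i) (hcc : ∀ i, c i ≤ c' i)
    (hc' : ∀ i, c' i ≤ 1) {x : Fin n → Vec d} {S M ρ : ℝ} (hρ : 0 < ρ) (hn : 0 < n)
    (hρn : ρ * n ≤ n - 2 * f) (hW : (n : ℝ) - 2 * f ≤ ∑ i, c i)
    (hS : ∀ v : Vec d, ‖v‖ = 1 → ∑ i ∈ H, inner ℝ v (x i - honestMean H x) ^ 2 ≤ n * S)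
    (hS0 : 0 ≤ S) (hM0 : 0 ≤ M)
    (hM : ∀ v : Vec d, ‖v‖ = 1 → ∑ i, c' i * inner ℝ v (x i - honestMean H x) ^ 2 ≤ M * (n * S)) :
    ‖weightedMean c x - honestMean H x‖ ^ 2 ≤ 2 * (2 + M) / ρ ^ 2 * (f / n) * S := by
  have hn' : (0 : ℝ) < n := by exact_mod_cast hn
  have hWpos : 0 < ∑ i, c i := (mul_pos hρ hn').trans_le (hρn.trans hW)
  set a := honestMean H x with ha
  set W := ∑ i, c i with hWdef
  have hc1 (i) : c i ≤ 1 := (hcc i).trans (hc' i)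
  have key (v : Vec d) (hv : ‖v‖ = 1) :
      (W * inner ℝ v (weightedMean c x - a)) ^ 2 ≤ 2 * (2 + M) * f * (n * S) := by
    have h1 : W * inner ℝ v (weightedMean c x - a) = ∑ i, c i * inner ℝ v (x i - a) := by
      have h := sum_mul_inner_sub_weightedMean hWpos.ne' x v
      rw [hWdef, Finset.sum_mul, ← sub_eq_zero, ← neg_zero, ← h, ← Finset.sum_sub_distrib,
        ← Finset.sum_neg_distrib]
      refine Finset.sum_congr rfl fun i _ => ?_
      simp only [inner_sub_right]
      ring
    have h2 : ∑ i ∈ H, inner ℝ v (x i - a) = 0 := by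
      rw [← inner_sum, sum_sub_honestMean hHn, inner_zero_right]
    have h3 : W * inner ℝ v (weightedMean c x - a)
        = -∑ i ∈ H, (1 - c i) * inner ℝ v (x i - a) + ∑ i ∈ Hᶜ, c i * inner ℝ v (x i - a) := by
      rw [h1, ← Finset.sum_add_sum_compl H]
      congr 1
      simp only [sub_mul, one_mul, Finset.sum_sub_distrib, h2]
      ring
    have h4 : (∑ i ∈ H, (1 - c i) * inner ℝ v (x i - a)) ^ 2 ≤ 2 * f * (n * S) := by
      refine (sq_sum_mul_le H fun i _ => by linarith [hc1 i]).trans ?_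
      refine mul_le_mul ?_ ?_ (Finset.sum_nonneg fun i _ =>
        mul_nonneg (by linarith [hc1 i]) (sq_nonneg _)) (by positivity)
      · have h5 : ∑ i ∈ H, (1 - c i) ≤ ∑ i, (1 - c i) :=
          Finset.sum_le_sum_of_subset_of_nonneg (Finset.subset_univ _)
            fun i _ _ => by linarith [hc1 i]
        have h6 : ∑ i, (1 - c i) = n - W := by simp [hWdef]
        linarith
      · exact (Finset.sum_le_sum fun i _ => mul_le_of_le_one_left (sq_nonneg _)
          (by linarith [hc i])).trans (hS v hv)
    have h5 : (∑ i ∈ Hᶜ, c i * inner ℝ v (x i - a)) ^ 2 ≤ f * (M * (n * S)) := by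
      refine (sq_sum_mul_le Hᶜ fun i _ => hc i).trans ?_
      refine mul_le_mul ?_ ?_ (Finset.sum_nonneg fun i _ =>
        mul_nonneg (hc i) (sq_nonneg _)) (by positivity)
      · refine (Finset.sum_le_card_nsmul _ _ 1 fun i _ => hc1 i).trans ?_
        simp [IsFilterWeight.card_compl hH]
      · refine le_trans ?_ (hM v hv)
        refine (Finset.sum_le_sum_of_subset_of_nonneg (Finset.subset_univ _)
          fun i _ _ => mul_nonneg (hc i) (sq_nonneg _)).trans ?_
        exact Finset.sum_le_sum fun i _ => mul_le_mul_of_nonneg_right (hcc i) (sq_nonneg _)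
    rw [h3]
    nlinarith [sq_nonneg (∑ i ∈ H, (1 - c i) * inner ℝ v (x i - a)
      + ∑ i ∈ Hᶜ, c i * inner ℝ v (x i - a))]
  have hbound (z : ℝ) (hz : 0 ≤ z) (h : (W * z) ^ 2 ≤ 2 * (2 + M) * f * (n * S)) :
      z ^ 2 ≤ 2 * (2 + M) / ρ ^ 2 * (f / n) * S := by
    have h1 : (ρ * n * z) ^ 2 ≤ (W * z) ^ 2 := by
      gcongr
      exact hρn.trans hW
    have h2 : 2 * (2 + M) / ρ ^ 2 * (f / n) * S = (2 * (2 + M) * f * (n * S)) / (ρ * n) ^ 2 := by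
      field_simp
    rw [h2, le_div_iff₀ (by positivity)]
    calc z ^ 2 * (ρ * n) ^ 2 = (ρ * n * z) ^ 2 := by ring
      _ ≤ _ := h1.trans h
  rcases eq_or_ne (weightedMean c x - a) 0 with h0 | h0
  · rw [h0]
    simp only [norm_zero, ne_eq, OfNat.ofNat_ne_zero, not_false_eq_true, zero_pow]
    positivity
  · refine hbound _ (norm_nonneg _) ?_
    have hpos := norm_pos_iff.2 h0
    -- In the direction of the error itself, the inner product is its norm.
    have h1 := key (‖weightedMean c x - a‖⁻¹ • (weightedMean c x - a)) (by
      rw [norm_smul, norm_inv, norm_norm, inv_mul_cancel₀ hpos.ne'])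
    have h2 : ‖weightedMean c x - a‖⁻¹ * ‖weightedMean c x - a‖ ^ 2 = ‖weightedMean c x - a‖ := by
      field_simp
    rwa [inner_smul_left, real_inner_self_eq_norm_sq, conj_trivial, h2] at h1

/-! ### Robustness of the filter -/

/-- The weights after one step of the filter. -/
noncomputable def filterStep {n : ℕ} (c τ : Fin n → ℝ) : Fin n → ℝ :=
  fun i => c i * (1 - τ i / ⨆ j, if c j = 0 then 0 else τ j)

section filterStep

variable {n : ℕ} {c τ : Fin n → ℝ}

theorem iSup_ite_nonneg (hτ : ∀ i, 0 ≤ τ i) : 0 ≤ ⨆ j, if c j = 0 then 0 else τ j :=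
  Real.iSup_nonneg fun j => by split_ifs; exacts [le_rfl, hτ j]

theorem le_iSup_ite {i : Fin n} (hi : c i ≠ 0) : τ i ≤ ⨆ j, if c j = 0 then 0 else τ j := by
  have := le_ciSup (Set.finite_range fun j => if c j = 0 then 0 else τ j).bddAbove i
  simpa [hi] using this

theorem filterStep_nonneg (hc : ∀ i, 0 ≤ c i) (hτ : ∀ i, 0 ≤ τ i) (i : Fin n) :
    0 ≤ filterStep c τ i := by
  by_cases hi : c i = 0
  · simp [filterStep, hi]
  · exact mul_nonneg (hc i) (sub_nonneg.2 (div_le_one_of_le₀ (le_iSup_ite hi) (iSup_ite_nonneg hτ)))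

theorem filterStep_le (hc : ∀ i, 0 ≤ c i) (hτ : ∀ i, 0 ≤ τ i) (i : Fin n) :
    filterStep c τ i ≤ c i :=
  mul_le_of_le_one_right (hc i) (sub_le_self _ (div_nonneg (hτ i) (iSup_ite_nonneg hτ)))

theorem IsFilterWeight.filterStep {H : Finset (Fin n)} (h : IsFilterWeight H c)
    (hτ : ∀ i, 0 ≤ τ i) (hle : ∑ i ∈ H, c i * τ i ≤ ∑ i ∈ Hᶜ, c i * τ i) :
    IsFilterWeight H (filterStep c τ) := by
  refine ⟨filterStep_nonneg h.nonneg hτ,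
    fun i => (filterStep_le h.nonneg hτ i).trans (h.le_one i), ?_⟩
  have (s : Finset (Fin n)) : ∑ i ∈ s, (1 - _root_.filterStep c τ i)
      = ∑ i ∈ s, (1 - c i) + (∑ i ∈ s, c i * τ i) / ⨆ j, if c j = 0 then 0 else τ j := by
    rw [Finset.sum_div, ← Finset.sum_add_distrib]
    refine Finset.sum_congr rfl fun i _ => ?_
    rw [_root_.filterStep]
    ring
  rw [this, this]
  exact add_le_add h.removed_le (div_le_div_of_nonneg_right hle (iSup_ite_nonneg hτ))

/-- An index attaining the maximum of τ over the nonzero weights loses all its weight, and no weight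
is revived. -/
theorem card_filterStep_ne_zero_lt (hc : ∀ i, 0 ≤ c i)
    (h : 0 < ∑ i, c i * τ i) :
    (Finset.univ.filter fun i => filterStep c τ i ≠ 0).card
      < (Finset.univ.filter fun i => c i ≠ 0).card := by
  obtain ⟨k, -, hk⟩ := Finset.exists_lt_of_sum_lt (s := Finset.univ) (f := fun _ : Fin n => (0 : ℝ))
    (g := fun i => c i * τ i) (by simpa using h)
  have hck : c k ≠ 0 := fun h0 => by simp [h0] at hk
  have hτk : 0 < τ k := pos_of_mul_pos_right hk (hc k)
  have : Nonempty (Fin n) := ⟨k⟩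
  obtain ⟨j, hj⟩ := exists_eq_ciSup_of_finite (f := fun j => if c j = 0 then 0 else τ j)
  have hpos := hτk.trans_le (le_iSup_ite (τ := τ) hck)
  have hcj : c j ≠ 0 := fun h0 => by simp only [h0, if_true] at hj; exact hpos.ne hj
  simp only [hcj, if_false] at hj
  refine Finset.card_lt_card ⟨fun i hi => ?_, fun hsub => ?_⟩
  · simp only [Finset.mem_filter, Finset.mem_univ, true_and] at hi ⊢
    exact fun h0 => hi (by simp [filterStep, h0])
  · have := hsub (Finset.mem_filter.2 ⟨Finset.mem_univ j, hcj⟩)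
    simp only [Finset.mem_filter, Finset.mem_univ, true_and] at this
    exact this (by rw [filterStep, ← hj, div_self (hj ▸ hpos).ne', sub_self, mul_zero])

end filterStep

theorem cafLoop_succ {d n : ℕ} (eig : Matrix (Fin d) (Fin d) ℝ → Vec d) (f : ℕ)
    (x : Fin n → Vec d) (k : ℕ) (c : Fin n → ℝ) (best : WithTop ℝ × Vec d) :
    ∃ s : ℝ, s = inner ℝ (eig (weightedCov c x))
        (Matrix.toEuclideanLin (weightedCov c x) (eig (weightedCov c x))) ∧
      cafLoop eig f x (k + 1) c best =
        if ∑ i, c i < (n : ℝ) - 2 * f then best.2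
        else if s = 0 then (if (s : WithTop ℝ) < best.1 then (↑s, weightedMean c x) else best).2
        else cafLoop eig f x k
          (filterStep c fun i => inner ℝ (eig (weightedCov c x)) (x i - weightedMean c x) ^ 2)
          (if (s : WithTop ℝ) < best.1 then (↑s, weightedMean c x) else best) :=
  ⟨_, rfl, rfl⟩

/-- The output is either the mean stored at the start or the weighted mean of some later weight that
passed the test on the total; weights only decrease. -/
theorem cafLoop_mem {d n : ℕ} (eig : Matrix (Fin d) (Fin d) ℝ → Vec d) (f : ℕ)
    (x : Fin n → Vec d) {c' : Fin n → ℝ} {Good : Vec d → Prop}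
    (hgood : ∀ c : Fin n → ℝ, (∀ i, 0 ≤ c i) → (∀ i, c i ≤ c' i) →
      (n : ℝ) - 2 * f ≤ ∑ i, c i → Good (weightedMean c x)) (k : ℕ) (c : Fin n → ℝ)
    (best : WithTop ℝ × Vec d) (hc : ∀ i, 0 ≤ c i) (hcc : ∀ i, c i ≤ c' i) (hb : Good best.2) :
    Good (cafLoop eig f x k c best) := by
  induction k generalizing c best with
  | zero => exact hb
  | succ k ih =>
    obtain ⟨s, -, heq⟩ := cafLoop_succ eig f x k c best
    rw [heq]
    by_cases hW : ∑ i, c i < (n : ℝ) - 2 * f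
    · rwa [if_pos hW]
    · rw [if_neg hW]
      have hb' : Good (if (s : WithTop ℝ) < best.1 then ((s : WithTop ℝ), weightedMean c x)
          else best).2 := by
        split_ifs
        · exact hgood c hc hcc (not_lt.1 hW)
        · exact hb
      by_cases hs0 : s = 0
      · rwa [if_pos hs0]
      · rw [if_neg hs0]
        exact ih _ _ (filterStep_nonneg hc fun i => sq_nonneg _)
          (fun i => (filterStep_le hc (fun i => sq_nonneg _) i).trans (hcc i)) hb'

/-- The constant in the robustness guarantee of CAF. -/
noncomputable def cafConst (η : ℝ) : ℝ :=
  -- ρ is a lower bound for (n-2f)/n. Below the threshold κS the filter has succeeded; the inner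
  -- bracket of the result is then the second moment constant `M` of `norm_weightedMean_sub_sq_le`.
  let ρ := η / (2 + η)
  let κ := 2 * ((1 + η) / η) / ρ
  2 * (2 + (2 * κ + 4 * (κ + 1) / ρ)) / ρ ^ 2

theorem cafConst_pos {η : ℝ} (hη : 0 < η) : 0 < cafConst η := by
  unfold cafConst; positivity

/-- Recentres the covariance from the weighted mean to the honest mean. Their distance u along v is
controlled because the honest inputs, of total weight at least ρn, are close to both centres on
average. -/
theorem IsFilterWeight.sum_mul_inner_sub_honestMean_sq_le {d n f : ℕ} {H : Finset (Fin n)}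
    {c : Fin n → ℝ} (h : IsFilterWeight H c) (hH : H.card + f = n) {x : Fin n → Vec d}
    {S κ ρ : ℝ} (hρ : 0 < ρ) (hn : 0 < n) (hρn : ρ * n ≤ n - 2 * f) (hS0 : 0 ≤ S) (hκ : 0 ≤ κ)
    {v : Vec d} (hS : ∑ i ∈ H, inner ℝ v (x i - honestMean H x) ^ 2 ≤ n * S)
    (hcov : (∑ i, c i)⁻¹ * ∑ i, c i * inner ℝ v (x i - weightedMean c x) ^ 2 ≤ κ * S) :
    ∑ i, c i * inner ℝ v (x i - honestMean H x) ^ 2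
      ≤ (2 * κ + 4 * (κ + 1) / ρ) * (n * S) := by
  have hn' : (0 : ℝ) < n := by exact_mod_cast hn
  have hcH := hρn.trans (h.le_sum_honest hH)
  have hWpos : 0 < ∑ i, c i := (mul_pos hρ hn').trans_le (hρn.trans (h.le_sum hH))
  have hWn : ∑ i, c i ≤ n := by
    simpa using Finset.sum_le_card_nsmul Finset.univ c 1 fun i _ => h.le_one i
  set u := inner ℝ v (weightedMean c x - honestMean H x)
  have hu (i) : inner ℝ v (x i - honestMean H x) = inner ℝ v (x i - weightedMean c x) + u := by
    rw [← inner_add_right, sub_add_sub_cancel]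
  have h1 : ∑ i, c i * inner ℝ v (x i - weightedMean c x) ^ 2 ≤ n * (κ * S) := by
    rw [inv_mul_le_iff₀ hWpos] at hcov
    exact hcov.trans (by gcongr)
  have h2 : (∑ i ∈ H, c i) * u ^ 2 ≤ 2 * (n * (κ * S)) + 2 * (n * S) := by
    have h3 : ∑ i ∈ H, c i * inner ℝ v (x i - weightedMean c x) ^ 2 ≤ n * (κ * S) :=
      (Finset.sum_le_sum_of_subset_of_nonneg (Finset.subset_univ _)
        fun i _ _ => mul_nonneg (h.nonneg i) (sq_nonneg _)).trans h1
    have h4 : ∑ i ∈ H, c i * inner ℝ v (x i - honestMean H x) ^ 2 ≤ n * S :=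
      (Finset.sum_le_sum fun i _ => mul_le_of_le_one_left (sq_nonneg _) (h.le_one i)).trans hS
    calc (∑ i ∈ H, c i) * u ^ 2
        ≤ ∑ i ∈ H, (2 * (c i * inner ℝ v (x i - weightedMean c x) ^ 2)
            + 2 * (c i * inner ℝ v (x i - honestMean H x) ^ 2)) := by
          rw [Finset.sum_mul]
          refine Finset.sum_le_sum fun i _ => ?_
          have h5 : u = inner ℝ v (x i - honestMean H x) - inner ℝ v (x i - weightedMean c x) := by
            rw [hu i]; ring
          have h6 : u ^ 2 ≤ 2 * inner ℝ v (x i - weightedMean c x) ^ 2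
              + 2 * inner ℝ v (x i - honestMean H x) ^ 2 := by
            rw [h5]
            nlinarith [sq_nonneg (inner ℝ v (x i - honestMean H x)
              + inner ℝ v (x i - weightedMean c x))]
          nlinarith [mul_le_mul_of_nonneg_left h6 (h.nonneg i)]
      _ ≤ _ := by
          rw [Finset.sum_add_distrib, ← Finset.mul_sum, ← Finset.mul_sum]
          linarith
  have h3 : u ^ 2 ≤ 2 * (κ + 1) / ρ * S := by
    have h4 : ρ * n * u ^ 2 ≤ 2 * (n * (κ * S)) + 2 * (n * S) :=
      (mul_le_mul_of_nonneg_right hcH (sq_nonneg u)).trans h2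
    have h5 : n * (ρ * u ^ 2) ≤ n * (2 * (κ + 1) * S) := by linarith
    have h6 := le_of_mul_le_mul_left h5 hn'
    rw [div_mul_eq_mul_div, le_div_iff₀ hρ]
    linarith
  calc ∑ i, c i * inner ℝ v (x i - honestMean H x) ^ 2
      ≤ ∑ i, (2 * (c i * inner ℝ v (x i - weightedMean c x) ^ 2) + 2 * (c i * u ^ 2)) := by
        refine Finset.sum_le_sum fun i _ => ?_
        rw [hu i]
        nlinarith [mul_nonneg (h.nonneg i)
          (sq_nonneg (inner ℝ v (x i - weightedMean c x) - u))]
    _ = 2 * ∑ i, c i * inner ℝ v (x i - weightedMean c x) ^ 2 + 2 * ((∑ i, c i) * u ^ 2) := by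
        rw [Finset.sum_add_distrib, ← Finset.mul_sum, ← Finset.mul_sum, Finset.sum_mul]
    _ ≤ 2 * (n * (κ * S)) + 2 * (n * (2 * (κ + 1) / ρ * S)) := by gcongr
    _ = _ := by ring

theorem norm_caf_sub_sq_le {d n f : ℕ} {η : ℝ} (hη : 0 < η) (hn : 0 < n)
    (hnf : (2 + η) * f ≤ n) {H : Finset (Fin n)} (hH : H.card + f = n)
    {eig : Matrix (Fin d) (Fin d) ℝ → Vec d} (heig : IsTopEigensolver eig) (x : Fin n → Vec d)
    {S : ℝ} (hS0 : 0 ≤ S)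
    (hS : ∀ v : Vec d, ‖v‖ = 1 → ∑ i ∈ H, inner ℝ v (x i - honestMean H x) ^ 2 ≤ n * S) :
    ‖caf eig f x - honestMean H x‖ ^ 2 ≤ cafConst η * (f / n) * S := by
  set ρ : ℝ := η / (2 + η) with hρdef
  set κ : ℝ := 2 * ((1 + η) / η) / ρ with hκdef
  have hρ : 0 < ρ := by positivity
  have hκ : 0 < κ := by positivity
  have hn' : (0 : ℝ) < n := by exact_mod_cast hn
  have hρn : ρ * n ≤ n - 2 * f := by
    rw [hρdef, div_mul_eq_mul_div, div_le_iff₀ (by positivity)]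
    nlinarith
  have hHn : H.Nonempty := by
    rw [← Finset.card_pos]
    by_contra! h0
    have : f = n := by omega
    rw [this] at hnf
    nlinarith
  set Good : Vec d → Prop := fun z => ‖z - honestMean H x‖ ^ 2 ≤ cafConst η * (f / n) * S
  -- The third hypothesis says that no good eigenvalue has been met yet. It ensures that the first
  -- eigenvalue at most κS replaces `best`, whose stored mean may be useless until then.
  suffices key : ∀ (k : ℕ) (c : Fin n → ℝ) (best : WithTop ℝ × Vec d), IsFilterWeight H c →
      (Finset.univ.filter fun i => c i ≠ 0).card ≤ k → ((κ * S : ℝ) : WithTop ℝ) < best.1 →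
      Good (cafLoop eig f x k c best) by
    refine key n _ _ ⟨by simp, by simp, by simp⟩ ?_ (WithTop.coe_lt_top _)
    exact (Finset.card_le_univ _).trans (by simp)
  intro k
  induction k with
  | zero =>
    intro c best hc hcard _
    have h0 : ∑ i, c i = 0 := by
      refine Finset.sum_eq_zero fun i hi => ?_
      have h1 := Finset.filter_eq_empty_iff.1 (Finset.card_eq_zero.1 (Nat.le_zero.1 hcard)) hi
      simpa using h1
    have := hρn.trans (hc.le_sum hH)
    nlinarith
  | succ k ih =>
    intro c best hc hcard hbest
    obtain ⟨s, hs, heq⟩ := cafLoop_succ eig f x k c best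
    rw [heq, if_neg (not_lt.2 (hc.le_sum hH))]
    have hWpos : 0 < ∑ i, c i := (mul_pos hρ hn').trans_le (hρn.trans (hc.le_sum hH))
    rcases le_or_gt s (κ * S) with hsS | hsS
    · have hM : ∀ v : Vec d, ‖v‖ = 1 → ∑ i, c i * inner ℝ v (x i - honestMean H x) ^ 2
          ≤ (2 * κ + 4 * (κ + 1) / ρ) * (n * S) := fun v hv => by
        refine hc.sum_mul_inner_sub_honestMean_sq_le hH hρ hn hρn hS0 hκ.le (hS v hv) ?_
        rw [← inner_toEuclideanLin_weightedCov]
        exact (heig.inner_le hc.nonneg x hv).trans (hs ▸ hsS)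
      -- From here on the invariant may fail: later means are good merely because their weights lie
      -- below `c` and have total at least n - 2f.
      have hgood : ∀ c' : Fin n → ℝ, (∀ i, 0 ≤ c' i) → (∀ i, c' i ≤ c i) →
          (n : ℝ) - 2 * f ≤ ∑ i, c' i → Good (weightedMean c' x) := fun c' h0 h1 h2 =>
        norm_weightedMean_sub_sq_le hH hHn h0 h1 hc.le_one hρ hn hρn h2 hS hS0 (by positivity) hM
      have hlt : (s : WithTop ℝ) < best.1 := lt_of_le_of_lt (WithTop.coe_le_coe.2 hsS) hbest
      have hmean := hgood c hc.nonneg (fun _ => le_rfl) (hc.le_sum hH)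
      rw [if_pos hlt]
      by_cases hs0 : s = 0
      · rwa [if_pos hs0]
      · rw [if_neg hs0]
        exact cafLoop_mem eig f x hgood k _ _
          (filterStep_nonneg hc.nonneg fun i => sq_nonneg _)
          (filterStep_le hc.nonneg fun i => sq_nonneg _) hmean
    · have hspos : 0 < s := (mul_nonneg hκ.le hS0).trans_lt hsS
      rw [if_neg hspos.ne']
      set v := eig (weightedCov c x) with hv
      have hvn : ‖v‖ = 1 := heig.norm_eq_one _ (posSemidef_weightedCov hc.nonneg x)
      have hsum : ∑ i, c i * inner ℝ v (x i - weightedMean c x) ^ 2 = (∑ i, c i) * s := by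
        rw [hs, inner_toEuclideanLin_weightedCov, mul_inv_cancel_left₀ hWpos.ne']
      refine ih _ _ (hc.filterStep (fun i => sq_nonneg _) ?_) ?_ ?_
      · have hu (i) : inner ℝ v (x i - weightedMean c x) = inner ℝ v (x i - honestMean H x)
            - inner ℝ v (weightedMean c x - honestMean H x) := by
          rw [← inner_sub_right, sub_sub_sub_cancel_right]
        have h0 := sum_mul_inner_sub_weightedMean hWpos.ne' x v
        simp only [hu] at h0 hsum ⊢
        refine hc.sum_honest_le_sum_compl hH hη hn hnf h0 (hS v hvn) ?_
        rw [hsum]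
        -- κ was chosen so that s > κS is exactly enough for the comparison of honest and other
        -- contributions.
        calc 2 * ((1 + η) / η) * (n * S) = (ρ * n) * (κ * S) := by rw [hκdef]; field_simp
          _ < (ρ * n) * s := by gcongr
          _ ≤ _ := by gcongr; exact hρn.trans (hc.le_sum hH)
      · refine Nat.le_of_lt_succ (lt_of_lt_of_le ?_ hcard)
        refine card_filterStep_ne_zero_lt hc.nonneg ?_
        rw [hsum]
        positivity
      · split_ifs
        · exact WithTop.coe_lt_coe.2 hsS
        · exact hbest

/-! ### Measurability -/

theorem measurable_weightedMean {Ω : Type*} [MeasurableSpace Ω] {d n : ℕ} {c : Ω → Fin n → ℝ}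
    {x : Ω → Fin n → Vec d} (hc : Measurable c) (hx : Measurable x) :
    Measurable fun ω => weightedMean (c ω) (x ω) := by
  unfold weightedMean
  fun_prop

theorem measurable_weightedCov {Ω : Type*} [MeasurableSpace Ω] {d n : ℕ} {c : Ω → Fin n → ℝ}
    {x : Ω → Fin n → Vec d} (hc : Measurable c) (hx : Measurable x) :
    Measurable fun ω => (fun a b => weightedCov (c ω) (x ω) a b : Fin d → Fin d → ℝ) := by
  have := measurable_weightedMean hc hx
  simp only [weightedCov, Matrix.smul_apply, Matrix.sum_apply, Matrix.vecMulVec_apply,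
    smul_eq_mul, PiLp.sub_apply]
  fun_prop

/-- The stored eigenvalue is only ever compared with real numbers, so `hb1` asks for nothing more
than measurability of these comparisons. -/
theorem measurable_cafLoop {Ω : Type*} [MeasurableSpace Ω] {d n : ℕ}
    {eig : Matrix (Fin d) (Fin d) ℝ → Vec d} (heig : IsTopEigensolver eig) (f : ℕ)
    {x : Ω → Fin n → Vec d} (hx : Measurable x) (k : ℕ) {c : Ω → Fin n → ℝ} (hc : Measurable c)
    {best : Ω → WithTop ℝ × Vec d}
    (hb1 : ∀ s : Ω → ℝ, Measurable s → MeasurableSet {ω | (s ω : WithTop ℝ) < (best ω).1})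
    (hb2 : Measurable fun ω => (best ω).2) :
    Measurable fun ω => cafLoop eig f (x ω) k (c ω) (best ω) := by
  induction k generalizing c best with
  | zero => exact hb2
  | succ k ih =>
    have hmean := measurable_weightedMean hc hx
    have hv : Measurable fun ω => eig (weightedCov (c ω) (x ω)) :=
      heig.measurable.comp (measurable_weightedCov hc hx)
    have hτ (i : Fin n) : Measurable fun ω =>
        inner ℝ (eig (weightedCov (c ω) (x ω))) (x ω i - weightedMean (c ω) (x ω)) ^ 2 :=
      (hv.inner (((measurable_pi_apply i).comp hx).sub hmean)).pow_const 2
    have hci (i : Fin n) : Measurable fun ω => c ω i := (measurable_pi_apply i).comp hc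
    set s : Ω → ℝ := fun ω => inner ℝ (eig (weightedCov (c ω) (x ω)))
      (Matrix.toEuclideanLin (weightedCov (c ω) (x ω)) (eig (weightedCov (c ω) (x ω)))) with hs
    have hsm : Measurable s := by
      simp only [hs, inner_toEuclideanLin_weightedCov]
      exact (Finset.measurable_sum _ fun i _ => hci i).inv.mul
        (Finset.measurable_sum _ fun i _ => (hci i).mul (hτ i))
    set best' : Ω → WithTop ℝ × Vec d := fun ω =>
      if (s ω : WithTop ℝ) < (best ω).1 then ((s ω : WithTop ℝ), weightedMean (c ω) (x ω))
      else best ω with hbest'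
    have hb'1 (r : Ω → ℝ) (hr : Measurable r) :
        MeasurableSet {ω | (r ω : WithTop ℝ) < (best' ω).1} := by
      have : {ω | (r ω : WithTop ℝ) < (best' ω).1}
          = ({ω | (s ω : WithTop ℝ) < (best ω).1} ∩ {ω | r ω < s ω})
            ∪ ({ω | (s ω : WithTop ℝ) < (best ω).1}ᶜ ∩ {ω | (r ω : WithTop ℝ) < (best ω).1}) := by
        ext ω
        by_cases h : (s ω : WithTop ℝ) < (best ω).1
        · simp [hbest', h]
        · simp [hbest', h]
      rw [this]
      exact ((hb1 s hsm).inter (measurableSet_lt hr hsm)).union ((hb1 s hsm).compl.inter (hb1 r hr))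
    have hb'2 : Measurable fun ω => (best' ω).2 := by
      simp only [hbest', apply_ite Prod.snd]
      exact Measurable.ite (hb1 s hsm) hmean hb2
    have hstep : Measurable fun ω => filterStep (c ω) fun i =>
        inner ℝ (eig (weightedCov (c ω) (x ω))) (x ω i - weightedMean (c ω) (x ω)) ^ 2 := by
      unfold filterStep
      refine measurable_pi_iff.2 fun i => ?_
      have hmax : Measurable fun ω => ⨆ j, if c ω j = 0 then (0 : ℝ) else
          inner ℝ (eig (weightedCov (c ω) (x ω))) (x ω j - weightedMean (c ω) (x ω)) ^ 2 := by
        refine Measurable.iSup fun j => Measurable.ite ?_ measurable_const (hτ j)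
        exact measurableSet_eq_fun (hci j) measurable_const
      exact (hci i).mul (measurable_const.sub ((hτ i).div hmax))
    have heq (ω : Ω) : cafLoop eig f (x ω) (k + 1) (c ω) (best ω) =
        if ∑ i, c ω i < (n : ℝ) - 2 * f then (best ω).2
        else if s ω = 0 then (best' ω).2
        else cafLoop eig f (x ω) k (filterStep (c ω) fun i =>
          inner ℝ (eig (weightedCov (c ω) (x ω))) (x ω i - weightedMean (c ω) (x ω)) ^ 2)
          (best' ω) := rfl
    simp only [heq]
    refine Measurable.ite (measurableSet_lt (by fun_prop) measurable_const) hb2 ?_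
    exact Measurable.ite (measurableSet_eq_fun hsm measurable_const) hb'2 (ih hstep hb'1 hb'2)

theorem measurable_caf {d n : ℕ} {eig : Matrix (Fin d) (Fin d) ℝ → Vec d}
    (heig : IsTopEigensolver eig) (f : ℕ) : Measurable (caf eig f : (Fin n → Vec d) → Vec d) :=
  measurable_cafLoop heig f measurable_id n measurable_const
    (fun _ _ => by simp [WithTop.coe_lt_top]) measurable_const

theorem measurable_gradient {d : ℕ} (F : Vec d → ℝ) : Measurable (gradient F) :=
  (InnerProductSpace.toDual ℝ (Vec d)).symm.continuous.measurable.comp (measurable_fderiv ℝ F)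

theorem measurable_clipGrad {d : ℕ} (c : Option ℝ) :
    Measurable (clipGrad c : Vec d → Vec d) := by
  cases c with
  | none => exact measurable_id
  | some C =>
    unfold clipGrad
    fun_prop

namespace CafCor

variable {X : Type u} {d n m : ℕ}

/-- The mean of the clipped gradients of worker `i` over its mini-batch. -/
noncomputable def batchGrad (A : CafCor X d n m) (Di : Fin m → X) (B : Finset (Fin m))
    (θ : Vec d) : Vec d :=
  (A.b : ℝ)⁻¹ • ∑ k ∈ B, clipGrad A.clip (gradient (fun z => A.loss z (Di k)) θ)

theorem noisyGrad_eq (A : CafCor X d n m) (Di : Fin m → X) (i : Fin n) (r : Round d n m)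
    (θ : Vec d) : A.noisyGrad Di i r θ = A.batchGrad Di (r.2.2 i) θ + dpNoise i r := by
  rw [noisyGrad, batchGrad, dpNoise, add_assoc]

theorem measurable_batchGrad {Ω : Type*} [MeasurableSpace Ω] (A : CafCor X d n m)
    (Di : Fin m → X) {B : Ω → Finset (Fin m)} (hB : Measurable B) {θ : Ω → Vec d}
    (hθ : Measurable θ) : Measurable fun ω => A.batchGrad Di (B ω) (θ ω) := by
  have h (k : Fin m) : Measurable fun ω =>
      clipGrad A.clip (gradient (fun z => A.loss z (Di k)) (θ ω)) :=
    (measurable_clipGrad _).comp ((measurable_gradient _).comp hθ)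
  have (ω : Ω) : A.batchGrad Di (B ω) (θ ω) = (A.b : ℝ)⁻¹ • ∑ k,
      if k ∈ B ω then clipGrad A.clip (gradient (fun z => A.loss z (Di k)) (θ ω)) else 0 := by
    rw [batchGrad]
    congr 1
    simp
  simp only [this]
  have h' (k : Fin m) : Measurable fun ω =>
      if k ∈ B ω then clipGrad A.clip (gradient (fun z => A.loss z (Di k)) (θ ω)) else 0 :=
    Measurable.ite (hB (measurableSet_mem_finset k)) (h k) measurable_const
  fun_prop

theorem measurable_noisyGrad {Ω : Type*} [MeasurableSpace Ω] (A : CafCor X d n m)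
    (Di : Fin m → X) (i : Fin n) {r : Ω → Round d n m} (hr : Measurable r) {θ : Ω → Vec d}
    (hθ : Measurable θ) : Measurable fun ω => A.noisyGrad Di i (r ω) (θ ω) := by
  have h0 : Measurable fun r : Round d n m => r.2.2 i := by fun_prop
  have h2 := A.measurable_batchGrad Di (h0.comp hr) hθ
  have h3 : Measurable fun ω => (dpNoise i (r ω) : Vec d) := (measurable_dpNoise i).comp hr
  simp only [noisyGrad_eq]
  exact h2.add h3

end CafCor

/-! ### Translations of the noise of one round -/

theorem HasImageDensity.prod {E E' : Type*} [MeasurableSpace E] [MeasurableSpace E']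
    {μ : Measure E} {μ' : Measure E'} [SFinite μ] [SFinite μ'] {T : E → E} {T' : E' → E'}
    {ζ : E → ℝ≥0∞} {ζ' : E' → ℝ≥0∞} (h : HasImageDensity μ T ζ) (h' : HasImageDensity μ' T' ζ') :
    HasImageDensity (μ.prod μ') (Prod.map T T') fun q => ζ q.1 * ζ' q.2 := by
  have h1 := h.measurable_density
  have h2 := h'.measurable_density
  refine ⟨h.measurable_map.prodMap h'.measurable_map, by fun_prop, ?_⟩
  rw [← Measure.map_prod_map _ _ h.measurable_map h'.measurable_map, h.map_eq, h'.map_eq,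
    prod_withDensity h1 h2]

theorem lintegral_exp_inner_prod_isoGaussian {ι κ : Type*} [Fintype ι] [Fintype κ] {d : ℕ}
    {v : ℝ} (hv : 0 < v) (w : ι → Vec d) (w' : κ → Vec d) :
    ∫⁻ q, ENNReal.ofReal (Real.exp (∑ i, inner ℝ (w i) (q.1 i) + ∑ i, inner ℝ (w' i) (q.2 i)))
        ∂(Measure.pi fun _ : ι => isoGaussian d v).prod (Measure.pi fun _ : κ => isoGaussian d v)
      = ENNReal.ofReal (Real.exp (v / 2 * (∑ i, ‖w i‖ ^ 2 + ∑ i, ‖w' i‖ ^ 2))) := by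
  simp_rw [Real.exp_add, ENNReal.ofReal_mul (Real.exp_pos _).le]
  rw [lintegral_prod_mul
    (f := fun x : ι → Vec d => ENNReal.ofReal (Real.exp (∑ i, inner ℝ (w i) (x i))))
    (g := fun x : κ → Vec d => ENNReal.ofReal (Real.exp (∑ i, inner ℝ (w' i) (x i))))
    (Measurable.aemeasurable (by fun_prop)) (Measurable.aemeasurable (by fun_prop)),
    lintegral_exp_inner_pi_isoGaussian hv, lintegral_exp_inner_pi_isoGaussian hv,
    ← ENNReal.ofReal_mul (Real.exp_pos _).le, ← Real.exp_add, mul_add]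

/-- The density of the Gaussian noise translated by `(w, w')`. -/
noncomputable def shiftDensity {ι κ : Type*} [Fintype ι] [Fintype κ] {d : ℕ} (v : ℝ)
    (w : ι → Vec d) (w' : κ → Vec d) (q : (ι → Vec d) × (κ → Vec d)) : ℝ≥0∞ :=
  ENNReal.ofReal (Real.exp ((∑ i, inner ℝ (w i) (q.1 i) + ∑ i, inner ℝ (w' i) (q.2 i)) / v
    - (∑ i, ‖w i‖ ^ 2 + ∑ i, ‖w' i‖ ^ 2) / (2 * v)))

theorem hasImageDensity_shiftDensity {ι κ : Type*} [Fintype ι] [Fintype κ] {d : ℕ}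
    {v : ℝ} (hv : 0 < v) (w : ι → Vec d) (w' : κ → Vec d) :
    HasImageDensity
      ((Measure.pi fun _ : ι => isoGaussian d v).prod (Measure.pi fun _ : κ => isoGaussian d v))
      (Prod.map (fun x => x + w) fun x => x + w') (shiftDensity v w w') := by
  convert (hasImageDensity_pi_isoGaussian hv w).prod (hasImageDensity_pi_isoGaussian hv w') using 2
    with q
  rw [shiftDensity, ← ENNReal.ofReal_mul (Real.exp_pos _).le, ← Real.exp_add]
  congr 2
  ring

theorem lintegral_shiftDensity_rpow {ι κ : Type*} [Fintype ι] [Fintype κ] {d : ℕ}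
    {v : ℝ} (hv : 0 < v) (w : ι → Vec d) (w' : κ → Vec d) (α : ℝ) :
    ∫⁻ q, shiftDensity v w w' q ^ α
        ∂(Measure.pi fun _ : ι => isoGaussian d v).prod (Measure.pi fun _ : κ => isoGaussian d v)
      = ENNReal.ofReal (Real.exp ((α ^ 2 - α) / (2 * v)
          * (∑ i, ‖w i‖ ^ 2 + ∑ i, ‖w' i‖ ^ 2))) := by
  have h (q : (ι → Vec d) × (κ → Vec d)) : shiftDensity v w w' q ^ α
      = ENNReal.ofReal (Real.exp (-(α / (2 * v) * (∑ i, ‖w i‖ ^ 2 + ∑ i, ‖w' i‖ ^ 2))))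
        * ENNReal.ofReal (Real.exp (∑ i, inner ℝ ((α / v) • w i) (q.1 i)
            + ∑ i, inner ℝ ((α / v) • w' i) (q.2 i))) := by
    rw [shiftDensity, ENNReal.ofReal_rpow_of_pos (Real.exp_pos _), ← Real.exp_mul,
      ← ENNReal.ofReal_mul (Real.exp_pos _).le, ← Real.exp_add]
    congr 2
    simp only [inner_smul_left, conj_trivial, ← Finset.mul_sum]
    field_simp
    ring
  simp_rw [h]
  rw [lintegral_const_mul _ (by fun_prop), lintegral_exp_inner_prod_isoGaussian hv,
    ← ENNReal.ofReal_mul (Real.exp_pos _).le, ← Real.exp_add]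
  congr 2
  simp only [norm_smul, mul_pow, ← Finset.mul_sum, Real.norm_eq_abs, sq_abs]
  field_simp
  ring

namespace CafCor

variable {X : Type u} {d n m : ℕ}

/-- The mini-batches are put outermost because the translation of the Gaussian noise will depend on
them. -/
theorem lintegral_roundLaw (A : CafCor X d n m) {v : ℝ} (hcor : A.varCor = v)
    (hind : A.varInd = v) {F : Round d n m → ℝ≥0∞} (hF : Measurable F) :
    ∫⁻ r, F r ∂A.roundLaw
      = ∫⁻ B, ∫⁻ q, F (q.1, q.2, B)
          ∂(Measure.pi fun _ : WorkerPair n => isoGaussian d v).prod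
            (Measure.pi fun _ : Fin n => isoGaussian d v)
          ∂Measure.pi fun _ : Fin n => batchLaw A.b_le := by
  unfold roundLaw
  rw [hcor, hind, ← (measurePreserving_prodAssoc _ _ _).lintegral_comp hF, lintegral_prod_symm]
  · rfl
  · exact (hF.comp MeasurableEquiv.prodAssoc.measurable).aemeasurable

theorem ae_card_batch (A : CafCor X d n m) :
    ∀ᵐ B ∂Measure.pi fun _ : Fin n => batchLaw A.b_le, ∀ i, (B i).card = A.b := by
  rw [ae_all_iff]
  intro i
  have h : ∀ᵐ B ∂batchLaw A.b_le, B.card = A.b := by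
    rw [ae_iff, batchLaw, PMF.toMeasure_uniformOfFinset_apply _ _ (Set.toFinite _).measurableSet]
    simp +contextual [Finset.filter_eq_empty_iff]
  exact (measurePreserving_eval (fun _ : Fin n => batchLaw A.b_le) i).quasiMeasurePreserving.ae h

end CafCor

/-! ### Hiding the change of one gradient in the noise -/

/-- The profile along which the noise has to be moved to compensate a change at worker `i`. -/
noncomputable def hidingWeight {n : ℕ} (H : Finset (Fin n)) (i j : Fin n) : ℝ :=
  -- The solution on H of (h+1) a_j - ∑ a = 1_{j=i}, that is, of (Laplacian of the complete graph +
  -- identity) a = e_i.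
  if j ∈ H then (1 + if j = i then 1 else 0) / (H.card + 1) else 0

theorem sum_hidingWeight {n : ℕ} {H : Finset (Fin n)} {i : Fin n} (hi : i ∈ H) :
    ∑ j ∈ H, hidingWeight H i j = 1 := by
  have h (j) (hj : j ∈ H) : hidingWeight H i j = (1 + if j = i then 1 else 0) / (H.card + 1) := by
    simp [hidingWeight, hj]
  rw [Finset.sum_congr rfl h, ← Finset.sum_div, Finset.sum_add_distrib, Finset.sum_ite_eq' H i]
  simp only [hi, if_true, Finset.sum_const, nsmul_eq_mul, mul_one]
  field_simp

theorem sum_hidingWeight_sq {n : ℕ} {H : Finset (Fin n)} {i : Fin n} (hi : i ∈ H) :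
    ∑ j ∈ H, hidingWeight H i j ^ 2 = (H.card + 3) / (H.card + 1) ^ 2 := by
  have h (j) (hj : j ∈ H) : hidingWeight H i j ^ 2
      = (1 + if j = i then 3 else 0) / (H.card + 1) ^ 2 := by
    simp only [hidingWeight, hj, if_true, div_pow]
    congr 1
    split_ifs <;> norm_num
  rw [Finset.sum_congr rfl h, ← Finset.sum_div, Finset.sum_add_distrib, Finset.sum_ite_eq' H i]
  simp [hi]

/-- The translation of the secrets between honest workers that hides a change `Δ` at `i`. -/
noncomputable def secretShift {d n : ℕ} (H : Finset (Fin n)) (i : Fin n) (Δ : Vec d)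
    (p : WorkerPair n) : Vec d :=
  if p.1.1 ∈ H ∧ p.1.2 ∈ H then (hidingWeight H i p.1.1 - hidingWeight H i p.1.2) • Δ else 0

/-- The translation of the individual noises that hides a change `Δ` at `i`. -/
noncomputable def indShift {d n : ℕ} (H : Finset (Fin n)) (i : Fin n) (Δ : Vec d)
    (j : Fin n) : Vec d :=
  hidingWeight H i j • Δ

/-- The secrets contribute h∑a² - (∑a)² and the individual noises ∑a², together (h+1)∑a² - 1 with
∑a² = (h+3)/(h+1)². The order 1/h shows that all honest workers share in hiding the change at one of
them. -/
theorem norm_shift_sq {d n : ℕ} {H : Finset (Fin n)} {i : Fin n} (hi : i ∈ H) (Δ : Vec d) :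
    ∑ p, ‖secretShift H i Δ p‖ ^ 2 + ∑ j, ‖indShift H i Δ j‖ ^ 2
      = 2 / (H.card + 1) * ‖Δ‖ ^ 2 := by
  set a := hidingWeight H i with ha
  have h1 : ∑ p, ‖secretShift H i Δ p‖ ^ 2
      = (H.card * ∑ j ∈ H, a j ^ 2 - (∑ j ∈ H, a j) ^ 2) * ‖Δ‖ ^ 2 := by
    have h2 := sum_sum_eq_sum_workerPair fun j k =>
      if j ∈ H ∧ k ∈ H then (a j - a k) ^ 2 else 0
    have h3 (p : WorkerPair n) : ‖secretShift H i Δ p‖ ^ 2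
        = (if p.1.1 ∈ H ∧ p.1.2 ∈ H then (a p.1.1 - a p.1.2) ^ 2 else 0) * ‖Δ‖ ^ 2 := by
      unfold secretShift
      split_ifs
      · rw [norm_smul, mul_pow, Real.norm_eq_abs, sq_abs]
      · simp
    have h4 (p : WorkerPair n) : (if p.1.2 ∈ H ∧ p.1.1 ∈ H then (a p.1.2 - a p.1.1) ^ 2 else 0)
        = if p.1.1 ∈ H ∧ p.1.2 ∈ H then (a p.1.1 - a p.1.2) ^ 2 else 0 := by
      simp only [and_comm (a := p.1.2 ∈ H), ← neg_sub (a p.1.1), neg_sq]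
    simp only [h4, sub_self, ne_eq, OfNat.ofNat_ne_zero, not_false_eq_true, zero_pow, ite_self,
      Finset.sum_const_zero, add_zero, ← two_mul, ← Finset.mul_sum] at h2
    have h5 : ∑ j, ∑ k, (if j ∈ H ∧ k ∈ H then (a j - a k) ^ 2 else 0)
        = 2 * (H.card * ∑ j ∈ H, a j ^ 2) - 2 * (∑ j ∈ H, a j) ^ 2 := by
      have h6 : ∑ j, ∑ k, (if j ∈ H ∧ k ∈ H then (a j - a k) ^ 2 else 0)
          = ∑ j ∈ H, ∑ k ∈ H, (a j - a k) ^ 2 := by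
        rw [← Finset.sum_subset (Finset.subset_univ H) fun j _ hj => by simp [hj]]
        refine Finset.sum_congr rfl fun j hj => ?_
        simp [hj, Finset.sum_ite_mem]
      have h7 : (∑ j ∈ H, a j) ^ 2 = ∑ j ∈ H, ∑ k ∈ H, a j * a k := by
        rw [sq, Finset.sum_mul_sum]
      rw [h6, h7]
      simp only [sub_sq, Finset.sum_add_distrib, Finset.sum_sub_distrib, Finset.sum_const,
        nsmul_eq_mul, mul_assoc, ← Finset.mul_sum]
      ring
    rw [Finset.sum_congr rfl fun p _ => h3 p, ← Finset.sum_mul]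
    congr 1
    linarith
  have h2 : ∑ j, ‖indShift H i Δ j‖ ^ 2 = (∑ j ∈ H, a j ^ 2) * ‖Δ‖ ^ 2 := by
    rw [Finset.sum_mul, ← Finset.sum_subset (Finset.subset_univ H)]
    · refine Finset.sum_congr rfl fun j _ => ?_
      rw [indShift, norm_smul, mul_pow, Real.norm_eq_abs, sq_abs]
    · intro j _ hj
      simp [indShift, hidingWeight, hj]
  rw [h1, h2, sum_hidingWeight hi, sum_hidingWeight_sq hi]
  field_simp
  ring

/-- A round in which the secrets in `known` are overwritten by `s`. -/
noncomputable def revealRound {d n m : ℕ} (known : Set (WorkerPair n)) (s : WorkerPair n → Vec d)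
    (r : Round d n m) : Round d n m :=
  open Classical in (fun p => if p ∈ known then s p else r.1 p, r.2)

theorem measurable_revealRound {d n m : ℕ} (known : Set (WorkerPair n)) (s : WorkerPair n → Vec d) :
    Measurable (revealRound known s : Round d n m → Round d n m) := by
  classical
  unfold revealRound
  refine Measurable.prodMk (measurable_pi_iff.2 fun p => ?_) measurable_snd
  by_cases h : p ∈ known
  · simp [h]
  · simp only [h, if_false]
    fun_prop

/-- Only secrets between honest workers are translated; the others are revealed and thus unavailable
for hiding. At j the translations add up to ((h+1) a_j - ∑ a) Δ. -/
theorem dpNoise_shift {d n m : ℕ} {H : Finset (Fin n)} {i : Fin n} (hi : i ∈ H) (Δ : Vec d)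
    (s : WorkerPair n → Vec d) (r : Round d n m) {j : Fin n} (hj : j ∈ H) :
    dpNoise j (revealRound (CafCor.maliciousSecrets H) s
        (r.1 + secretShift H i Δ, r.2.1 + indShift H i Δ, r.2.2))
      = dpNoise j (revealRound (CafCor.maliciousSecrets H) s r) + if j = i then Δ else 0 := by
  classical
  set a := hidingWeight H i with ha
  have h1 (k : Fin n) : pairNoise (revealRound (CafCor.maliciousSecrets H) s
        (r.1 + secretShift H i Δ, r.2.1 + indShift H i Δ, r.2.2)).1 j k
      = pairNoise (revealRound (CafCor.maliciousSecrets H) s r).1 j k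
        + if k ∈ H then (a j - a k) • Δ else 0 := by
    by_cases hk : k ∈ H
    · rcases lt_trichotomy j k with h | h | h
      · simp [pairNoise, revealRound, CafCor.maliciousSecrets, secretShift, h, hj, hk, ← ha]
      · simp [h, pairNoise_self]
      · simp [pairNoise, revealRound, CafCor.maliciousSecrets, secretShift, h, h.not_gt, hj, hk,
          ← ha]
        module
    · rcases lt_trichotomy j k with h | h | h
      · simp [pairNoise, revealRound, CafCor.maliciousSecrets, h, hk]
      · simp [h, pairNoise_self, hk]
      · simp [pairNoise, revealRound, CafCor.maliciousSecrets, h, h.not_gt, hk]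
  have h2 : ∑ k, (if k ∈ H then (a j - a k) • Δ else 0) + a j • Δ = if j = i then Δ else 0 := by
    rw [Finset.sum_ite_mem, Finset.univ_inter, ← Finset.sum_smul, ← add_smul,
      Finset.sum_sub_distrib, sum_hidingWeight hi]
    have : (∑ _k ∈ H, a j) - 1 + a j = if j = i then 1 else 0 := by
      simp only [Finset.sum_const, nsmul_eq_mul, ha, hidingWeight, hj, if_true]
      field_simp
      ring
    rw [this]
    split_ifs <;> simp
  rw [dpNoise, dpNoise, Finset.sum_congr rfl fun k _ => h1 k, Finset.sum_add_distrib, ← h2]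
  simp only [revealRound, Pi.add_apply, indShift, ← ha]
  abel

theorem norm_clipGrad_le {d : ℕ} {C : ℝ} (hC : 0 < C) (g : Vec d) :
    ‖clipGrad (some C) g‖ ≤ C := by
  rw [clipGrad, norm_smul, Real.norm_of_nonneg (by positivity)]
  rcases eq_or_ne g 0 with rfl | hg
  · simpa using hC.le
  · have := norm_pos_iff.2 hg
    calc min 1 (C / ‖g‖) * ‖g‖ ≤ C / ‖g‖ * ‖g‖ := by gcongr; exact min_le_right _ _
      _ = C := by field_simp

theorem CafCor.norm_batchGrad_le {X : Type u} {d n m : ℕ} (A : CafCor X d n m) {C : ℝ}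
    (hC : 0 < C) (hclip : A.clip = some C) (hb : 0 < A.b) (Di : Fin m → X)
    {B : Finset (Fin m)} (hB : B.card = A.b) (θ : Vec d) : ‖A.batchGrad Di B θ‖ ≤ C := by
  have hb' : (0 : ℝ) < A.b := by exact_mod_cast hb
  rw [batchGrad, norm_smul, norm_inv, Real.norm_of_nonneg hb'.le, inv_mul_le_iff₀ hb', ← hB,
    hclip, ← nsmul_eq_mul]
  exact norm_sum_le_of_le _ (fun k _ => norm_clipGrad_le hC _) |>.trans (by simp)

/-! ### Privacy of CafCor -/

namespace CafCor

variable {X : Type u} {d n m : ℕ}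

/-- The part of a state that is relevant for the transcript: the model, the momenta of the honest
workers, and the messages of the earlier rounds. -/
abbrev HonestState (d n : ℕ) : Type := Vec d × (Fin n → Vec d) × (ℕ → Fin n → Vec d)

/-- The messages sent in a round, as a function of the honest state. -/
noncomputable def stateMessages (H : Finset (Fin n)) (adv : ℕ → (ℕ → Fin n → Vec d) → Fin n → Vec d)
    (t : ℕ) (s : HonestState d n) : Fin n → Vec d :=
  messages H adv t ⟨s.1, s.2.1, s.2.2⟩

/-- The model after a round, as a function of the honest state. -/
noncomputable def nextModel (A : CafCor X d n m) (H : Finset (Fin n))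
    (adv : ℕ → (ℕ → Fin n → Vec d) → Fin n → Vec d) (t : ℕ) (s : HonestState d n) : Vec d :=
  s.1 - A.γ t • caf A.eig A.f (stateMessages H adv t s)

/-- The transition of the honest state, when the secrets in `known` are `sec`. -/
noncomputable def honestStep (A : CafCor X d n m) (H : Finset (Fin n)) (D : Fin n → Fin m → X)
    (adv : ℕ → (ℕ → Fin n → Vec d) → Fin n → Vec d) (known : Set (WorkerPair n))
    (sec : ℕ → WorkerPair n → Vec d) (t : ℕ) (s : HonestState d n) (r : Round d n m) :
    HonestState d n :=
  (A.nextModel H adv t s,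
    fun i => if i ∈ H then A.β t • s.2.1 i + (1 - A.β t) •
      A.noisyGrad (D i) i (revealRound known (sec (t + 1)) r) (A.nextModel H adv t s) else 0,
    Function.update s.2.2 t (stateMessages H adv t s))

theorem messages_congr {H : Finset (Fin n)} (adv : ℕ → (ℕ → Fin n → Vec d) → Fin n → Vec d) (t : ℕ)
    {s s' : RoundState d n} (h : ∀ i ∈ H, s.mom i = s'.mom i) (hl : s.log = s'.log) :
    messages H adv t s = messages H adv t s' := by
  have : (fun j => if j ∈ H then s.mom j else 0) = fun j => if j ∈ H then s'.mom j else 0 := by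
    funext j
    split_ifs with hj
    exacts [h j hj, rfl]
  funext i
  simp only [messages, this, hl]
  split_ifs with hi
  exacts [h i hi, rfl]

/-- Momenta outside H never enter a message, so `honestStep` sets them to 0; in this way the data of
such workers drop out of the process. -/
theorem run_eq_markovPath (A : CafCor X d n m) (H : Finset (Fin n)) (D : Fin n → Fin m → X)
    (adv : ℕ → (ℕ → Fin n → Vec d) → Fin n → Vec d) (known : Set (WorkerPair n))
    (sec : ℕ → WorkerPair n → Vec d) (ω : ℕ → Round d n m) (t : ℕ) :
    let s := A.run H D adv (reveal known sec ω) t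
    let p := markovPath (A.honestStep H D adv known sec) (A.θ₀, 0, 0) ω t
    p.1 = s.θ ∧ (∀ i ∈ H, p.2.1 i = s.mom i) ∧ p.2.2 = s.log := by
  induction t with
  | zero => exact ⟨rfl, fun _ _ => rfl, rfl⟩
  | succ t ih =>
    obtain ⟨h1, h2, h3⟩ := ih
    have hmsg : stateMessages H adv t
        (markovPath (A.honestStep H D adv known sec) (A.θ₀, 0, 0) ω t)
        = messages H adv t (A.run H D adv (reveal known sec ω) t) :=
      messages_congr adv t h2 h3
    have hθ : A.nextModel H adv t
        (markovPath (A.honestStep H D adv known sec) (A.θ₀, 0, 0) ω t)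
        = (A.run H D adv (reveal known sec ω) (t + 1)).θ := by
      rw [nextModel, hmsg, h1]
      rfl
    refine ⟨hθ, fun i hi => ?_, ?_⟩
    · simp only [markovPath, honestStep, if_pos hi, hθ, h2 i hi]
      rfl
    · simp only [markovPath, honestStep, hmsg, h3]
      rfl

/-- The models are determined by the messages. -/
noncomputable def modelOfLog (A : CafCor X d n m) (log : ℕ → Fin n → Vec d) : ℕ → Vec d
  | 0 => A.θ₀
  | t + 1 => modelOfLog A log t - A.γ t • caf A.eig A.f (log t)

theorem run_log_of_lt (A : CafCor X d n m) (H : Finset (Fin n)) (D : Fin n → Fin m → X)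
    (adv : ℕ → (ℕ → Fin n → Vec d) → Fin n → Vec d) (ω : ℕ → Round d n m) {t T : ℕ} (h : t < T) :
    (A.run H D adv ω T).log t = messages H adv t (A.run H D adv ω t) := by
  induction T with
  | zero => omega
  | succ T ih =>
    rcases Nat.lt_succ_iff_lt_or_eq.1 h with h | rfl
    · rw [← ih h]
      exact Function.update_of_ne h.ne _ _
    · exact Function.update_self _ _ _

theorem modelOfLog_run (A : CafCor X d n m) (H : Finset (Fin n)) (D : Fin n → Fin m → X)
    (adv : ℕ → (ℕ → Fin n → Vec d) → Fin n → Vec d) (ω : ℕ → Round d n m) {t T : ℕ} (h : t ≤ T) :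
    A.modelOfLog (A.run H D adv ω T).log t = (A.run H D adv ω t).θ := by
  induction t with
  | zero => rfl
  | succ t ih =>
    rw [modelOfLog, ih (Nat.le_of_succ_le h), run_log_of_lt A H D adv ω h]
    rfl

/-- The transcript as a function of the messages. -/
noncomputable def transcriptOfLog (A : CafCor X d n m) (log : ℕ → Fin n → Vec d) :
    (Fin (A.T + 1) → Vec d) × (Fin A.T → Fin n → Vec d) :=
  (fun t => A.modelOfLog log t, fun t => log t)

/-- Since the models can be recomputed from the messages, only the log has to be protected. -/
theorem transcript_eq (A : CafCor X d n m) (H : Finset (Fin n)) (D : Fin n → Fin m → X)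
    (adv : ℕ → (ℕ → Fin n → Vec d) → Fin n → Vec d) (ω : ℕ → Round d n m) :
    A.transcript H D adv ω = A.transcriptOfLog (A.run H D adv ω A.T).log := by
  refine Prod.ext (funext fun t => ?_) rfl
  exact (modelOfLog_run A H D adv ω (Nat.le_of_lt_succ t.2)).symm

theorem measurable_transcriptOfLog (A : CafCor X d n m) (heig : IsTopEigensolver A.eig) :
    Measurable A.transcriptOfLog := by
  have h (t : ℕ) : Measurable fun log => A.modelOfLog log t := by
    induction t with
    | zero => exact measurable_const
    | succ t ih =>
      have : Measurable fun log : ℕ → Fin n → Vec d => caf A.eig A.f (log t) :=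
        (measurable_caf heig A.f).comp (measurable_pi_apply t)
      have h : Measurable fun log : ℕ → Fin n → Vec d => A.γ t • caf A.eig A.f (log t) := by
        fun_prop
      exact ih.sub h
  exact (measurable_pi_iff.2 fun t : Fin (A.T + 1) => h t).prodMk
    (measurable_pi_iff.2 fun t : Fin A.T => measurable_pi_apply (t : ℕ))

theorem measurable_update_row {Ω : Type*} [MeasurableSpace Ω] {log : Ω → ℕ → Fin n → Vec d}
    (hlog : Measurable log) {x : Ω → Fin n → Vec d} (hx : Measurable x) (t : ℕ) :
    Measurable fun ω => Function.update (log ω) t (x ω) := by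
  refine measurable_pi_iff.2 fun j => ?_
  by_cases h : j = t
  · subst h; simpa using hx
  · simp only [Function.update_of_ne h]
    exact (measurable_pi_apply j).comp hlog

theorem measurable_stateMessages (H : Finset (Fin n))
    {adv : ℕ → (ℕ → Fin n → Vec d) → Fin n → Vec d} (hadv : ∀ t, Measurable (adv t)) (t : ℕ) :
    Measurable (stateMessages H adv t : HonestState d n → Fin n → Vec d) := by
  have h1 : Measurable fun s : HonestState d n => fun j => if j ∈ H then s.2.1 j else 0 := by
    refine measurable_pi_iff.2 fun j => ?_
    split_ifs <;> fun_prop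
  have h2 : Measurable fun s : HonestState d n => adv t (Function.update s.2.2 t
      fun j => if j ∈ H then s.2.1 j else 0) :=
    (hadv t).comp (measurable_update_row (by fun_prop) h1 t)
  refine measurable_pi_iff.2 fun i => ?_
  simp only [stateMessages, messages]
  split_ifs
  · fun_prop
  · exact (measurable_pi_apply i).comp h2

theorem measurable_nextModel (A : CafCor X d n m) (heig : IsTopEigensolver A.eig)
    (H : Finset (Fin n)) {adv : ℕ → (ℕ → Fin n → Vec d) → Fin n → Vec d}
    (hadv : ∀ t, Measurable (adv t)) (t : ℕ) : Measurable (A.nextModel H adv t) := by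
  have h1 : Measurable fun s : HonestState d n => caf A.eig A.f (stateMessages H adv t s) :=
    (measurable_caf heig A.f).comp (measurable_stateMessages H hadv t)
  unfold nextModel
  fun_prop

theorem measurable_honestStep (A : CafCor X d n m) (heig : IsTopEigensolver A.eig)
    (H : Finset (Fin n)) (D : Fin n → Fin m → X) {adv : ℕ → (ℕ → Fin n → Vec d) → Fin n → Vec d}
    (hadv : ∀ t, Measurable (adv t)) (known : Set (WorkerPair n)) (sec : ℕ → WorkerPair n → Vec d)
    (t : ℕ) :
    Measurable fun p : HonestState d n × Round d n m => A.honestStep H D adv known sec t p.1 p.2 := by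
  have h1 : Measurable fun p : HonestState d n × Round d n m => A.nextModel H adv t p.1 :=
    (A.measurable_nextModel heig H hadv t).comp measurable_fst
  have h2 : Measurable fun p : HonestState d n × Round d n m =>
      revealRound known (sec (t + 1)) p.2 :=
    (measurable_revealRound known (sec (t + 1))).comp measurable_snd
  have h3 : Measurable fun p : HonestState d n × Round d n m => stateMessages H adv t p.1 :=
    (measurable_stateMessages H hadv t).comp measurable_fst
  refine h1.prodMk (Measurable.prodMk (measurable_pi_iff.2 fun i => ?_)
    (measurable_update_row (by fun_prop) h3 t))
  split_ifs
  · have h4 : Measurable fun p : HonestState d n × Round d n m => p.1.2.1 i := by fun_prop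
    have h5 := A.measurable_noisyGrad (D i) i h2 h1
    fun_prop
  · exact measurable_const

/-- The next model is fixed before the round's noise is drawn, so Δ depends only on the state and
the mini-batches. For these fixed, the map on the Gaussian noise is a genuine translation. -/
theorem honestStep_shift (A : CafCor X d n m) {H : Finset (Fin n)} {D D' : Fin n → Fin m → X}
    (adv : ℕ → (ℕ → Fin n → Vec d) → Fin n → Vec d) (sec : ℕ → WorkerPair n → Vec d) {i : Fin n}
    (hi : i ∈ H) (hD : ∀ j, j ≠ i → D j = D' j) (t : ℕ) (s : HonestState d n) (r : Round d n m)
    {Δ : Vec d} (hΔ : Δ = A.batchGrad (D i) (r.2.2 i) (A.nextModel H adv t s)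
      - A.batchGrad (D' i) (r.2.2 i) (A.nextModel H adv t s)) :
    A.honestStep H D' adv (maliciousSecrets H) sec t s
        (r.1 + secretShift H i Δ, r.2.1 + indShift H i Δ, r.2.2)
      = A.honestStep H D adv (maliciousSecrets H) sec t s r := by
  have key (j : Fin n) (hj : j ∈ H) : A.noisyGrad (D' j) j
      (revealRound (maliciousSecrets H) (sec (t + 1))
        (r.1 + secretShift H i Δ, r.2.1 + indShift H i Δ, r.2.2)) (A.nextModel H adv t s)
      = A.noisyGrad (D j) j (revealRound (maliciousSecrets H) (sec (t + 1)) r)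
        (A.nextModel H adv t s) := by
    rw [noisyGrad_eq, noisyGrad_eq, dpNoise_shift hi Δ _ _ hj]
    by_cases hji : j = i
    · subst hji
      simp only [revealRound, if_true, hΔ]
      abel
    · simp only [revealRound, if_neg hji, add_zero, hD j hji]
  unfold honestStep
  congr 2
  funext j
  split_ifs with hj
  · rw [key j hj]
  · rfl

end CafCor

namespace CafCor

variable {X : Type u} {d n m : ℕ}

theorem measurable_shiftDensity {Ω ι κ : Type*} [MeasurableSpace Ω] [Fintype ι] [Fintype κ] {v : ℝ}
    {w : Ω → ι → Vec d} (hw : Measurable w) {w' : Ω → κ → Vec d} (hw' : Measurable w')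
    {q : Ω → (ι → Vec d) × (κ → Vec d)} (hq : Measurable q) :
    Measurable fun ω => shiftDensity v (w ω) (w' ω) (q ω) := by
  unfold shiftDensity
  fun_prop

/-- The calibration of the noise. With l = log(1/δ) and a = 2l/ε, the T moment bounds add at most
a(1+a)ε²/(8l) = ε/4 + l/2 to the exponent -aε = -2l, and ε ≤ l keeps the result below -l. -/
theorem exp_mul_pow_le {C ε δ v h : ℝ} {T : ℕ} (hε : 0 < ε) (hδ : 0 < δ)
    (hεδ : ε ≤ Real.log (1 / δ)) (hv : 0 < v) (hh : 0 < h)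
    (hvar : 32 * C ^ 2 * T * Real.log (1 / δ) ≤ v * ε ^ 2 * h) :
    ENNReal.ofReal (Real.exp (-(2 * Real.log (1 / δ) / ε * ε)))
        * ENNReal.ofReal (Real.exp (((1 + 2 * Real.log (1 / δ) / ε) ^ 2
            - (1 + 2 * Real.log (1 / δ) / ε)) / (2 * v) * (2 / h * (2 * C) ^ 2))) ^ T
      ≤ ENNReal.ofReal δ := by
  set l := Real.log (1 / δ) with hl
  have hlpos : 0 < l := hε.trans_le hεδ
  have hδl : δ = Real.exp (-l) := by
    rw [hl, one_div, Real.log_inv, neg_neg, Real.exp_log hδ]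
  rw [← ENNReal.ofReal_pow (Real.exp_pos _).le, ← Real.exp_nat_mul,
    ← ENNReal.ofReal_mul (Real.exp_pos _).le, ← Real.exp_add, hδl]
  refine ENNReal.ofReal_le_ofReal (Real.exp_le_exp.2 ?_)
  have h1 : 2 * l / ε * ε = 2 * l := by field_simp
  have h2 : T * (((1 + 2 * l / ε) ^ 2 - (1 + 2 * l / ε)) / (2 * v) * (2 / h * (2 * C) ^ 2))
      = (2 * l / ε) * (1 + 2 * l / ε) * (32 * C ^ 2 * T * l) / (8 * l * v * h) := by
    field_simp
    ring
  have h3 : (2 * l / ε) * (1 + 2 * l / ε) * (32 * C ^ 2 * T * l) / (8 * l * v * h)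
      ≤ (2 * l / ε) * (1 + 2 * l / ε) * (v * ε ^ 2 * h) / (8 * l * v * h) := by gcongr
  have h4 : (2 * l / ε) * (1 + 2 * l / ε) * (v * ε ^ 2 * h) / (8 * l * v * h)
      = ε / 4 + l / 2 := by
    field_simp
    ring
  rw [h1, h2]
  linarith

theorem lintegral_roundLaw_shift (A : CafCor X d n m) {v : ℝ} (hv : 0 < v) (hcor : A.varCor = v)
    (hind : A.varInd = v) {w : (Fin n → Finset (Fin m)) → WorkerPair n → Vec d}
    {w' : (Fin n → Finset (Fin m)) → Fin n → Vec d}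
    (hz : Measurable fun r : Round d n m => shiftDensity v (w r.2.2) (w' r.2.2) (r.1, r.2.1))
    {G G' : Round d n m → ℝ≥0∞} (hG : Measurable G) (hG' : Measurable G')
    (h : ∀ r, G' (r.1 + w r.2.2, r.2.1 + w' r.2.2, r.2.2) = G r) :
    ∫⁻ r, G r ∂A.roundLaw
      = ∫⁻ r, shiftDensity v (w r.2.2) (w' r.2.2) (r.1, r.2.1) * G' r ∂A.roundLaw := by
  rw [A.lintegral_roundLaw hcor hind hG, A.lintegral_roundLaw hcor hind (hz.fun_mul hG')]
  refine lintegral_congr fun B => ?_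
  have hq : Measurable fun q : (WorkerPair n → Vec d) × (Fin n → Vec d) => G' (q.1, q.2, B) :=
    hG'.comp (by fun_prop)
  refine Eq.trans (lintegral_congr fun q => ?_)
    ((hasImageDensity_shiftDensity hv (w B) (w' B)).lintegral_comp hq)
  exact (h (q.1, q.2, B)).symm

theorem lintegral_roundLaw_shiftDensity_rpow_le (A : CafCor X d n m) {v : ℝ} (hv : 0 < v)
    (hcor : A.varCor = v) (hind : A.varInd = v)
    {w : (Fin n → Finset (Fin m)) → WorkerPair n → Vec d}
    {w' : (Fin n → Finset (Fin m)) → Fin n → Vec d}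
    (hz : Measurable fun r : Round d n m => shiftDensity v (w r.2.2) (w' r.2.2) (r.1, r.2.1))
    {R a : ℝ} (ha : 0 ≤ a)
    (hR : ∀ B, (∀ i, (B i).card = A.b) → ∑ p, ‖w B p‖ ^ 2 + ∑ j, ‖w' B j‖ ^ 2 ≤ R) :
    ∫⁻ r, shiftDensity v (w r.2.2) (w' r.2.2) (r.1, r.2.1) ^ (1 + a) ∂A.roundLaw
      ≤ ENNReal.ofReal (Real.exp (((1 + a) ^ 2 - (1 + a)) / (2 * v) * R)) := by
  rw [A.lintegral_roundLaw hcor hind (hz.pow_const _)]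
  calc _ ≤ ∫⁻ _, ENNReal.ofReal (Real.exp (((1 + a) ^ 2 - (1 + a)) / (2 * v) * R))
        ∂Measure.pi fun _ : Fin n => batchLaw A.b_le := by
        refine lintegral_mono_ae ?_
        filter_upwards [A.ae_card_batch] with B hB
        refine (lintegral_shiftDensity_rpow hv _ _ _).le.trans ?_
        have h1 := hR B hB
        have h4 : 0 ≤ ((1 + a) ^ 2 - (1 + a)) / (2 * v) := by
          have : (1 + a) ^ 2 - (1 + a) = a * (1 + a) := by ring
          rw [this]
          positivity
        gcongr
    _ = _ := by simp

theorem measurable_shiftDensity_hiding {Ω : Type*} [MeasurableSpace Ω] (v : ℝ) (H : Finset (Fin n))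
    (i : Fin n) {Δ : Ω → Vec d} (hΔ : Measurable Δ)
    {q : Ω → (WorkerPair n → Vec d) × (Fin n → Vec d)} (hq : Measurable q) :
    Measurable fun ω => shiftDensity v (secretShift H i (Δ ω)) (indShift H i (Δ ω)) (q ω) := by
  refine measurable_shiftDensity (measurable_pi_iff.2 fun p => ?_)
    (measurable_pi_iff.2 fun j => ?_) hq
  · unfold secretShift
    split_ifs <;> fun_prop
  · unfold indShift
    fun_prop

/-- The difference that replacing the data of worker `i` makes to its gradient. -/
noncomputable def gradChange (A : CafCor X d n m) (H : Finset (Fin n)) (D D' : Fin n → Fin m → X)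
    (adv : ℕ → (ℕ → Fin n → Vec d) → Fin n → Vec d) (i : Fin n) (t : ℕ) (s : HonestState d n)
    (B : Fin n → Finset (Fin m)) : Vec d :=
  A.batchGrad (D i) (B i) (A.nextModel H adv t s)
    - A.batchGrad (D' i) (B i) (A.nextModel H adv t s)

theorem measurable_gradChange (A : CafCor X d n m) (heig : IsTopEigensolver A.eig)
    (H : Finset (Fin n)) (D D' : Fin n → Fin m → X)
    {adv : ℕ → (ℕ → Fin n → Vec d) → Fin n → Vec d} (hadv : ∀ t, Measurable (adv t)) (i : Fin n)
    (t : ℕ) : Measurable fun p : HonestState d n × Round d n m =>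
      A.gradChange H D D' adv i t p.1 p.2.2.2 := by
  have h1 : Measurable fun p : HonestState d n × Round d n m => A.nextModel H adv t p.1 :=
    (A.measurable_nextModel heig H hadv t).comp measurable_fst
  have h2 : Measurable fun p : HonestState d n × Round d n m => p.2.2.2 i := by fun_prop
  exact (A.measurable_batchGrad _ h2 h1).sub (A.measurable_batchGrad _ h2 h1)

theorem norm_gradChange_le (A : CafCor X d n m) (H : Finset (Fin n)) (D D' : Fin n → Fin m → X)
    (adv : ℕ → (ℕ → Fin n → Vec d) → Fin n → Vec d) (i : Fin n) (t : ℕ) (s : HonestState d n)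
    {C : ℝ} (hC : 0 < C) (hclip : A.clip = some C) (hb : 0 < A.b) {B : Fin n → Finset (Fin m)}
    (hB : ∀ i, (B i).card = A.b) : ‖A.gradChange H D D' adv i t s B‖ ≤ 2 * C := by
  refine (norm_sub_le _ _).trans ?_
  have h2 := A.norm_batchGrad_le hC hclip hb (D i) (hB i) (A.nextModel H adv t s)
  have h3 := A.norm_batchGrad_le hC hclip hb (D' i) (hB i) (A.nextModel H adv t s)
  linarith

theorem secLDP_maliciousSecrets (A : CafCor X d n m) (heig : IsTopEigensolver A.eig)
    (H : Finset (Fin n)) (hb : 0 < A.b) {C ε δ v : ℝ} (hC : 0 < C) (hclip : A.clip = some C)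
    (hε : 0 < ε) (hδ : 0 < δ) (hεδ : ε ≤ Real.log (1 / δ)) (hv : 0 < v) (hcor : A.varCor = v)
    (hind : A.varInd = v)
    (hvar : 32 * C ^ 2 * A.T * Real.log (1 / δ) ≤ v * ε ^ 2 * (H.card + 1)) :
    A.SecLDP H (maliciousSecrets H) ε δ := by
  intro sec adv hadv D D' hDD Y hY
  obtain ⟨i, hD⟩ := hDD
  have hset (E : Fin n → Fin m → X) :
      {ω | A.transcript H E adv (reveal (maliciousSecrets H) sec ω) ∈ Y}
        = {ω | markovPath (A.honestStep H E adv (maliciousSecrets H) sec) (A.θ₀, 0, 0) ω A.T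
            ∈ (fun s : HonestState d n => A.transcriptOfLog s.2.2) ⁻¹' Y} := by
    ext ω
    obtain ⟨-, -, h⟩ := A.run_eq_markovPath H E adv (maliciousSecrets H) sec ω A.T
    simp only [Set.mem_ofPred_eq, Set.mem_preimage, transcript_eq, h]
  rw [hset, hset]
  by_cases hi : i ∈ H
  · have hYm : MeasurableSet ((fun s : HonestState d n => A.transcriptOfLog s.2.2) ⁻¹' Y) :=
      ((A.measurable_transcriptOfLog heig).comp (measurable_snd.comp measurable_snd)) hY
    have hstep := A.measurable_honestStep heig H D hadv (maliciousSecrets H) sec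
    have hstep' := A.measurable_honestStep heig H D' hadv (maliciousSecrets H) sec
    have hΔm := A.measurable_gradChange heig H D D' hadv i
    have hshift (t : ℕ) (s : HonestState d n) (r : Round d n m) :=
      A.honestStep_shift adv sec hi hD t s r (Δ := A.gradChange H D D' adv i t s r.2.2) rfl
    have hΔn (t : ℕ) (s : HonestState d n) (B : Fin n → Finset (Fin m))
        (hB : ∀ i, (B i).card = A.b) := A.norm_gradChange_le H D D' adv i t s hC hclip hb hB
    -- Only measurability, the shift identity and the bound 2C are used from now on.
    generalize A.gradChange H D D' adv i = Δ at hΔm hshift hΔn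
    generalize A.honestStep H D adv (maliciousSecrets H) sec = step at hshift hstep ⊢
    generalize A.honestStep H D' adv (maliciousSecrets H) sec = step' at hshift hstep' ⊢
    obtain ⟨z, hz⟩ : ∃ z : ℕ → HonestState d n → Round d n m → ℝ≥0∞, ∀ t s r, z t s r =
      shiftDensity v (secretShift H i (Δ t s r.2.2)) (indShift H i (Δ t s r.2.2)) (r.1, r.2.1) :=
      ⟨_, fun _ _ _ => rfl⟩
    have hzm (t : ℕ) : Measurable fun p : HonestState d n × Round d n m => z t p.1 p.2 := by
      simp only [hz]
      exact measurable_shiftDensity_hiding v H i (hΔm t) (by fun_prop)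
    have hzs (t : ℕ) (s : HonestState d n) : Measurable fun r => z t s r :=
      (hzm t).comp measurable_prodMk_left
    simp only [hz] at hzs
    have hdens (t : ℕ) (s : HonestState d n) (F : HonestState d n → ℝ≥0∞) (hF : Measurable F) :
        ∫⁻ r, F (step t s r) ∂A.roundLaw = ∫⁻ r, z t s r * F (step' t s r) ∂A.roundLaw := by
      have h1 : Measurable fun r => F (step t s r) := hF.comp ((hstep t).comp measurable_prodMk_left)
      have h2 : Measurable fun r => F (step' t s r) :=
        hF.comp ((hstep' t).comp measurable_prodMk_left)
      simp only [hz]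
      exact A.lintegral_roundLaw_shift hv hcor hind
        (w := fun B => secretShift H i (Δ t s B)) (w' := fun B => indShift H i (Δ t s B))
        (hzs t s) h1 h2 fun r => congrArg F (hshift t s r)
    set a : ℝ := 2 * Real.log (1 / δ) / ε with ha
    have hapos : 0 < a := by
      have := hε.trans_le hεδ
      positivity
    have hmom (t : ℕ) (s : HonestState d n) : ∫⁻ r, z t s r ^ (1 + a) ∂A.roundLaw
        ≤ ENNReal.ofReal (Real.exp (((1 + a) ^ 2 - (1 + a)) / (2 * v)
            * (2 / (H.card + 1) * (2 * C) ^ 2))) := by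
      simp only [hz]
      refine A.lintegral_roundLaw_shiftDensity_rpow_le hv hcor hind
        (w := fun B => secretShift H i (Δ t s B)) (w' := fun B => indShift H i (Δ t s B))
        (hzs t s) hapos.le fun B hB => ?_
      have h1 := hΔn t s B hB
      rw [norm_shift_sq hi]
      gcongr
    refine (measure_markovPath_le A.roundLaw hstep hstep' hzm hdens hapos hmom _ A.T ε
      hYm).trans ?_
    exact add_le_add le_rfl (exp_mul_pow_le hε hδ hεδ hv (by positivity) hvar)
  -- The data of a worker outside H do not enter the honest process at all.
  · have hstep : A.honestStep H D adv (maliciousSecrets H) sec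
        = A.honestStep H D' adv (maliciousSecrets H) sec := by
      funext t s r
      unfold honestStep
      congr 2
      funext j
      split_ifs with hj
      · rw [hD j (fun h => hi (h ▸ hj))]
      · rfl
    rw [hstep]
    refine le_add_right ?_
    refine le_mul_of_one_le_left zero_le ?_
    rw [ENNReal.one_le_ofReal]
    exact Real.one_le_exp hε.le

/-- Treated apart because the tuned variance vanishes for T = 0. The transcript is then just the
initial model. -/
theorem secLDP_of_T_eq_zero (A : CafCor X d n m) (H : Finset (Fin n)) (known : Set (WorkerPair n))
    (hT : A.T = 0) {ε : ℝ} (hε : 0 < ε) (δ : ℝ) : A.SecLDP H known ε δ := by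
  intro s adv _ D D' _ Y _
  have : {ω | A.transcript H D adv (reveal known s ω) ∈ Y}
      = {ω | A.transcript H D' adv (reveal known s ω) ∈ Y} := by
    ext ω
    have (t : Fin (A.T + 1)) : (t : ℕ) = 0 := by have := t.2; omega
    have h : A.transcript H D adv (reveal known s ω) = A.transcript H D' adv (reveal known s ω) := by
      refine Prod.ext (funext fun t => ?_) (funext fun t => ?_)
      · simp only [transcript, this]
        rfl
      · exact absurd t.2 (by omega)
    simp only [Set.mem_ofPred_eq, h]
  rw [this]
  refine le_add_right (le_mul_of_one_le_left zero_le ?_)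
  rw [ENNReal.one_le_ofReal]
  exact Real.one_le_exp hε.le

end CafCor

theorem tunedCafCor_secLDP {X : Type u} {d n m f b : ℕ} (hb : 0 < b) (hbm : b ≤ m)
    {H : Finset (Fin n)} (hH : H.card + f = n) (hHn : 0 < H.card) (loss : Vec d → X → ℝ)
    {C ε δ : ℝ} (L μ : ℝ) (hC : 0 < C) (hε : 0 < ε) (hδ : 0 < δ) (hεδ : ε ≤ Real.log (1 / δ))
    (θ₀ : Vec d) (T : ℕ) {eig : Matrix (Fin d) (Fin d) ℝ → Vec d} (heig : IsTopEigensolver eig) :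
    (tunedCafCor loss f b hbm (some C) C ε δ L μ T θ₀ eig : CafCor X d n m).SecLDP H
      (CafCor.maliciousSecrets H) ε δ := by
  rcases Nat.eq_zero_or_pos T with hT | hT
  · exact CafCor.secLDP_of_T_eq_zero _ H _ hT hε δ
  · have hl := hε.trans_le hεδ
    have hT' : (0 : ℝ) < T := by exact_mod_cast hT
    have hh : (0 : ℝ) < H.card := by exact_mod_cast hHn
    have hc : (n : ℝ) - f = H.card := by
      have : (H.card : ℝ) + f = n := by exact_mod_cast hH
      linarith
    refine CafCor.secLDP_maliciousSecrets (v := noiseVar C T δ ε n f) _ heig H hb hC rfl hε hδ hεδ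
      ?_ rfl rfl ?_
    · rw [noiseVar, hc]; positivity
    · change 32 * C ^ 2 * T * Real.log (1 / δ) ≤ _
      rw [noiseVar, hc, div_mul_eq_mul_div, div_mul_eq_mul_div, le_div_iff₀ (by positivity)]
      have : 0 ≤ 32 * C ^ 2 * T * Real.log (1 / δ) * ε ^ 2 := by positivity
      nlinarith

/-! ### Smooth and strongly convex functions -/

section Convex

variable {d : ℕ} {L μ : ℝ} {F : Vec d → ℝ}

/-- At the test point z = x - g/L, smoothness bounds F z from above around x and convexity bounds it
from below around y. -/
theorem IsSmooth.norm_gradient_sub_sq_le (hF : IsSmooth L F) (hL : 0 < L) (hμ : 0 ≤ μ)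
    (hF' : IsStronglyConvex μ F) (x y : Vec d) :
    ‖gradient F x - gradient F y‖ ^ 2 ≤ 2 * L * (F x - F y - inner ℝ (gradient F y) (x - y)) := by
  set g := gradient F x - gradient F y with hg
  set z := x - L⁻¹ • g with hz
  have h1 := hF x z
  have h2 := hF' y z
  have h3 : z - x = -(L⁻¹ • g) := by rw [hz]; abel
  have h4 : z - y = (x - y) + -(L⁻¹ • g) := by rw [hz]; abel
  rw [h3] at h1
  have h5 : 0 ≤ μ / 2 * ‖z - y‖ ^ 2 := by positivity
  rw [h4, inner_add_right] at h2
  rw [h4] at h5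
  rw [norm_neg, norm_smul, mul_pow, norm_inv, Real.norm_of_nonneg hL.le] at h1
  rw [inner_neg_right, inner_smul_right] at h1 h2
  have h6 : inner ℝ (gradient F x) g - inner ℝ (gradient F y) g = ‖g‖ ^ 2 := by
    rw [← inner_sub_left, ← hg, real_inner_self_eq_norm_sq]
  have h7 : L / 2 * (L⁻¹ ^ 2 * ‖g‖ ^ 2) = L⁻¹ * ‖g‖ ^ 2 / 2 := by field_simp
  have h8 : L⁻¹ * ‖g‖ ^ 2 / 2 ≤ F x - F y - inner ℝ (gradient F y) (x - y) := by
    have h9 : L⁻¹ * inner ℝ (gradient F x) g - L⁻¹ * inner ℝ (gradient F y) g = L⁻¹ * ‖g‖ ^ 2 := by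
      rw [← mul_sub, h6]
    rw [h7] at h1
    linarith
  calc ‖g‖ ^ 2 = 2 * L * (L⁻¹ * ‖g‖ ^ 2 / 2) := by field_simp
    _ ≤ _ := by gcongr

/-- Adding the previous inequality for (x, y) and for (y, x) gives ‖g‖² ≤ L⟨g, x - y⟩. -/
theorem IsSmooth.norm_gradient_sub_le (hF : IsSmooth L F) (hL : 0 < L) (hμ : 0 ≤ μ)
    (hF' : IsStronglyConvex μ F) (x y : Vec d) :
    ‖gradient F x - gradient F y‖ ≤ L * ‖x - y‖ := by
  have h1 := hF.norm_gradient_sub_sq_le hL hμ hF' x y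
  have h2 := hF.norm_gradient_sub_sq_le hL hμ hF' y x
  rw [norm_sub_rev] at h2
  set g := gradient F x - gradient F y with hg
  have h3 : inner ℝ (gradient F y) (x - y) + inner ℝ (gradient F x) (y - x)
      = -inner ℝ g (x - y) := by
    rw [← neg_sub x y, inner_neg_right, hg, inner_sub_left]; ring
  have h4 : ‖g‖ ^ 2 ≤ L * (‖g‖ * ‖x - y‖) := by
    have h5 := real_inner_le_norm g (x - y)
    nlinarith
  by_contra! hlt
  have h5 : 0 < ‖g‖ := lt_of_le_of_lt (by positivity) hlt
  nlinarith

theorem IsStronglyConvex.sub_le (hF : IsStronglyConvex μ F) (hμ : 0 < μ) (θ θ' : Vec d) :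
    F θ - F θ' ≤ ‖gradient F θ‖ ^ 2 / (2 * μ) := by
  have h1 := hF θ θ'
  have h2 := neg_le_of_abs_le (abs_real_inner_le_norm (gradient F θ) (θ' - θ))
  rw [le_div_iff₀ (by positivity)]
  nlinarith [sq_nonneg (‖gradient F θ‖ - μ * ‖θ' - θ‖)]

theorem IsStronglyConvex.bddBelow (hF : IsStronglyConvex μ F) (hμ : 0 < μ) :
    BddBelow (Set.range F) := by
  refine ⟨F 0 - ‖gradient F 0‖ ^ 2 / (2 * μ), ?_⟩
  rintro _ ⟨θ, rfl⟩
  linarith [hF.sub_le hμ 0 θ]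

theorem IsStronglyConvex.sub_iInf_nonneg (hF : IsStronglyConvex μ F) (hμ : 0 < μ) (θ : Vec d) :
    0 ≤ F θ - ⨅ θ, F θ :=
  sub_nonneg.2 (ciInf_le (hF.bddBelow hμ) θ)

theorem IsStronglyConvex.sub_iInf_le (hF : IsStronglyConvex μ F) (hμ : 0 < μ) (θ : Vec d) :
    2 * μ * (F θ - ⨅ θ, F θ) ≤ ‖gradient F θ‖ ^ 2 := by
  have h : F θ - ‖gradient F θ‖ ^ 2 / (2 * μ) ≤ ⨅ θ, F θ :=
    le_ciInf fun θ' => by linarith [hF.sub_le hμ θ θ']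
  have h2 : F θ - ⨅ θ, F θ ≤ ‖gradient F θ‖ ^ 2 / (2 * μ) := by linarith
  rw [le_div_iff₀ (by positivity)] at h2
  linarith

theorem IsStronglyConvex.le_of_isSmooth (hF' : IsStronglyConvex μ F) (hF : IsSmooth L F)
    (hd : 0 < d) : μ ≤ L := by
  have : Nonempty (Fin d) := ⟨⟨0, hd⟩⟩
  obtain ⟨v, hv⟩ := exists_norm_eq (Vec d) zero_le_one
  have h1 := (hF' 0 v).trans (hF 0 v)
  rw [sub_zero, hv] at h1
  linarith

/-- One step of gradient descent with a momentum `m` in place of the gradient and an aggregation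
error `R - m`: the Lyapunov function decreases. -/
theorem lyapunov_step (hF : IsSmooth L F) (hF' : IsStronglyConvex μ F) (hL : 0 < L) (hμ : 0 < μ)
    (hd : 0 < d) {γ : ℝ} (hγ : 0 < γ) (hγL : 24 * L * γ ≤ 1) (θ R m : Vec d) :
    F (θ - γ • R) - (⨅ θ, F θ)
        + L⁻¹ * ((1 - 24 * L * γ) ^ 2 * ‖m - gradient F (θ - γ • R)‖ ^ 2)
      ≤ (1 - μ * γ) * (F θ - (⨅ θ, F θ) + L⁻¹ * ‖m - gradient F θ‖ ^ 2) + γ * ‖R - m‖ ^ 2 := by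
  set F' := ⨅ θ, F θ
  set θ' := θ - γ • R with hθ'
  set δ := m - gradient F θ with hδ
  set e := R - m with he
  have hμL := hF'.le_of_isSmooth hF hd
  have h1 := hF θ θ'
  have hdiff : θ' - θ = -(γ • R) := by rw [hθ']; abel
  rw [hdiff, norm_neg, norm_smul, inner_neg_right, inner_smul_right, mul_pow,
    Real.norm_of_nonneg hγ.le] at h1
  -- Polarization keeps a term -γ/2 ‖R‖², which later pays for the drift of the gradient and for the
  -- quadratic term of smoothness.
  have h2 : 2 * inner ℝ (gradient F θ) R = ‖gradient F θ‖ ^ 2 + ‖R‖ ^ 2 - ‖δ + e‖ ^ 2 := by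
    have : δ + e = R - gradient F θ := by rw [hδ, he]; abel
    rw [this, norm_sub_sq_real, real_inner_comm]
    ring
  have h3 : ‖δ + e‖ ^ 2 ≤ 2 * ‖δ‖ ^ 2 + 2 * ‖e‖ ^ 2 := by
    have := norm_add_le δ e
    nlinarith [sq_nonneg (‖δ‖ - ‖e‖), norm_nonneg (δ + e), norm_nonneg δ, norm_nonneg e]
  have h4 := hF'.sub_iInf_le hμ θ
  have h5 : ‖m - gradient F θ'‖ ≤ ‖δ‖ + L * γ * ‖R‖ := by
    have h6 : m - gradient F θ' = δ + (gradient F θ - gradient F θ') := by rw [hδ]; abel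
    have h7 := hF.norm_gradient_sub_le hL hμ.le hF' θ θ'
    rw [norm_sub_rev θ θ', hdiff, norm_neg, norm_smul, Real.norm_of_nonneg hγ.le] at h7
    rw [h6]
    refine (norm_add_le _ _).trans ?_
    linarith
  set a := 24 * L * γ with ha
  have ha0 : 0 < a := by positivity
  have h6 : (1 - a) ^ 2 * ‖m - gradient F θ'‖ ^ 2
      ≤ (1 - a) * ‖δ‖ ^ 2 + L * γ / 24 * ‖R‖ ^ 2 := by
    have h7 : ‖m - gradient F θ'‖ ^ 2 ≤ (‖δ‖ + L * γ * ‖R‖) ^ 2 := by gcongr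
    have h8 : (1 - a) ^ 2 * (‖δ‖ + L * γ * ‖R‖) ^ 2
        ≤ (1 - a) * ‖δ‖ ^ 2 + L * γ / 24 * ‖R‖ ^ 2 := by
      have h9 : L * γ = a / 24 := by rw [ha]; ring
      rw [h9]
      -- Young's inequality with weight a; its loss 1+a is absorbed by one factor 1-a of the
      -- contraction.
      have h10 : (‖δ‖ + a / 24 * ‖R‖) ^ 2 ≤ (1 + a) * ‖δ‖ ^ 2 + (1 + a) * a * (‖R‖ / 24) ^ 2 := by
        nlinarith [mul_nonneg ha0.le (sq_nonneg (‖δ‖ - ‖R‖ / 24))]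
      have h11 : 0 ≤ 1 - a := by linarith
      have h12 : (1 - a) ^ 2 * (1 + a) ≤ 1 - a := by
        nlinarith [mul_nonneg h11 (sq_nonneg a)]
      calc (1 - a) ^ 2 * (‖δ‖ + a / 24 * ‖R‖) ^ 2
          ≤ (1 - a) ^ 2 * ((1 + a) * ‖δ‖ ^ 2 + (1 + a) * a * (‖R‖ / 24) ^ 2) := by gcongr
        _ = ((1 - a) ^ 2 * (1 + a)) * (‖δ‖ ^ 2 + a * (‖R‖ / 24) ^ 2) := by ring
        _ ≤ (1 - a) * (‖δ‖ ^ 2 + a * (‖R‖ / 24) ^ 2) := by gcongr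
        _ ≤ _ := by nlinarith [mul_nonneg ha0.le (mul_nonneg ha0.le (sq_nonneg ‖R‖)),
                      mul_nonneg ha0.le (sq_nonneg ‖R‖)]
    exact (mul_le_mul_of_nonneg_left h7 (sq_nonneg _)).trans h8
  -- The gain -24γ‖δ‖² exceeds the two losses γ‖δ‖², from the descent step and from the factor 1-μγ.
  -- The terms in ‖R‖² sum to γ(1/24 + 1/48 - 1/2) < 0.
  have h7 : L⁻¹ * ((1 - a) ^ 2 * ‖m - gradient F θ'‖ ^ 2)
      ≤ L⁻¹ * ‖δ‖ ^ 2 - 24 * γ * ‖δ‖ ^ 2 + γ / 24 * ‖R‖ ^ 2 := by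
    refine (mul_le_mul_of_nonneg_left h6 (inv_nonneg.2 hL.le)).trans (le_of_eq ?_)
    rw [ha]
    field_simp
  have h8 : μ * γ * (L⁻¹ * ‖δ‖ ^ 2) ≤ γ * ‖δ‖ ^ 2 := by
    have : μ * L⁻¹ ≤ 1 := by rw [← div_eq_mul_inv]; exact div_le_one_of_le₀ hμL hL.le
    calc μ * γ * (L⁻¹ * ‖δ‖ ^ 2) = (μ * L⁻¹) * (γ * ‖δ‖ ^ 2) := by ring
      _ ≤ 1 * (γ * ‖δ‖ ^ 2) := by gcongr
      _ = _ := one_mul _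
  have h9 : L / 2 * (γ ^ 2 * ‖R‖ ^ 2) ≤ γ / 48 * ‖R‖ ^ 2 := by
    have : L / 2 * (γ ^ 2 * ‖R‖ ^ 2) = (24 * L * γ) * (γ / 48 * ‖R‖ ^ 2) := by ring
    rw [this]
    exact mul_le_of_le_one_left (by positivity) hγL
  have h10 : γ * (2 * μ * (F θ - F')) ≤ γ * ‖gradient F θ‖ ^ 2 := by gcongr
  have h11 : γ * ‖δ + e‖ ^ 2 ≤ γ * (2 * ‖δ‖ ^ 2 + 2 * ‖e‖ ^ 2) := by gcongr
  have h12 : γ * (2 * inner ℝ (gradient F θ) R)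
      = γ * (‖gradient F θ‖ ^ 2 + ‖R‖ ^ 2 - ‖δ + e‖ ^ 2) := by rw [h2]
  have h13 : 0 ≤ γ * ‖R‖ ^ 2 := by positivity
  have h14 : 0 ≤ γ * ‖δ‖ ^ 2 := by positivity
  have h15 : (1 - μ * γ) * (F θ - F' + L⁻¹ * ‖δ‖ ^ 2)
      = F θ - F' - γ * (2 * μ * (F θ - F')) / 2 + L⁻¹ * ‖δ‖ ^ 2 - μ * γ * (L⁻¹ * ‖δ‖ ^ 2) := by ring
  change F θ' - F' + L⁻¹ * ((1 - a) ^ 2 * ‖m - gradient F θ'‖ ^ 2)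
    ≤ (1 - μ * γ) * (F θ - F' + L⁻¹ * ‖δ‖ ^ 2) + γ * ‖e‖ ^ 2
  rw [h15]
  linarith

end Convex

/-! ### The schedules -/

section Schedule

variable {L μ : ℝ}

theorem stepSize_pos (hL : 0 < L) (hμ : 0 < μ) (t : ℕ) : 0 < stepSize L μ t := by
  unfold stepSize; positivity

theorem mul_stepSize (hL : 0 < L) (hμ : 0 < μ) (t : ℕ) :
    24 * L * stepSize L μ t = 240 * (L / μ) / (t + 240 * (L / μ)) := by
  unfold stepSize; field_simp; norm_num

theorem mul_stepSize_le_one (hL : 0 < L) (hμ : 0 < μ) (t : ℕ) : 24 * L * stepSize L μ t ≤ 1 := by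
  rw [mul_stepSize hL hμ]
  exact div_le_one_of_le₀ (by linarith [(Nat.cast_nonneg t : (0 : ℝ) ≤ t)]) (by positivity)

/-- The sum of the squared weights of the momentum. -/
noncomputable def momentumWeight (L μ : ℝ) : ℕ → ℝ
  | 0 => 0
  | t + 1 => (1 - 24 * L * stepSize L μ t) ^ 2 * momentumWeight L μ t
      + (24 * L * stepSize L μ t) ^ 2

theorem momentumWeight_nonneg (L μ : ℝ) (t : ℕ) : 0 ≤ momentumWeight L μ t := by
  induction t with
  | zero => exact le_rfl
  | succ t ih => rw [momentumWeight]; positivity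

/-- With x_t = 24Lγ_t, the bound 2x_t is preserved: the recursion gains at least x_t², while 2(x_t -
x_{t+1}) ≤ x_t²/120 because the schedule starts at 240L/μ ≥ 240. -/
theorem momentumWeight_le (hμ : 0 < μ) (hμL : μ ≤ L) (t : ℕ) :
    momentumWeight L μ t ≤ 48 * L * stepSize L μ t := by
  have hL := hμ.trans_le hμL
  induction t with
  | zero => rw [momentumWeight]; have := stepSize_pos hL hμ 0; positivity
  | succ t ih =>
    have h48 (t : ℕ) : 48 * L * stepSize L μ t = 2 * (24 * L * stepSize L μ t) := by ring
    rw [h48] at ih ⊢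
    rw [momentumWeight]
    have h1 := mul_stepSize_le_one hL hμ t
    have h0 := stepSize_pos hL hμ t
    have hx : 24 * L * stepSize L μ t = 240 * (L / μ) / (t + 240 * (L / μ)) := mul_stepSize hL hμ t
    have hy : 24 * L * stepSize L μ (t + 1) = 240 * (L / μ) / ((t + 1 : ℕ) + 240 * (L / μ)) :=
      mul_stepSize hL hμ (t + 1)
    set x := 24 * L * stepSize L μ t
    set y := 24 * L * stepSize L μ (t + 1)
    have hx0 : 0 ≤ x := by positivity
    have hq : 1 ≤ L / μ := (one_le_div hμ).2 hμL
    set q := 240 * (L / μ) with hqdef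
    have hq1 : 240 ≤ q := by linarith
    have ht : (0 : ℝ) ≤ t := Nat.cast_nonneg t
    have hs : 0 < (t : ℝ) + q := by linarith
    have hxq : x * (t + q) = q := by rw [hx]; field_simp
    have hyq : x - y ≤ x * x / 240 := by
      have h2 : y = q / (t + q + 1) := by rw [hy]; push_cast; ring_nf
      have h3 : x - y = q / ((t + q) * (t + q + 1)) := by rw [hx, h2]; field_simp; ring
      have h4 : x * x = q * q / ((t + q) * (t + q)) := by rw [hx]; field_simp
      rw [h3, h4, div_div, div_le_div_iff₀ (by positivity) (by positivity)]
      have h5 : 0 ≤ q * (t + q) := by positivity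
      have h6 : 0 ≤ q * (t + q) * ((q - 240) * (t + q)) :=
        mul_nonneg h5 (mul_nonneg (by linarith) hs.le)
      nlinarith [mul_nonneg h5 (by linarith : (0 : ℝ) ≤ q)]
    calc (1 - x) ^ 2 * momentumWeight L μ t + x ^ 2
        ≤ (1 - x) ^ 2 * (2 * x) + x ^ 2 := by gcongr
      _ ≤ 2 * y := by nlinarith [mul_nonneg hx0 hx0]

/-- The ansatz a/μ + M/s with s = t + 240L/μ is stable: since μγ_t = 10/s, the contraction removes
10M/s², and M is chosen so that the last term adds at most 9M/s². Finally M(s-1)/s² ≤ M/(s+1). -/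
theorem recursion_le (hL : 0 < L) (hμ : 0 < μ) (hμL : μ ≤ L) {w : ℕ → ℝ} {a B : ℝ} (hB : 0 ≤ B)
    (ha : 0 ≤ a) (hw0 : 0 ≤ w 0)
    (hw : ∀ t, w (t + 1) ≤ (1 - μ * stepSize L μ t) * w t + stepSize L μ t * a
      + stepSize L μ t ^ 2 * B) (t : ℕ) :
    w t ≤ a / μ + (240 * (L / μ) * w 0 + 100 * B / (9 * μ ^ 2)) / (t + 240 * (L / μ)) := by
  have hq : 1 ≤ L / μ := (one_le_div hμ).2 hμL
  set q := 240 * (L / μ) with hqdef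
  have hq1 : 240 ≤ q := by linarith
  set M := q * w 0 + 100 * B / (9 * μ ^ 2) with hM
  have hM0 : 0 ≤ M := by positivity
  have hMB : 100 * B / μ ^ 2 ≤ 9 * M := by
    have : 9 * M = 9 * (q * w 0) + 100 * B / μ ^ 2 := by rw [hM]; field_simp
    rw [this]
    have : 0 ≤ 9 * (q * w 0) := by positivity
    linarith
  induction t with
  | zero =>
    have h1 : w 0 ≤ M / q := by
      rw [le_div_iff₀ (by linarith), hM]
      have : 0 ≤ 100 * B / (9 * μ ^ 2) := by positivity
      linarith
    have h2 : 0 ≤ a / μ := by positivity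
    simpa using h1.trans (by linarith)
  | succ t ih =>
    have ht : (0 : ℝ) ≤ t := Nat.cast_nonneg t
    have hs : 0 < (t : ℝ) + q := by linarith
    have hγ : stepSize L μ t = 10 / (μ * (t + q)) := rfl
    have hμγ : μ * stepSize L μ t = 10 / (t + q) := by rw [hγ]; field_simp
    have h1 : 0 ≤ 1 - μ * stepSize L μ t := by
      rw [hμγ, sub_nonneg]
      exact div_le_one_of_le₀ (by linarith) hs.le
    calc w (t + 1) ≤ (1 - μ * stepSize L μ t) * w t + stepSize L μ t * a
          + stepSize L μ t ^ 2 * B := hw t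
      _ ≤ (1 - μ * stepSize L μ t) * (a / μ + M / (t + q)) + stepSize L μ t * a
          + stepSize L μ t ^ 2 * B := by gcongr
      _ = a / μ + (M / (t + q) - 10 * M / (t + q) ^ 2 + (100 * B / μ ^ 2) / (t + q) ^ 2) := by
          rw [hγ]; field_simp; ring
      _ ≤ a / μ + (M / (t + q) - 10 * M / (t + q) ^ 2 + (9 * M) / (t + q) ^ 2) := by gcongr
      _ ≤ _ := by
          have h2 : M / (t + q) - 10 * M / (t + q) ^ 2 + (9 * M) / (t + q) ^ 2
              = M * (t + q - 1) / (t + q) ^ 2 := by field_simp; ring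
          have h3 : M * (t + q - 1) / (t + q) ^ 2 ≤ M / (((t + 1 : ℕ) : ℝ) + q) := by
            push_cast
            rw [div_le_div_iff₀ (by positivity) (by linarith)]
            nlinarith
          rw [h2]
          linarith

end Schedule

/-! ### Suprema of exponentials over the unit ball -/

section BallAverage

variable {E : Type*} [NormedAddCommGroup E] [InnerProductSpace ℝ E] [FiniteDimensional ℝ E]
  [MeasurableSpace E] [BorelSpace E]

/-- By the symmetry w ↦ -w, the integrand can be paired with its reflection, and e^s + e^{-s} ≥ 2.
-/
theorem measure_ball_le_lintegral_exp_inner (y : E) :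
    (volume (Metric.ball (0 : E) 1)) ≤
      ∫⁻ w in Metric.ball (0 : E) 1, ENNReal.ofReal (Real.exp (inner ℝ w y)) := by
  have hm : Measurable fun w : E => ENNReal.ofReal (Real.exp (inner ℝ w y)) := by fun_prop
  have hneg : ∫⁻ w in Metric.ball (0 : E) 1, ENNReal.ofReal (Real.exp (inner ℝ w y))
      = ∫⁻ w in Metric.ball (0 : E) 1, ENNReal.ofReal (Real.exp (-inner ℝ w y)) := by
    have h := (Measure.measurePreserving_neg (volume : Measure E)).setLIntegral_comp_preimage
      (s := Metric.ball (0 : E) 1) measurableSet_ball hm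
    rw [← h]
    have hs : (Neg.neg : E → E) ⁻¹' Metric.ball (0 : E) 1 = Metric.ball (0 : E) 1 := by
      ext w; simp
    change ∫⁻ w in (Neg.neg : E → E) ⁻¹' Metric.ball (0 : E) 1, _ = _
    rw [hs]
    simp only [inner_neg_left]
  have h2 : 2 * volume (Metric.ball (0 : E) 1) ≤
      2 * ∫⁻ w in Metric.ball (0 : E) 1, ENNReal.ofReal (Real.exp (inner ℝ w y)) := by
    rw [two_mul (∫⁻ _ in _, _)]
    nth_rw 2 [hneg]
    rw [← lintegral_add_left hm, ← setLIntegral_const]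
    refine lintegral_mono fun w => ?_
    rw [← ENNReal.ofReal_add (Real.exp_pos _).le (Real.exp_pos _).le]
    refine (by simp : (2 : ℝ≥0∞) = ENNReal.ofReal 2).trans_le (ENNReal.ofReal_le_ofReal ?_)
    have h1 := Real.add_one_le_exp (inner ℝ w y)
    have h2 := Real.add_one_le_exp (-inner ℝ w y)
    linarith
  exact (ENNReal.mul_le_mul_iff_right (by simp) (by simp)).1 h2

/-- The exponential of a linear form at a point of the unit ball is controlled by its average over
the ball of radius `2`. -/
theorem exists_measure_exp_inner_le (E : Type*) [NormedAddCommGroup E] [InnerProductSpace ℝ E]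
    [FiniteDimensional ℝ E] [MeasurableSpace E] [BorelSpace E] :
    ∃ ρ : Measure E, IsProbabilityMeasure ρ ∧ (∀ᵐ w ∂ρ, ‖w‖ ≤ 2) ∧
      ∀ u y : E, ‖u‖ ≤ 1 → ENNReal.ofReal (Real.exp (inner ℝ u y)) ≤
        2 ^ Module.finrank ℝ E * ∫⁻ w, ENNReal.ofReal (Real.exp (inner ℝ w y)) ∂ρ := by
  set V := volume (Metric.ball (0 : E) 1) with hV
  have hV0 : V ≠ 0 := (Metric.measure_ball_pos _ _ one_pos).ne'
  have hVtop : V ≠ ⊤ := measure_ball_lt_top.ne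
  have h2 : volume (Metric.ball (0 : E) 2) = 2 ^ Module.finrank ℝ E * V := by
    rw [Measure.addHaar_ball_of_pos _ _ two_pos, ENNReal.ofReal_pow zero_le_two]
    simp [hV]
  have h20 : volume (Metric.ball (0 : E) 2) ≠ 0 := (Metric.measure_ball_pos _ _ two_pos).ne'
  have h2top : volume (Metric.ball (0 : E) 2) ≠ ⊤ := measure_ball_lt_top.ne
  refine ⟨(volume (Metric.ball (0 : E) 2))⁻¹ • volume.restrict (Metric.ball (0 : E) 2),
    ⟨by simp [ENNReal.inv_mul_cancel h20 h2top]⟩, ?_, fun u y hu => ?_⟩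
  · refine Measure.ae_smul_measure ?_ _
    filter_upwards [ae_restrict_mem measurableSet_ball] with w hw
    exact (mem_ball_zero_iff.1 hw).le
  · rw [lintegral_smul_measure, smul_eq_mul, h2,
      ENNReal.mul_inv (Or.inr hVtop) (Or.inr hV0), ← mul_assoc, ← mul_assoc,
      ENNReal.mul_inv_cancel (by simp) (by simp), one_mul]
    have hm : Measurable fun w : E => ENNReal.ofReal (Real.exp (inner ℝ w y)) := by fun_prop
    -- Translating the unit ball to u multiplies the integral by e^{⟨u,y⟩}; the translated ball lies
    -- in the ball of radius 2, whose volume is 2^dim times larger.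
    have hshift : ∫⁻ w in Metric.ball u 1, ENNReal.ofReal (Real.exp (inner ℝ w y))
        = ENNReal.ofReal (Real.exp (inner ℝ u y)) *
          ∫⁻ w in Metric.ball (0 : E) 1, ENNReal.ofReal (Real.exp (inner ℝ w y)) := by
      have h := (measurePreserving_add_left (volume : Measure E) u).setLIntegral_comp_preimage
        (s := Metric.ball u 1) measurableSet_ball hm
      have hs : (fun w => u + w) ⁻¹' Metric.ball u 1 = Metric.ball (0 : E) 1 := by
        ext w; simp [dist_eq_norm]
      rw [← h, hs, ← lintegral_const_mul _ hm]
      refine lintegral_congr fun w => ?_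
      rw [inner_add_left, Real.exp_add, ENNReal.ofReal_mul (Real.exp_pos _).le]
    have hsub : Metric.ball u 1 ⊆ Metric.ball (0 : E) 2 := by
      refine Metric.ball_subset_ball' ?_
      rw [dist_zero_right]; linarith
    calc ENNReal.ofReal (Real.exp (inner ℝ u y))
        = V⁻¹ * (ENNReal.ofReal (Real.exp (inner ℝ u y)) * V) := by
          rw [mul_comm, mul_assoc, ENNReal.mul_inv_cancel hV0 hVtop, mul_one]
      _ ≤ V⁻¹ * (ENNReal.ofReal (Real.exp (inner ℝ u y)) *
          ∫⁻ w in Metric.ball (0 : E) 1, ENNReal.ofReal (Real.exp (inner ℝ w y))) := by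
          gcongr; exact measure_ball_le_lintegral_exp_inner y
      _ ≤ _ := by
          rw [← hshift]
          gcongr

end BallAverage

/-- For x ≥ A one squares x/A ≤ e^{(x-A)/A}; the exponent 2(x-A)/A is at most x-A since A ≥ 2. -/
theorem sq_le_add_exp {x A : ℝ} (hx : 0 ≤ x) (hA : 2 ≤ A) :
    x ^ 2 ≤ A ^ 2 + A ^ 2 * Real.exp (x - A) := by
  have h0 : 0 ≤ A ^ 2 * Real.exp (x - A) := by positivity
  rcases le_total x A with h | h
  · nlinarith
  · have h1 : x / A ≤ Real.exp ((x - A) / A) := by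
      have := Real.add_one_le_exp ((x - A) / A)
      have h3 : (x - A) / A + 1 = x / A := by field_simp; ring
      rwa [h3] at this
    have h2 : x ^ 2 = A ^ 2 * (x / A) ^ 2 := by field_simp
    have h4 : (x / A) ^ 2 ≤ Real.exp (x - A) := by
      calc (x / A) ^ 2 ≤ Real.exp ((x - A) / A) ^ 2 := by gcongr
        _ = Real.exp (2 * ((x - A) / A)) := by rw [← Real.exp_nat_mul]; norm_num
        _ ≤ _ := by
          refine Real.exp_le_exp.2 ?_
          rw [← mul_div_assoc, div_le_iff₀ (by linarith)]
          nlinarith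
    rw [h2]
    nlinarith [mul_le_mul_of_nonneg_left h4 (sq_nonneg A), sq_nonneg A]

set_option maxHeartbeats 400000 in
/-- For a subgaussian family of random vectors `N i`, the top eigenvalue of `∑ i, N i (N i)ᵀ` has a
mean of order `n + d`. -/
theorem exists_integral_sum_inner_sq_le {Ω : Type*} [MeasurableSpace Ω] {P : Measure Ω}
    [IsProbabilityMeasure P] {d n : ℕ} (hd : 0 < d) {N : Fin n → Ω → Vec d}
    (hN : ∀ i, Measurable (N i)) {q : ℝ} (hq : 0 < q)
    (hexp : ∀ w : Fin n → Vec d, ∫⁻ ω, ENNReal.ofReal (Real.exp (∑ i, inner ℝ (w i) (N i ω))) ∂P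
      ≤ ENNReal.ofReal (Real.exp (q / 2 * ∑ i, ‖w i‖ ^ 2))) :
    ∃ Z : Ω → ℝ, Measurable Z ∧ (∀ ω, 0 ≤ Z ω) ∧
      ∫⁻ ω, ENNReal.ofReal (Z ω) ∂P ≤ ENNReal.ofReal (162 * (n + d) * q) ∧
      ∀ᵐ ω ∂P, ∀ v : Vec d, ‖v‖ = 1 → ∑ i, inner ℝ v (N i ω) ^ 2 ≤ Z ω := by
  obtain ⟨ρ, hρ, hρ2, hρle⟩ := exists_measure_exp_inner_le (Vec d)
  obtain ⟨τ, hτ, hτ2, hτle⟩ := exists_measure_exp_inner_le (EuclideanSpace ℝ (Fin n))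
  rw [finrank_euclideanSpace_fin] at hρle hτle
  have hd1 : (1 : ℝ) ≤ d := by exact_mod_cast hd
  set a : ℝ := n + d with ha
  have ha1 : 1 ≤ a := by have : (0 : ℝ) ≤ n := Nat.cast_nonneg n; linarith
  -- Balances the exponential moment on the balls of radius 2, (q/2) l² · 4 · 4 = 8a, against the
  -- cost 2^{n+d} ≤ e^a of the two averagings. Their product e^{9a} dictates `B`.
  set l : ℝ := Real.sqrt (a / q) with hl
  have hl0 : 0 < l := Real.sqrt_pos.2 (by positivity)
  have hl2 : l ^ 2 = a / q := Real.sq_sqrt (by positivity)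
  set B : ℝ := 9 * a with hB
  obtain ⟨G, hG⟩ : ∃ G : EuclideanSpace ℝ (Fin n) × Vec d → Ω → ℝ≥0∞, ∀ p ω, G p ω =
    ENNReal.ofReal (Real.exp (l * ∑ i, p.1 i * inner ℝ p.2 (N i ω))) := ⟨_, fun _ _ => rfl⟩
  have hGm : Measurable (Function.uncurry G) := by
    have : ∀ i, Measurable fun p : (EuclideanSpace ℝ (Fin n) × Vec d) × Ω =>
        inner ℝ p.1.2 (N i p.2) := fun i =>
      Measurable.inner (by fun_prop) ((hN i).comp measurable_snd)
    simp only [Function.uncurry_def, hG]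
    fun_prop
  -- The quantity to control is the supremum of the bilinear form (u, w) ↦ ∑ u_i ⟨w, N_i⟩ over two
  -- unit balls. Averaging its exponential over both larger balls replaces a net argument and gives
  -- a measurable majorant for all directions at once.
  obtain ⟨Φ, hΦ⟩ : ∃ Φ : Ω → ℝ≥0∞, ∀ ω, Φ ω = ∫⁻ p, G p ω ∂(τ.prod ρ) := ⟨_, fun _ => rfl⟩
  have hΦm : Measurable Φ := by
    simp only [funext hΦ]
    exact hGm.lintegral_prod_left'
  have hΦle : ∫⁻ ω, Φ ω ∂P ≤ ENNReal.ofReal (Real.exp (8 * a)) := by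
    have hGs : Measurable (Function.uncurry fun ω p => G p ω) := hGm.comp measurable_swap
    simp only [hΦ]
    rw [lintegral_lintegral_swap hGs.aemeasurable]
    have hle : ∀ᵐ p ∂τ.prod ρ, ∫⁻ ω, G p ω ∂P ≤ ENNReal.ofReal (Real.exp (8 * a)) := by
      have h1 : ∀ᵐ p ∂τ.prod ρ, ‖p.1‖ ≤ 2 := Measure.quasiMeasurePreserving_fst.ae hτ2
      have h2 : ∀ᵐ p ∂τ.prod ρ, ‖p.2‖ ≤ 2 := Measure.quasiMeasurePreserving_snd.ae hρ2
      filter_upwards [h1, h2] with p hp1 hp2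
      refine le_trans (le_of_eq ?_) ((hexp fun i => (l * p.1 i) • p.2).trans
        (ENNReal.ofReal_le_ofReal (Real.exp_le_exp.2 ?_)))
      · simp only [hG, Finset.mul_sum, inner_smul_left, RCLike.conj_to_real, mul_assoc]
      · have h3 : ∑ i, ‖(l * p.1 i) • p.2‖ ^ 2 = l ^ 2 * ‖p.1‖ ^ 2 * ‖p.2‖ ^ 2 := by
          rw [EuclideanSpace.real_norm_sq_eq, Finset.mul_sum, Finset.sum_mul]
          refine Finset.sum_congr rfl fun i _ => ?_
          rw [norm_smul, mul_pow, Real.norm_eq_abs, sq_abs, mul_pow]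
        have h4 : ‖p.1‖ ^ 2 ≤ 4 := by nlinarith [norm_nonneg p.1]
        have h5 : ‖p.2‖ ^ 2 ≤ 4 := by nlinarith [norm_nonneg p.2]
        rw [h3, hl2]
        calc q / 2 * (a / q * ‖p.1‖ ^ 2 * ‖p.2‖ ^ 2) ≤ q / 2 * (a / q * 4 * 4) := by gcongr
          _ = 8 * a := by field_simp; norm_num
    calc ∫⁻ p, ∫⁻ ω, G p ω ∂P ∂τ.prod ρ
        ≤ ∫⁻ _, ENNReal.ofReal (Real.exp (8 * a)) ∂τ.prod ρ := lintegral_mono_ae hle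
      _ = _ := by simp
  have hΦω (ω : Ω) : Φ ω = ∫⁻ u, ∫⁻ w, G (u, w) ω ∂ρ ∂τ := by
    have hGω : Measurable fun p => G p ω :=
      hGm.comp (measurable_id.prodMk measurable_const)
    rw [hΦ]
    exact lintegral_prod _ hGω.aemeasurable
  obtain ⟨Z, hZ⟩ : ∃ Z : Ω → ℝ≥0∞, ∀ ω, Z ω = ENNReal.ofReal (q / a * B ^ 2)
    + ENNReal.ofReal (q / a * B ^ 2 * Real.exp (-B)) * (2 ^ (n + d) * Φ ω) := ⟨_, fun _ => rfl⟩
  have hZm : Measurable Z := by simp only [funext hZ]; fun_prop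
  have hZle : ∫⁻ ω, Z ω ∂P ≤ ENNReal.ofReal (162 * a * q) := by
    have hm : Measurable fun ω => 2 ^ (n + d) * Φ ω := by fun_prop
    simp only [hZ]
    rw [lintegral_add_left measurable_const, lintegral_const, measure_univ, mul_one,
      lintegral_const_mul _ hm, lintegral_const_mul _ hΦm]
    have h2 : (2 : ℝ≥0∞) ^ (n + d) ≤ ENNReal.ofReal (Real.exp a) := by
      have h3 : (2 : ℝ) ^ (n + d) ≤ Real.exp a := by
        have h4 : (2 : ℝ) ≤ Real.exp 1 := by linarith [Real.add_one_le_exp (1 : ℝ)]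
        calc (2 : ℝ) ^ (n + d) ≤ Real.exp 1 ^ (n + d) := by gcongr
          _ = Real.exp a := by rw [← Real.exp_nat_mul, ha]; push_cast; ring_nf
      calc (2 : ℝ≥0∞) ^ (n + d) = ENNReal.ofReal (2 ^ (n + d)) := by
            rw [ENNReal.ofReal_pow zero_le_two]; simp
        _ ≤ _ := ENNReal.ofReal_le_ofReal h3
    calc ENNReal.ofReal (q / a * B ^ 2) + ENNReal.ofReal (q / a * B ^ 2 * Real.exp (-B))
          * (2 ^ (n + d) * ∫⁻ ω, Φ ω ∂P)
        ≤ ENNReal.ofReal (q / a * B ^ 2) + ENNReal.ofReal (q / a * B ^ 2 * Real.exp (-B))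
          * (ENNReal.ofReal (Real.exp a) * ENNReal.ofReal (Real.exp (8 * a))) := by gcongr
      _ = ENNReal.ofReal (162 * a * q) := by
          rw [← ENNReal.ofReal_mul (Real.exp_pos _).le, ← ENNReal.ofReal_mul (by positivity),
            ← ENNReal.ofReal_add (by positivity) (by positivity), ← Real.exp_add, mul_assoc,
            ← Real.exp_add, hB]
          congr 1
          rw [show -(9 * a) + (a + 8 * a) = 0 by ring, Real.exp_zero]
          field_simp; norm_num
  refine ⟨fun ω => (Z ω).toReal, hZm.ennreal_toReal, fun ω => ENNReal.toReal_nonneg,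
    (lintegral_mono fun ω => ENNReal.ofReal_toReal_le).trans hZle, ?_⟩
  filter_upwards [ae_lt_top hZm (hZle.trans_lt ENNReal.ofReal_lt_top).ne] with ω hω v hv
  rw [← ENNReal.ofReal_le_iff_le_toReal hω.ne]
  set y : EuclideanSpace ℝ (Fin n) := WithLp.toLp 2 fun i => inner ℝ v (N i ω) with hy
  have hysq : ∑ i, inner ℝ v (N i ω) ^ 2 = ‖y‖ ^ 2 := by
    rw [EuclideanSpace.real_norm_sq_eq]
  have hinner (u : EuclideanSpace ℝ (Fin n)) :
      inner ℝ u (l • y) = l * ∑ i, u i * inner ℝ v (N i ω) := by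
    rw [inner_smul_right, PiLp.inner_apply]
    simp [hy, mul_comm]
  have hkey : ENNReal.ofReal (Real.exp (l * ‖y‖)) ≤ 2 ^ (n + d) * Φ ω := by
    have h1 : ‖(‖y‖⁻¹ • y)‖ ≤ 1 := by
      rw [norm_smul, norm_inv, norm_norm]
      exact inv_mul_le_one
    have h2 := hτle (‖y‖⁻¹ • y) (l • y) h1
    rw [inner_smul_left, inner_smul_right, real_inner_self_eq_norm_sq, RCLike.conj_to_real] at h2
    have h3 : ‖y‖⁻¹ * (l * ‖y‖ ^ 2) = l * ‖y‖ := by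
      rcases eq_or_ne ‖y‖ 0 with h | h
      · simp [h]
      · field_simp
    rw [h3] at h2
    refine h2.trans ?_
    have h4 (u : EuclideanSpace ℝ (Fin n)) : ENNReal.ofReal (Real.exp (inner ℝ u (l • y)))
        ≤ 2 ^ d * ∫⁻ w, G (u, w) ω ∂ρ := by
      have h5 (w : Vec d) : inner ℝ w (∑ i, (l * u i) • N i ω)
          = l * ∑ i, u i * inner ℝ w (N i ω) := by
        rw [inner_sum, Finset.mul_sum]
        simp only [inner_smul_right, mul_assoc]
      have h6 := hρle v (∑ i, (l * u i) • N i ω) hv.le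
      simp only [h5] at h6
      simp only [hinner, hG]
      exact h6
    have hGω : Measurable fun p => G p ω :=
      hGm.comp (measurable_id.prodMk measurable_const)
    have hGω' : Measurable fun u => ∫⁻ w, G (u, w) ω ∂ρ := hGω.lintegral_prod_right'
    calc 2 ^ n * ∫⁻ u, ENNReal.ofReal (Real.exp (inner ℝ u (l • y))) ∂τ
        ≤ 2 ^ n * ∫⁻ u, 2 ^ d * ∫⁻ w, G (u, w) ω ∂ρ ∂τ := by gcongr with u; exact h4 u
      _ = 2 ^ (n + d) * Φ ω := by
          rw [lintegral_const_mul _ hGω', ← mul_assoc, ← pow_add, hΦω]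
  -- Undoing the scaling by l, the two terms contribute (q/a)(9a)² each in the mean, hence 162 a q.
  have hreal := sq_le_add_exp (x := l * ‖y‖) (A := B) (by positivity) (by linarith)
  calc ENNReal.ofReal (∑ i, inner ℝ v (N i ω) ^ 2)
      ≤ ENNReal.ofReal (q / a * B ^ 2 + q / a * B ^ 2 * Real.exp (-B) * Real.exp (l * ‖y‖)) := by
        refine ENNReal.ofReal_le_ofReal ?_
        rw [hysq]
        have h1 : ‖y‖ ^ 2 = q / a * (l * ‖y‖) ^ 2 := by rw [mul_pow, hl2]; field_simp
        rw [h1]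
        refine (mul_le_mul_of_nonneg_left hreal (by positivity)).trans (le_of_eq ?_)
        rw [show l * ‖y‖ - B = -B + l * ‖y‖ by ring, Real.exp_add]
        ring
    _ = ENNReal.ofReal (q / a * B ^ 2) + ENNReal.ofReal (q / a * B ^ 2 * Real.exp (-B))
          * ENNReal.ofReal (Real.exp (l * ‖y‖)) := by
        rw [ENNReal.ofReal_add (by positivity) (by positivity),
          ENNReal.ofReal_mul (p := q / a * B ^ 2 * Real.exp (-B)) (by positivity)]
    _ ≤ Z ω := by simp only [hZ]; gcongr

/-! ### Second moments -/

section SecondMoment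

variable {Ω E : Type*} [MeasurableSpace Ω] {P : Measure Ω} [IsProbabilityMeasure P]
  [NormedAddCommGroup E] [InnerProductSpace ℝ E] [CompleteSpace E]

/-- The cross term vanishes because ξ is centred. -/
theorem lintegral_norm_add_smul_sq_le {ξ : Ω → E} (hξ : MemLp ξ 2 P) (h0 : ∫ ω, ξ ω ∂P = 0)
    {V : ℝ} (hV : ∫ ω, ‖ξ ω‖ ^ 2 ∂P ≤ V) (a : E) (c : ℝ) :
    ∫⁻ ω, ENNReal.ofReal (‖a + c • ξ ω‖ ^ 2) ∂P ≤ ENNReal.ofReal (‖a‖ ^ 2 + c ^ 2 * V) := by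
  have hi : Integrable ξ P := hξ.integrable one_le_two
  have h2 : Integrable (fun ω => ‖ξ ω‖ ^ 2) P := hξ.integrable_norm_pow two_ne_zero
  have hin : Integrable (fun ω => inner ℝ a (ξ ω)) P := hi.const_inner a
  have heq (ω : Ω) : ‖a + c • ξ ω‖ ^ 2
      = ‖a‖ ^ 2 + 2 * c * inner ℝ a (ξ ω) + c ^ 2 * ‖ξ ω‖ ^ 2 := by
    rw [norm_add_sq_real, inner_smul_right, norm_smul, mul_pow, Real.norm_eq_abs, sq_abs]
    ring
  simp only [heq]
  have hI1 : Integrable (fun ω => ‖a‖ ^ 2 + 2 * c * inner ℝ a (ξ ω)) P :=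
    (integrable_const _).add (hin.const_mul _)
  have hI : Integrable (fun ω => ‖a‖ ^ 2 + 2 * c * inner ℝ a (ξ ω) + c ^ 2 * ‖ξ ω‖ ^ 2) P :=
    hI1.add (h2.const_mul _)
  rw [← ofReal_integral_eq_lintegral_ofReal hI
    (ae_of_all _ fun ω => (sq_nonneg ‖a + c • ξ ω‖).trans_eq (heq ω))]
  refine ENNReal.ofReal_le_ofReal ?_
  rw [integral_add hI1 (h2.const_mul _),
    integral_add (integrable_const _) (hin.const_mul _), integral_const_mul, integral_const_mul,
    integral_inner hi, h0, inner_zero_right]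
  simp only [integral_const, probReal_univ, one_smul]
  nlinarith [mul_le_mul_of_nonneg_left hV (sq_nonneg c)]

end SecondMoment

theorem norm_inv_card_smul_sum_sq_le {E : Type*} [NormedAddCommGroup E]
    [InnerProductSpace ℝ E] {ι : Type*} (s : Finset ι) (y : ι → E) :
    ‖(s.card : ℝ)⁻¹ • ∑ i ∈ s, y i‖ ^ 2 ≤ (s.card : ℝ)⁻¹ * ∑ i ∈ s, ‖y i‖ ^ 2 := by
  rcases s.eq_empty_or_nonempty with rfl | hs
  · simp
  have hc : 0 < (s.card : ℝ) := by exact_mod_cast hs.card_pos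
  have h1 : ‖∑ i ∈ s, y i‖ ^ 2 ≤ s.card * ∑ i ∈ s, ‖y i‖ ^ 2 :=
    (pow_le_pow_left₀ (norm_nonneg _) (norm_sum_le s y) 2).trans sq_sum_le_card_mul_sum_sq
  rw [norm_smul, mul_pow, norm_inv, Real.norm_of_nonneg hc.le]
  calc (s.card : ℝ)⁻¹ ^ 2 * ‖∑ i ∈ s, y i‖ ^ 2
      ≤ (s.card : ℝ)⁻¹ ^ 2 * (s.card * ∑ i ∈ s, ‖y i‖ ^ 2) := by gcongr
    _ = _ := by field_simp

/-! ### Mini-batches -/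

theorem integral_batchLaw {m b : ℕ} (hb : b ≤ m) {E : Type*} [NormedAddCommGroup E]
    [NormedSpace ℝ E] [CompleteSpace E] (φ : Finset (Fin m) → E) :
    ∫ B, φ B ∂batchLaw hb
      = (m.choose b : ℝ)⁻¹ • ∑ B ∈ Finset.powersetCard b Finset.univ, φ B := by
  rw [batchLaw, PMF.integral_eq_sum, Finset.smul_sum]
  simp only [PMF.uniformOfFinset_apply, Finset.card_powersetCard, Finset.card_univ,
    Fintype.card_fin]
  rw [← Finset.sum_filter_add_sum_filter_not Finset.univ
    (fun B : Finset (Fin m) => B ∈ Finset.powersetCard b Finset.univ)]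
  rw [Finset.sum_eq_zero (s := Finset.univ.filter fun B : Finset (Fin m) =>
    ¬ B ∈ Finset.powersetCard b Finset.univ), add_zero]
  · refine Finset.sum_congr (by ext; simp) fun B hB => ?_
    rw [if_pos hB]
    simp
  · intro B hB
    rw [if_neg (Finset.mem_filter.1 hB).2]
    simp

theorem integral_batchLaw_mean {m b : ℕ} (hb0 : 0 < b) (hb : b ≤ m) {E : Type*}
    [NormedAddCommGroup E] [NormedSpace ℝ E] [CompleteSpace E] (g : Fin m → E) :
    ∫ B, (b : ℝ)⁻¹ • ∑ k ∈ B, g k ∂batchLaw hb = (m : ℝ)⁻¹ • ∑ k, g k := by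
  rw [integral_batchLaw]
  have h1 (k : Fin m) :
      ((Finset.powersetCard b Finset.univ).filter fun B : Finset (Fin m) => k ∈ B).card
        = (m - 1).choose (b - 1) := by
    have := Finset.card_filter_powersetCard_subset {k} (Finset.univ : Finset (Fin m)) b
      (Finset.subset_univ _) (by simpa [Nat.one_le_iff_ne_zero] using hb0.ne')
    simpa using this
  have h2 : ∑ B ∈ Finset.powersetCard b (Finset.univ : Finset (Fin m)), ∑ k ∈ B, g k
      = ((m - 1).choose (b - 1) : ℝ) • ∑ k, g k := by
    have h3 (B : Finset (Fin m)) : ∑ k ∈ B, g k = ∑ k, if k ∈ B then g k else 0 := by simp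
    rw [Finset.sum_congr rfl fun B _ => h3 B, Finset.sum_comm, Finset.smul_sum]
    refine Finset.sum_congr rfl fun k _ => ?_
    rw [← Finset.sum_filter, Finset.sum_const, h1, Nat.cast_smul_eq_nsmul]
  have h4 : m * (m - 1).choose (b - 1) = m.choose b * b := by
    have := Nat.add_one_mul_choose_eq (m - 1) (b - 1)
    rwa [Nat.sub_add_cancel (hb0.trans_le hb), Nat.sub_add_cancel hb0] at this
  have h5 : (m : ℝ) * (m - 1).choose (b - 1) = m.choose b * b := by exact_mod_cast h4
  rw [← Finset.smul_sum, h2, smul_smul, smul_smul]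
  congr 1
  have hc : (0 : ℝ) < m.choose b := by exact_mod_cast Nat.choose_pos hb
  have hm : (0 : ℝ) < m := by exact_mod_cast hb0.trans_le hb
  have hb' : (0 : ℝ) < b := by exact_mod_cast hb0
  field_simp
  linarith

/-- Convexity alone, without a gain from the batch size; this suffices because the variance σ² does
not survive in the limit. -/
theorem integral_batchLaw_norm_sub_sq_le {m b : ℕ} (hb0 : 0 < b) (hb : b ≤ m) {E : Type*}
    [NormedAddCommGroup E] [InnerProductSpace ℝ E] (g : Fin m → E) (z : E) :
    ∫ B, ‖(b : ℝ)⁻¹ • ∑ k ∈ B, g k - z‖ ^ 2 ∂batchLaw hb ≤ (m : ℝ)⁻¹ * ∑ k, ‖g k - z‖ ^ 2 := by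
  rw [← smul_eq_mul, ← integral_batchLaw_mean hb0 hb fun k => ‖g k - z‖ ^ 2, integral_batchLaw,
    integral_batchLaw]
  simp only [smul_eq_mul]
  gcongr with B hB
  have hB' : B.card = b := (Finset.mem_powersetCard.1 hB).2
  have h1 : (b : ℝ)⁻¹ • ∑ k ∈ B, g k - z = (B.card : ℝ)⁻¹ • ∑ k ∈ B, (g k - z) := by
    have hb' : (b : ℝ) ≠ 0 := by exact_mod_cast hb0.ne'
    rw [hB', Finset.sum_sub_distrib, Finset.sum_const, smul_sub, hB', ← Nat.cast_smul_eq_nsmul ℝ,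
      smul_smul, inv_mul_cancel₀ hb', one_smul]
  rw [h1, ← hB']
  exact norm_inv_card_smul_sum_sq_le B _

/-! ### Gradients of averages -/

theorem gradient_const_mul_sum {d : ℕ} {ι : Type*} (s : Finset ι) {φ : ι → Vec d → ℝ}
    (hφ : ∀ i ∈ s, Differentiable ℝ (φ i)) (c : ℝ) (θ : Vec d) :
    gradient (fun z => c * ∑ i ∈ s, φ i z) θ = c • ∑ i ∈ s, gradient (φ i) θ := by
  refine HasGradientAt.gradient ?_
  rw [hasGradientAt_iff_hasFDerivAt, map_smul, map_sum]
  refine HasFDerivAt.const_mul (HasFDerivAt.fun_sum fun i hi => ?_) c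
  exact ((hφ i hi) θ).hasGradientAt.hasFDerivAt

theorem gradient_localLoss {X : Type u} {d m : ℕ} {loss : Vec d → X → ℝ}
    (hloss : ∀ x, Differentiable ℝ fun θ => loss θ x) (Di : Fin m → X) (θ : Vec d) :
    gradient (localLoss loss Di) θ = (m : ℝ)⁻¹ • ∑ k, gradient (fun z => loss z (Di k)) θ :=
  gradient_const_mul_sum Finset.univ (fun k _ => hloss (Di k)) _ θ

theorem differentiable_localLoss {X : Type u} {d m : ℕ} {loss : Vec d → X → ℝ}
    (hloss : ∀ x, Differentiable ℝ fun θ => loss θ x) (Di : Fin m → X) :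
    Differentiable ℝ (localLoss loss Di) :=
  (Differentiable.fun_sum fun k _ => hloss (Di k)).const_mul _

theorem gradient_honestLoss {X : Type u} {d n m : ℕ} {loss : Vec d → X → ℝ}
    (hloss : ∀ x, Differentiable ℝ fun θ => loss θ x) (H : Finset (Fin n))
    (D : Fin n → Fin m → X) (θ : Vec d) :
    gradient (honestLoss loss H D) θ
      = (H.card : ℝ)⁻¹ • ∑ i ∈ H, gradient (localLoss loss (D i)) θ :=
  gradient_const_mul_sum H (fun i _ => differentiable_localLoss hloss (D i)) _ θ

/-! ### Second moments from exponential moments. -/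

theorem sq_le_two_mul_exp_add (x : ℝ) : x ^ 2 ≤ 2 * (Real.exp x + Real.exp (-x)) := by
  rcases le_total 0 x with h | h
  · have h1 := Real.quadratic_le_exp_of_nonneg h
    have h2 := Real.add_one_le_exp (-x)
    linarith
  · have h1 := Real.quadratic_le_exp_of_nonneg (neg_nonneg.2 h)
    have h2 := Real.add_one_le_exp x
    nlinarith

theorem lintegral_norm_sq_le_of_exp {Ω : Type*} [MeasurableSpace Ω] {P : Measure Ω} {d : ℕ}
    {Y : Ω → Vec d} (hY : Measurable Y) {q : ℝ} (hq : 0 < q)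
    (hexp : ∀ l : ℝ, l ^ 2 = q⁻¹ → ∀ k,
      ∫⁻ ω, ENNReal.ofReal (Real.exp (l * Y ω k)) ∂P ≤ ENNReal.ofReal 2) :
    ∫⁻ ω, ENNReal.ofReal (‖Y ω‖ ^ 2) ∂P ≤ ENNReal.ofReal (8 * d * q) := by
  have hYk (k : Fin d) : Measurable fun ω => Y ω k := by fun_prop
  have hk (k : Fin d) : ∫⁻ ω, ENNReal.ofReal (Y ω k ^ 2) ∂P ≤ ENNReal.ofReal (8 * q) := by
    obtain ⟨l, hl2⟩ : ∃ l : ℝ, l ^ 2 = q⁻¹ := ⟨_, Real.sq_sqrt (by positivity)⟩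
    have hle (y : ℝ) : ENNReal.ofReal (y ^ 2) ≤ ENNReal.ofReal (2 * q)
        * (ENNReal.ofReal (Real.exp (l * y)) + ENNReal.ofReal (Real.exp (-l * y))) := by
      rw [← ENNReal.ofReal_add (Real.exp_pos _).le (Real.exp_pos _).le,
        ← ENNReal.ofReal_mul (by positivity)]
      refine ENNReal.ofReal_le_ofReal ?_
      have h1 := sq_le_two_mul_exp_add (l * y)
      rw [mul_pow, hl2, inv_mul_le_iff₀ hq] at h1
      rw [neg_mul]
      linarith
    have hme (l : ℝ) : Measurable fun ω => ENNReal.ofReal (Real.exp (l * Y ω k)) := by fun_prop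
    calc ∫⁻ ω, ENNReal.ofReal (Y ω k ^ 2) ∂P
        ≤ ∫⁻ ω, ENNReal.ofReal (2 * q) * (ENNReal.ofReal (Real.exp (l * Y ω k))
            + ENNReal.ofReal (Real.exp (-l * Y ω k))) ∂P := lintegral_mono fun ω => hle _
      _ ≤ ENNReal.ofReal (2 * q) * (ENNReal.ofReal 2 + ENNReal.ofReal 2) := by
          rw [lintegral_const_mul _ ((hme l).fun_add (hme (-l))), lintegral_add_left (hme l)]
          gcongr
          · exact hexp l hl2 k
          · exact hexp (-l) (by rw [neg_sq, hl2]) k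
      _ = _ := by
          rw [← ENNReal.ofReal_add zero_le_two zero_le_two, ← ENNReal.ofReal_mul (by positivity)]
          ring_nf
  simp only [EuclideanSpace.real_norm_sq_eq, ENNReal.ofReal_sum_of_nonneg fun _ _ => sq_nonneg _]
  rw [lintegral_finsetSum _ fun k _ => ((hYk k).pow_const 2).ennreal_ofReal]
  refine (Finset.sum_le_sum fun k _ => hk k).trans (le_of_eq ?_)
  rw [Finset.sum_const, Finset.card_univ, Fintype.card_fin, nsmul_eq_mul,
    ← ENNReal.ofReal_natCast, ← ENNReal.ofReal_mul (by positivity)]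
  ring_nf

/-! ### Mini-batch noise and privacy noise in one round. -/

namespace CafCor

variable {X : Type u} {d n m : ℕ}

/-- The deviation of the mini-batch gradient from the local gradient. -/
noncomputable def batchNoise (A : CafCor X d n m) (Di : Fin m → X) (B : Finset (Fin m))
    (θ : Vec d) : Vec d :=
  A.batchGrad Di B θ - gradient (localLoss A.loss Di) θ

theorem memLp_batchNoise (A : CafCor X d n m) (Di : Fin m → X) (i : Fin n) (θ : Vec d) :
    MemLp (fun r : Round d n m => A.batchNoise Di (r.2.2 i) θ) 2 A.roundLaw := by
  have h : MemLp (fun B => A.batchNoise Di B θ) 2 (batchLaw A.b_le) := .of_discrete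
  exact h.comp_measurePreserving (A.measurePreserving_batch i)

theorem integral_batchNoise (A : CafCor X d n m) (hb : 0 < A.b) (hclip : A.clip = none)
    (hloss : ∀ x, Differentiable ℝ fun θ => A.loss θ x) (Di : Fin m → X) (i : Fin n)
    (θ : Vec d) : ∫ r : Round d n m, A.batchNoise Di (r.2.2 i) θ ∂A.roundLaw = 0 := by
  have h0 : Measurable fun r : Round d n m => r.2.2 i := by fun_prop
  rw [← integral_map (φ := fun r : Round d n m => r.2.2 i) h0.aemeasurable
    (f := fun B => A.batchNoise Di B θ) (by fun_prop), (A.measurePreserving_batch i).map_eq]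
  unfold batchNoise
  rw [integral_sub .of_finite (integrable_const _)]
  unfold batchGrad
  rw [hclip]
  simp only [clipGrad]
  rw [integral_batchLaw_mean hb, gradient_localLoss hloss]
  simp

theorem integral_norm_batchNoise_sq_le (A : CafCor X d n m) (hb : 0 < A.b)
    (hclip : A.clip = none) {H : Finset (Fin n)} {D : Fin n → Fin m → X} {σ : ℝ}
    (hσ : BoundedVariance A.loss H D σ) {i : Fin n} (hi : i ∈ H) (θ : Vec d) :
    ∫ r : Round d n m, ‖A.batchNoise (D i) (r.2.2 i) θ‖ ^ 2 ∂A.roundLaw ≤ σ ^ 2 := by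
  have h0 : Measurable fun r : Round d n m => r.2.2 i := by fun_prop
  rw [← integral_map (φ := fun r : Round d n m => r.2.2 i) h0.aemeasurable
    (f := fun B => ‖A.batchNoise (D i) B θ‖ ^ 2) (by fun_prop), (A.measurePreserving_batch i).map_eq]
  unfold batchNoise batchGrad
  rw [hclip]
  simp only [clipGrad]
  exact (integral_batchLaw_norm_sub_sq_le hb A.b_le _ _).trans (hσ i hi θ)

/-- For the indicator of H the covariance form is v((n+1)h - h²) = v h(f+1), without the factor n of
independent noises. The constant 8 is the loss of `lintegral_norm_sq_le_of_exp`. -/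
theorem integral_norm_sum_dpNoise_sq_le (A : CafCor X d n m) {v : ℝ} (hv : 0 < v)
    (hcor : A.varCor = v) (hind : A.varInd = v) {f : ℕ} {H : Finset (Fin n)}
    (hH : H.card + f = n) (hH0 : 0 < H.card) :
    ∫ r, ‖∑ i ∈ H, dpNoise i r‖ ^ 2 ∂A.roundLaw ≤ 8 * d * v * H.card * (f + 1) := by
  have hmem : MemLp (fun r : Round d n m => ∑ i ∈ H, dpNoise i r) 2 A.roundLaw :=
    memLp_finsetSum _ fun i _ => A.memLp_dpNoise i
  set h : ℝ := (H.card : ℝ) with hh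
  have hh0 : 0 < h := by rw [hh]; exact_mod_cast hH0
  have hn : (n : ℝ) = h + f := by rw [hh]; exact_mod_cast hH.symm
  set q : ℝ := v * h * (f + 1) with hq
  have hq0 : 0 < q := by positivity
  have hexp (l : ℝ) (hl : l ^ 2 = q⁻¹) (k : Fin d) : ∫⁻ r, ENNReal.ofReal (Real.exp
      (l * (∑ i ∈ H, dpNoise i r : Vec d) k)) ∂A.roundLaw ≤ ENNReal.ofReal 2 := by
    set w : Fin n → Vec d := fun i => if i ∈ H then EuclideanSpace.single k l else 0 with hw
    have h1 (r : Round d n m) : ∑ i, inner ℝ (w i) (dpNoise i r)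
        = l * (∑ i ∈ H, dpNoise i r : Vec d) k := by
      rw [WithLp.ofLp_sum, Finset.sum_apply, Finset.mul_sum]
      simp only [hw]
      rw [← Finset.sum_filter_add_sum_filter_not Finset.univ (fun i => i ∈ H),
        Finset.sum_eq_zero (s := Finset.univ.filter fun i => ¬ i ∈ H), add_zero]
      · refine Finset.sum_congr (by ext; simp) fun i hi => ?_
        rw [if_pos hi, EuclideanSpace.inner_single_left]
        simp
      · intro i hi
        rw [if_neg (Finset.mem_filter.1 hi).2, inner_zero_left]
    have h2 : ∑ i, ‖w i‖ ^ 2 = h * l ^ 2 := by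
      have (i : Fin n) : ‖w i‖ ^ 2 = if i ∈ H then l ^ 2 else 0 := by
        simp only [hw]; split_ifs <;> simp
      simp [this, hh]
    have h3 : ‖∑ i, w i‖ ^ 2 = h ^ 2 * l ^ 2 := by
      have : ∑ i, w i = h • EuclideanSpace.single k l := by
        simp [hw, hh, ← Nat.cast_smul_eq_nsmul ℝ]
      rw [this, norm_smul, mul_pow]
      simp
    have h4 := A.lintegral_exp_inner_dpNoise hv hcor hind w
    simp only [h1] at h4
    rw [h4, h2, h3, hl]
    refine ENNReal.ofReal_le_ofReal ?_
    have h5 : v / 2 * ((n + 1) * (h * q⁻¹) - h ^ 2 * q⁻¹) = 1 / 2 := by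
      rw [hn, hq]; field_simp; ring
    rw [h5]
    have h6 : Real.exp (1 / 2) ^ 2 = Real.exp 1 := by rw [← Real.exp_nat_mul]; norm_num
    have h7 := Real.exp_one_lt_d9
    nlinarith [Real.exp_pos (1 / 2)]
  have hle : ∫⁻ r, ENNReal.ofReal (‖∑ i ∈ H, (dpNoise i r : Vec d)‖ ^ 2) ∂A.roundLaw
      ≤ ENNReal.ofReal (8 * d * q) := by
    have hm : Measurable fun r : Round d n m => (∑ i ∈ H, dpNoise i r : Vec d) := by
      have := fun i => measurable_dpNoise (d := d) (n := n) (m := m) i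
      fun_prop
    exact lintegral_norm_sq_le_of_exp hm hq0 hexp
  have hint : Integrable (fun r : Round d n m => ‖∑ i ∈ H, (dpNoise i r : Vec d)‖ ^ 2)
    A.roundLaw := hmem.integrable_norm_pow two_ne_zero
  rw [← ofReal_integral_eq_lintegral_ofReal hint (ae_of_all _ fun r => sq_nonneg _)] at hle
  refine ((ENNReal.ofReal_le_ofReal_iff (by positivity)).1 hle).trans_eq ?_
  rw [hq]
  ring

/-- The deviation of the average noisy gradient of the honest workers from the gradient. -/
noncomputable def meanNoise (A : CafCor X d n m) (H : Finset (Fin n)) (D : Fin n → Fin m → X)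
    (r : Round d n m) (θ : Vec d) : Vec d :=
  (H.card : ℝ)⁻¹ • ∑ i ∈ H, (A.batchNoise (D i) (r.2.2 i) θ + dpNoise i r)

theorem memLp_meanNoise (A : CafCor X d n m) (H : Finset (Fin n)) (D : Fin n → Fin m → X)
    (θ : Vec d) : MemLp (fun r => A.meanNoise H D r θ) 2 A.roundLaw := by
  have h (i : Fin n) : MemLp (fun r : Round d n m =>
      A.batchNoise (D i) (r.2.2 i) θ + dpNoise i r) 2 A.roundLaw :=
    (A.memLp_batchNoise (D i) i θ).add (A.memLp_dpNoise i)
  exact (memLp_finsetSum H fun i _ => h i).const_smul (H.card : ℝ)⁻¹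

theorem integral_meanNoise (A : CafCor X d n m) (hb : 0 < A.b) (hclip : A.clip = none)
    (hloss : ∀ x, Differentiable ℝ fun θ => A.loss θ x) (H : Finset (Fin n))
    (D : Fin n → Fin m → X) (θ : Vec d) : ∫ r, A.meanNoise H D r θ ∂A.roundLaw = 0 := by
  have h1 (i : Fin n) := (A.memLp_batchNoise (D i) i θ).integrable one_le_two
  have h2 (i : Fin n) := (A.memLp_dpNoise i).integrable one_le_two
  unfold meanNoise
  have h3 (i : Fin n) : Integrable (fun r : Round d n m =>
      A.batchNoise (D i) (r.2.2 i) θ + dpNoise i r) A.roundLaw := (h1 i).add (h2 i)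
  rw [integral_smul, integral_finsetSum _ fun i _ => h3 i]
  rw [Finset.sum_eq_zero, smul_zero]
  intro i _
  rw [integral_add (h1 i) (h2 i), A.integral_batchNoise hb hclip hloss, A.integral_dpNoise,
    add_zero]

theorem integral_norm_meanNoise_sq_le (A : CafCor X d n m) (hb : 0 < A.b) (hclip : A.clip = none)
    {v : ℝ} (hv : 0 < v) (hcor : A.varCor = v) (hind : A.varInd = v) {f : ℕ} {H : Finset (Fin n)}
    (hH : H.card + f = n) (hH0 : 0 < H.card) {D : Fin n → Fin m → X} {σ : ℝ}
    (hσ : BoundedVariance A.loss H D σ) (θ : Vec d) :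
    ∫ r, ‖A.meanNoise H D r θ‖ ^ 2 ∂A.roundLaw
      ≤ 2 * σ ^ 2 + 16 * d * v * (f + 1) / H.card := by
  have hh0 : (0 : ℝ) < H.card := by exact_mod_cast hH0
  have h1 (i : Fin n) := (A.memLp_batchNoise (D i) i θ).integrable_norm_pow two_ne_zero
  have hmem : MemLp (fun r : Round d n m => ∑ i ∈ H, dpNoise i r) 2 A.roundLaw :=
    memLp_finsetSum _ fun i _ => A.memLp_dpNoise i
  have h2 := hmem.integrable_norm_pow two_ne_zero
  have hpt (r : Round d n m) : ‖A.meanNoise H D r θ‖ ^ 2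
      ≤ 2 * ((H.card : ℝ)⁻¹ * ∑ i ∈ H, ‖A.batchNoise (D i) (r.2.2 i) θ‖ ^ 2)
        + 2 * (H.card : ℝ)⁻¹ ^ 2 * ‖∑ i ∈ H, (dpNoise i r : Vec d)‖ ^ 2 := by
    have h3 := norm_inv_card_smul_sum_sq_le H fun i => A.batchNoise (D i) (r.2.2 i) θ
    rw [meanNoise, Finset.sum_add_distrib, smul_add]
    have h4 : ‖(H.card : ℝ)⁻¹ • ∑ i ∈ H, (dpNoise i r : Vec d)‖ ^ 2
        = (H.card : ℝ)⁻¹ ^ 2 * ‖∑ i ∈ H, (dpNoise i r : Vec d)‖ ^ 2 := by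
      rw [norm_smul, mul_pow, Real.norm_eq_abs, sq_abs]
    generalize (H.card : ℝ)⁻¹ • ∑ i ∈ H, A.batchNoise (D i) (r.2.2 i) θ = a at *
    generalize (H.card : ℝ)⁻¹ • ∑ i ∈ H, (dpNoise i r : Vec d) = b at *
    have h5 := norm_add_le a b
    have h6 : ‖a + b‖ ^ 2 ≤ 2 * ‖a‖ ^ 2 + 2 * ‖b‖ ^ 2 := by
      nlinarith [sq_nonneg (‖a‖ - ‖b‖), norm_nonneg (a + b), norm_nonneg a, norm_nonneg b]
    linarith
  have hI1 : Integrable (fun r : Round d n m =>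
      2 * ((H.card : ℝ)⁻¹ * ∑ i ∈ H, ‖A.batchNoise (D i) (r.2.2 i) θ‖ ^ 2)) A.roundLaw :=
    ((integrable_finsetSum _ fun i _ => h1 i).const_mul _).const_mul _
  have hI2 := h2.const_mul (2 * (H.card : ℝ)⁻¹ ^ 2)
  refine (integral_mono ((A.memLp_meanNoise H D θ).integrable_norm_pow two_ne_zero)
    (hI1.add hI2) hpt).trans ?_
  simp only [Pi.add_apply]
  rw [integral_add hI1 hI2, integral_const_mul, integral_const_mul, integral_const_mul,
    integral_finsetSum _ fun i _ => h1 i]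
  have h3 : ∑ i ∈ H, ∫ r : Round d n m, ‖A.batchNoise (D i) (r.2.2 i) θ‖ ^ 2 ∂A.roundLaw
      ≤ H.card * σ ^ 2 := by
    rw [← nsmul_eq_mul]
    exact Finset.sum_le_card_nsmul _ _ _ fun i hi =>
      A.integral_norm_batchNoise_sq_le hb hclip hσ hi θ
  have h4 := A.integral_norm_sum_dpNoise_sq_le hv hcor hind hH hH0
  calc _ ≤ 2 * ((H.card : ℝ)⁻¹ * (H.card * σ ^ 2))
        + 2 * (H.card : ℝ)⁻¹ ^ 2 * (8 * d * v * H.card * (f + 1)) := by gcongr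
    _ = _ := by field_simp; ring

end CafCor

/-! ### Momentum -/

section Momentum

variable {E : Type*} [AddCommGroup E] [Module ℝ E]

/-- The momentum of the sequence `u 1, u 2, …` with coefficients `β`, started at `0`. -/
noncomputable def momentum (β : ℕ → ℝ) (u : ℕ → E) : ℕ → E
  | 0 => 0
  | t + 1 => β t • momentum β u t + (1 - β t) • u (t + 1)

theorem momentum_congr (β : ℕ → ℝ) {u u' : ℕ → E} {t : ℕ}
    (h : ∀ s ≤ t, u s = u' s) : momentum β u t = momentum β u' t := by
  induction t with
  | zero => rfl
  | succ t ih => rw [momentum, momentum, ih fun s hs => h s (by lia), h _ le_rfl]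

theorem momentum_add (β : ℕ → ℝ) (u u' : ℕ → E) (t : ℕ) :
    momentum β (fun s => u s + u' s) t = momentum β u t + momentum β u' t := by
  induction t with
  | zero => simp [momentum]
  | succ t ih => rw [momentum, momentum, momentum, ih]; module

theorem map_momentum {E' : Type*} [AddCommGroup E'] [Module ℝ E'] (φ : E →ₗ[ℝ] E') (β : ℕ → ℝ)
    (u : ℕ → E) (t : ℕ) : φ (momentum β u t) = momentum β (fun s => φ (u s)) t := by
  induction t with
  | zero => simp [momentum]
  | succ t ih => simp [momentum, ih]

/-- Momentum takes convex combinations, starting from 0, and the square is convex. -/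
theorem sum_momentum_sq_le {β : ℕ → ℝ} (hβ0 : ∀ t, 0 ≤ β t) (hβ1 : ∀ t, β t ≤ 1) {ι : Type*}
    (s : Finset ι) {u : ι → ℕ → ℝ} {c : ℝ} (hu : ∀ t, ∑ i ∈ s, u i t ^ 2 ≤ c) (t : ℕ) :
    ∑ i ∈ s, momentum β (u i) t ^ 2 ≤ c := by
  induction t with
  | zero =>
    have : 0 ≤ ∑ i ∈ s, u i 0 ^ 2 := Finset.sum_nonneg fun i _ => sq_nonneg _
    simpa [momentum] using this.trans (hu 0)
  | succ t ih =>
    have h (x y : ℝ) : (β t • x + (1 - β t) • y) ^ 2 ≤ β t * x ^ 2 + (1 - β t) * y ^ 2 := by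
      have := mul_nonneg (mul_nonneg (hβ0 t) (sub_nonneg.2 (hβ1 t))) (sq_nonneg (x - y))
      simp only [smul_eq_mul]
      nlinarith
    calc ∑ i ∈ s, momentum β (u i) (t + 1) ^ 2
        ≤ ∑ i ∈ s, (β t * momentum β (u i) t ^ 2 + (1 - β t) * u i (t + 1) ^ 2) :=
          Finset.sum_le_sum fun i _ => h _ _
      _ = β t * ∑ i ∈ s, momentum β (u i) t ^ 2 + (1 - β t) * ∑ i ∈ s, u i (t + 1) ^ 2 := by
          rw [Finset.sum_add_distrib, Finset.mul_sum, Finset.mul_sum]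
      _ ≤ β t * c + (1 - β t) * c := by
          have h0 := hβ0 t
          have h1 := sub_nonneg.2 (hβ1 t)
          have h2 := hu (t + 1)
          gcongr
      _ = c := by ring

end Momentum

theorem measurable_momentum {Ω : Type*} [MeasurableSpace Ω] {d : ℕ} (β : ℕ → ℝ)
    {u : ℕ → Ω → Vec d} (hu : ∀ t, Measurable (u t)) (t : ℕ) :
    Measurable fun ω => momentum β (fun s => u s ω) t := by
  induction t with
  | zero => exact measurable_const
  | succ t ih =>
    have := hu (t + 1)
    simp only [momentum]
    fun_prop

/-- The mean minimizes the sum of squares. This allows centring at the momentum of the global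
gradient, which all workers share. -/
theorem sum_inner_sub_honestMean_sq_le {d n : ℕ} (H : Finset (Fin n)) (x : Fin n → Vec d)
    (c v : Vec d) :
    ∑ i ∈ H, inner ℝ v (x i - honestMean H x) ^ 2 ≤ ∑ i ∈ H, inner ℝ v (x i - c) ^ 2 := by
  rcases H.eq_empty_or_nonempty with rfl | hH
  · simp
  have h0 : ∑ i ∈ H, inner ℝ v (x i - honestMean H x) = 0 := by
    rw [← inner_sum, sum_sub_honestMean hH, inner_zero_right]
  have h1 (i : Fin n) : inner ℝ v (x i - c) ^ 2 = inner ℝ v (x i - honestMean H x) ^ 2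
      + 2 * inner ℝ v (honestMean H x - c) * inner ℝ v (x i - honestMean H x)
      + inner ℝ v (honestMean H x - c) ^ 2 := by
    have : inner ℝ v (x i - c)
        = inner ℝ v (x i - honestMean H x) + inner ℝ v (honestMean H x - c) := by
      rw [← inner_add_right]; congr 1; abel
    rw [this]; ring
  simp only [h1]
  rw [Finset.sum_add_distrib, Finset.sum_add_distrib, ← Finset.mul_sum, h0]
  have : 0 ≤ ∑ i ∈ H, inner ℝ v (honestMean H x - c) ^ 2 :=
    Finset.sum_nonneg fun i _ => sq_nonneg _
  linarith

namespace CafCor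

variable {X : Type u} {d n m : ℕ}

/-! ### The execution against an omniscient adversary -/

/-- What the server receives in round `t`. -/
noncomputable def received (A : CafCor X d n m) (H : Finset (Fin n)) (D : Fin n → Fin m → X)
    (a : Adversary d n m) (ω : ℕ → Round d n m) (t : ℕ) : Fin n → Vec d :=
  fun i => if i ∈ H then (A.runAgainst H D a ω t).mom i else a.msg t ω i

theorem runAgainst_succ_θ (A : CafCor X d n m) (H : Finset (Fin n)) (D : Fin n → Fin m → X)
    (a : Adversary d n m) (ω : ℕ → Round d n m) (t : ℕ) :
    (A.runAgainst H D a ω (t + 1)).θ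
      = (A.runAgainst H D a ω t).θ - A.γ t • caf A.eig A.f (A.received H D a ω t) := rfl

theorem runAgainst_succ_mom (A : CafCor X d n m) (H : Finset (Fin n)) (D : Fin n → Fin m → X)
    (a : Adversary d n m) (ω : ℕ → Round d n m) (t : ℕ) (i : Fin n) :
    (A.runAgainst H D a ω (t + 1)).mom i = A.β t • (A.runAgainst H D a ω t).mom i
      + (1 - A.β t) • A.noisyGrad (D i) i (ω (t + 1)) (A.runAgainst H D a ω (t + 1)).θ := rfl

theorem runAgainst_mom (A : CafCor X d n m) (H : Finset (Fin n)) (D : Fin n → Fin m → X)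
    (a : Adversary d n m) (ω : ℕ → Round d n m) (t : ℕ) (i : Fin n) :
    (A.runAgainst H D a ω t).mom i
      = momentum A.β (fun s => A.noisyGrad (D i) i (ω s) (A.runAgainst H D a ω s).θ) t := by
  induction t with
  | zero => rfl
  | succ t ih => rw [runAgainst_succ_mom, ih, momentum]

theorem measurable_runAgainst (A : CafCor X d n m) (heig : IsTopEigensolver A.eig)
    (H : Finset (Fin n)) (D : Fin n → Fin m → X) (a : Adversary d n m) (t : ℕ) :
    Measurable (fun ω => (A.runAgainst H D a ω t).θ) ∧
      ∀ i, Measurable fun ω => (A.runAgainst H D a ω t).mom i := by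
  induction t with
  | zero => exact ⟨measurable_const, fun i => measurable_const⟩
  | succ t ih =>
    obtain ⟨ih1, ih2⟩ := ih
    have hrec : Measurable fun ω => A.received H D a ω t := by
      refine measurable_pi_lambda _ fun i => ?_
      unfold received
      split_ifs
      · exact ih2 i
      · exact (measurable_pi_apply i).comp (a.measurable t)
    have hcaf : Measurable fun ω => caf A.eig A.f (A.received H D a ω t) :=
      (measurable_caf heig A.f).comp hrec
    have hθ : Measurable fun ω => (A.runAgainst H D a ω (t + 1)).θ := by
      simp only [runAgainst_succ_θ]
      exact ih1.fun_sub (hcaf.fun_const_smul _)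
    refine ⟨hθ, fun i => ?_⟩
    have hg := A.measurable_noisyGrad (D i) i (measurable_pi_apply (t + 1)) hθ
    simp only [runAgainst_succ_mom]
    exact ((ih2 i).fun_const_smul _).fun_add (hg.fun_const_smul _)

theorem runAgainst_congr (A : CafCor X d n m) (H : Finset (Fin n)) (D : Fin n → Fin m → X)
    (a : Adversary d n m) {ω ω' : ℕ → Round d n m} {t : ℕ} (h : ∀ s ≤ t, ω s = ω' s) :
    (A.runAgainst H D a ω t).θ = (A.runAgainst H D a ω' t).θ ∧
      (A.runAgainst H D a ω t).mom = (A.runAgainst H D a ω' t).mom := by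
  induction t with
  | zero => exact ⟨rfl, rfl⟩
  | succ t ih =>
    obtain ⟨ih1, ih2⟩ := ih fun s hs => h s (by lia)
    have hrec : A.received H D a ω t = A.received H D a ω' t := by
      unfold received
      rw [ih2, a.nonanticipating t ω ω' fun s hs => h s (by lia)]
    have hθ : (A.runAgainst H D a ω (t + 1)).θ = (A.runAgainst H D a ω' (t + 1)).θ := by
      rw [runAgainst_succ_θ, runAgainst_succ_θ, ih1, hrec]
    refine ⟨hθ, funext fun i => ?_⟩
    rw [runAgainst_succ_mom, runAgainst_succ_mom, ih2, hθ, h _ le_rfl]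

theorem received_congr (A : CafCor X d n m) (H : Finset (Fin n)) (D : Fin n → Fin m → X)
    (a : Adversary d n m) {ω ω' : ℕ → Round d n m} {t : ℕ} (h : ∀ s ≤ t, ω s = ω' s) :
    A.received H D a ω t = A.received H D a ω' t := by
  unfold received
  rw [(A.runAgainst_congr H D a h).2, a.nonanticipating t ω ω' h]

/-- The model depends on strictly earlier rounds only, one fewer than the momenta. So the noise of
round t+1 is still fresh at θ_{t+1}, even against an omniscient adversary. -/
theorem runAgainst_θ_congr (A : CafCor X d n m) (H : Finset (Fin n)) (D : Fin n → Fin m → X)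
    (a : Adversary d n m) {ω ω' : ℕ → Round d n m} {t : ℕ} (h : ∀ s < t, ω s = ω' s) :
    (A.runAgainst H D a ω t).θ = (A.runAgainst H D a ω' t).θ := by
  cases t with
  | zero => rfl
  | succ t =>
    have h' : ∀ s ≤ t, ω s = ω' s := fun s hs => h s (by lia)
    rw [runAgainst_succ_θ, runAgainst_succ_θ, (A.runAgainst_congr H D a h').1,
      A.received_congr H D a h']

/-- The part of the momentum of worker `i` that is due to the mini-batches. -/
noncomputable def batchMomentum (A : CafCor X d n m) (H : Finset (Fin n)) (D : Fin n → Fin m → X)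
    (a : Adversary d n m) (i : Fin n) (t : ℕ) (ω : ℕ → Round d n m) : Vec d :=
  momentum A.β (fun s => A.batchNoise (D i) ((ω s).2.2 i) (A.runAgainst H D a ω s).θ) t

/-- The part of the momentum of worker `i` that is due to the noise. -/
noncomputable def noiseMomentum (A : CafCor X d n m) (i : Fin n) (t : ℕ)
    (ω : ℕ → Round d n m) : Vec d :=
  momentum A.β (fun s => dpNoise i (ω s)) t

/-- The part of the momentum of worker `i` that is due to the heterogeneity of the data. -/
noncomputable def heterogeneityMomentum (A : CafCor X d n m) (H : Finset (Fin n))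
    (D : Fin n → Fin m → X) (a : Adversary d n m) (i : Fin n) (t : ℕ)
    (ω : ℕ → Round d n m) : Vec d :=
  momentum A.β (fun s => gradient (localLoss A.loss (D i)) (A.runAgainst H D a ω s).θ
    - gradient (honestLoss A.loss H D) (A.runAgainst H D a ω s).θ) t

theorem measurable_batchNoise {Ω : Type*} [MeasurableSpace Ω] (A : CafCor X d n m)
    (Di : Fin m → X) {B : Ω → Finset (Fin m)} (hB : Measurable B) {θ : Ω → Vec d}
    (hθ : Measurable θ) : Measurable fun ω => A.batchNoise Di (B ω) (θ ω) := by
  have h1 := A.measurable_batchGrad Di hB hθ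
  have h2 : Measurable fun ω => gradient (localLoss A.loss Di) (θ ω) :=
    (measurable_gradient _).comp hθ
  simp only [batchNoise]
  exact h1.fun_sub h2

theorem measurable_batchMomentum (A : CafCor X d n m) (heig : IsTopEigensolver A.eig)
    (H : Finset (Fin n)) (D : Fin n → Fin m → X) (a : Adversary d n m) (i : Fin n) (t : ℕ) :
    Measurable (A.batchMomentum H D a i t) := by
  have h (s : ℕ) : Measurable fun ω =>
      A.batchNoise (D i) ((ω s).2.2 i) (A.runAgainst H D a ω s).θ := by
    have h0 : Measurable fun ω : ℕ → Round d n m => (ω s).2.2 i := by fun_prop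
    exact A.measurable_batchNoise (D i) h0 (A.measurable_runAgainst heig H D a s).1
  exact measurable_momentum A.β h t

theorem measurable_noiseMomentum (A : CafCor X d n m) (i : Fin n) (t : ℕ) :
    Measurable (A.noiseMomentum i t) := by
  have h (s : ℕ) : Measurable fun ω : ℕ → Round d n m => (dpNoise i (ω s) : Vec d) :=
    (measurable_dpNoise i).comp (measurable_pi_apply s)
  exact measurable_momentum A.β h t

theorem mom_eq_add (A : CafCor X d n m) (H : Finset (Fin n)) (D : Fin n → Fin m → X)
    (a : Adversary d n m) (ω : ℕ → Round d n m) (t : ℕ) (i : Fin n) :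
    (A.runAgainst H D a ω t).mom i
      = momentum A.β (fun s => gradient (honestLoss A.loss H D) (A.runAgainst H D a ω s).θ) t
        + A.heterogeneityMomentum H D a i t ω + A.batchMomentum H D a i t ω
        + A.noiseMomentum i t ω := by
  rw [runAgainst_mom, heterogeneityMomentum, batchMomentum, noiseMomentum, ← momentum_add,
    ← momentum_add, ← momentum_add]
  refine momentum_congr _ fun s _ => ?_
  rw [noisyGrad_eq, batchNoise]
  abel

theorem honestMean_mom_succ (A : CafCor X d n m)
    (hloss : ∀ x, Differentiable ℝ fun θ => A.loss θ x) (H : Finset (Fin n))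
    (D : Fin n → Fin m → X) (a : Adversary d n m) (ω : ℕ → Round d n m) (t : ℕ) :
    honestMean H (A.runAgainst H D a ω (t + 1)).mom
      = A.β t • honestMean H (A.runAgainst H D a ω t).mom
        + (1 - A.β t) • (gradient (honestLoss A.loss H D) (A.runAgainst H D a ω (t + 1)).θ
          + A.meanNoise H D (ω (t + 1)) (A.runAgainst H D a ω (t + 1)).θ) := by
  have h (i : Fin n) : (A.runAgainst H D a ω (t + 1)).mom i
      = A.β t • (A.runAgainst H D a ω t).mom i
      + (1 - A.β t) • (gradient (localLoss A.loss (D i)) (A.runAgainst H D a ω (t + 1)).θ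
        + (A.batchNoise (D i) ((ω (t + 1)).2.2 i) (A.runAgainst H D a ω (t + 1)).θ
          + dpNoise i (ω (t + 1)))) := by
    rw [runAgainst_succ_mom, noisyGrad_eq, batchNoise]
    congr 2
    abel
  rw [gradient_honestLoss hloss, meanNoise, honestMean, honestMean, ← smul_add,
    ← Finset.sum_add_distrib, Finset.sum_congr rfl fun i _ => h i, Finset.sum_add_distrib,
    ← Finset.smul_sum, ← Finset.smul_sum, smul_add]
  congr 1 <;> rw [smul_comm]

end CafCor

/-! ### Moments of the momenta for the tuned schedules. -/

namespace CafCor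

variable {X : Type u} {d n m : ℕ}

/-- CafCor without clipping, with noise of variance `v` and the schedules for `L` and `μ`. -/
structure IsTuned (A : CafCor X d n m) (f : ℕ) (L μ v : ℝ) : Prop where
  differentiable : ∀ x, Differentiable ℝ fun θ => A.loss θ x
  isTopEigensolver : IsTopEigensolver A.eig
  clip_eq : A.clip = none
  f_eq : A.f = f
  b_pos : 0 < A.b
  varCor_eq : A.varCor = v
  varInd_eq : A.varInd = v
  γ_eq : A.γ = stepSize L μ
  β_eq : A.β = fun t => 1 - 24 * L * stepSize L μ t
  L_pos : 0 < L
  μ_pos : 0 < μ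
  v_pos : 0 < v

variable {A : CafCor X d n m} {f : ℕ} {L μ v : ℝ} {H : Finset (Fin n)} {D : Fin n → Fin m → X}

theorem IsTuned.β_nonneg (hA : A.IsTuned f L μ v) (t : ℕ) : 0 ≤ A.β t := by
  rw [hA.β_eq]
  linarith [mul_stepSize_le_one hA.L_pos hA.μ_pos t]

theorem IsTuned.one_sub_β (hA : A.IsTuned f L μ v) (t : ℕ) :
    1 - A.β t = 24 * L * stepSize L μ t := by
  rw [hA.β_eq]; ring

theorem IsTuned.β_le_one (hA : A.IsTuned f L μ v) (t : ℕ) : A.β t ≤ 1 := by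
  have h1 := hA.one_sub_β t
  have h2 := stepSize_pos hA.L_pos hA.μ_pos t
  have h3 := hA.L_pos
  have : 0 ≤ 24 * L * stepSize L μ t := by positivity
  linarith

theorem update_eq_of_le {R : Type*} (ω : ℕ → R) (t : ℕ) (r : R) :
    ∀ s ≤ t, Function.update ω (t + 1) r s = ω s :=
  fun _ hs => Function.update_of_ne (by lia) _ _

theorem runAgainst_update_θ (A : CafCor X d n m) (H : Finset (Fin n)) (D : Fin n → Fin m → X)
    (a : Adversary d n m) (ω : ℕ → Round d n m) (t : ℕ) (r : Round d n m) :
    (A.runAgainst H D a (Function.update ω (t + 1) r) (t + 1)).θ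
      = (A.runAgainst H D a ω (t + 1)).θ :=
  A.runAgainst_θ_congr H D a fun s hs => update_eq_of_le ω t r s (by lia)

theorem batchMomentum_update (A : CafCor X d n m) (H : Finset (Fin n)) (D : Fin n → Fin m → X)
    (a : Adversary d n m) (i : Fin n) (ω : ℕ → Round d n m) (t : ℕ) (r : Round d n m) :
    A.batchMomentum H D a i (t + 1) (Function.update ω (t + 1) r)
      = A.β t • A.batchMomentum H D a i t ω
        + (1 - A.β t) • A.batchNoise (D i) (r.2.2 i) (A.runAgainst H D a ω (t + 1)).θ := by
  have h : A.batchMomentum H D a i t (Function.update ω (t + 1) r)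
      = A.batchMomentum H D a i t ω := by
    refine momentum_congr _ fun s hs => ?_
    rw [update_eq_of_le ω t r s hs,
      (A.runAgainst_congr H D a fun s' hs' => update_eq_of_le ω t r s' (hs'.trans hs)).1]
  rw [← h, ← A.runAgainst_update_θ H D a ω t r]
  nth_rw 1 [batchMomentum]
  rw [momentum, Function.update_self]
  rfl

theorem noiseMomentum_update (A : CafCor X d n m) (i : Fin n) (ω : ℕ → Round d n m) (t : ℕ)
    (r : Round d n m) : A.noiseMomentum i (t + 1) (Function.update ω (t + 1) r)
      = A.β t • A.noiseMomentum i t ω + (1 - A.β t) • dpNoise i r := by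
  have h : A.noiseMomentum i t (Function.update ω (t + 1) r) = A.noiseMomentum i t ω := by
    refine momentum_congr _ fun s hs => ?_
    rw [update_eq_of_le ω t r s hs]
  rw [← h]
  nth_rw 1 [noiseMomentum]
  rw [momentum, Function.update_self]
  rfl

/-- Mini-batch deviations are centred given the past, so integrating out the newest round leaves no
cross term and the weights add in squares. -/
theorem IsTuned.lintegral_norm_batchMomentum_sq_le (hA : A.IsTuned f L μ v) {σ : ℝ}
    (hσ : BoundedVariance A.loss H D σ) (a : Adversary d n m) {i : Fin n} (hi : i ∈ H) (t : ℕ) :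
    ∫⁻ ω, ENNReal.ofReal (‖A.batchMomentum H D a i t ω‖ ^ 2) ∂A.law
      ≤ ENNReal.ofReal (momentumWeight L μ t * σ ^ 2) := by
  have hm (t : ℕ) : Measurable fun ω => ENNReal.ofReal (‖A.batchMomentum H D a i t ω‖ ^ 2) := by
    have := A.measurable_batchMomentum hA.isTopEigensolver H D a i t
    fun_prop
  induction t with
  | zero => simp [batchMomentum, momentum]
  | succ t ih =>
    rw [law_eq] at ih ⊢
    rw [lintegral_update_infinitePi _ (t + 1) (hm (t + 1))]
    have hstep (ω : ℕ → Round d n m) : ∫⁻ r, ENNReal.ofReal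
          (‖A.batchMomentum H D a i (t + 1) (Function.update ω (t + 1) r)‖ ^ 2) ∂A.roundLaw
        ≤ ENNReal.ofReal (A.β t ^ 2) * ENNReal.ofReal (‖A.batchMomentum H D a i t ω‖ ^ 2)
          + ENNReal.ofReal ((1 - A.β t) ^ 2 * σ ^ 2) := by
      simp only [batchMomentum_update]
      refine (lintegral_norm_add_smul_sq_le (A.memLp_batchNoise (D i) i _)
        (A.integral_batchNoise hA.b_pos hA.clip_eq hA.differentiable (D i) i _)
        (A.integral_norm_batchNoise_sq_le hA.b_pos hA.clip_eq hσ hi _) _ _).trans_eq ?_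
      rw [norm_smul, mul_pow, Real.norm_eq_abs, sq_abs,
        ENNReal.ofReal_add (by positivity) (by positivity), ENNReal.ofReal_mul (by positivity)]
    refine (lintegral_mono hstep).trans ?_
    rw [lintegral_add_right _ measurable_const, lintegral_const_mul _ (hm t), lintegral_const,
      measure_univ, mul_one]
    refine (add_le_add_left (mul_le_mul_right ih _) _).trans_eq ?_
    have hp := momentumWeight_nonneg L μ t
    rw [← ENNReal.ofReal_mul (by positivity), ← ENNReal.ofReal_add (by positivity) (by positivity),
      momentumWeight, hA.one_sub_β, hA.β_eq]
    congr 1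
    ring

/-- The privacy noise does not depend on the model, so its momentum is a fixed linear combination of
independent Gaussians; the negative part of the covariance is dropped. -/
theorem IsTuned.lintegral_exp_noiseMomentum_le (hA : A.IsTuned f L μ v) (t : ℕ)
    (w : Fin n → Vec d) :
    ∫⁻ ω, ENNReal.ofReal (Real.exp (∑ i, inner ℝ (w i) (A.noiseMomentum i t ω))) ∂A.law
      ≤ ENNReal.ofReal (Real.exp (momentumWeight L μ t * (v * (n + 1)) / 2 * ∑ i, ‖w i‖ ^ 2)) := by
  have hm (t : ℕ) (w : Fin n → Vec d) : Measurable fun ω =>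
      ENNReal.ofReal (Real.exp (∑ i, inner ℝ (w i) (A.noiseMomentum i t ω))) := by
    have := fun i => A.measurable_noiseMomentum i t
    fun_prop
  induction t generalizing w with
  | zero => simp [noiseMomentum, momentum, momentumWeight]
  | succ t ih =>
    rw [law_eq] at ih ⊢
    rw [lintegral_update_infinitePi _ (t + 1) (hm (t + 1) w)]
    set c : ℝ := v / 2 * ((n + 1) * ∑ i, ‖(1 - A.β t) • w i‖ ^ 2) with hc
    have hv := hA.v_pos
    have hstep (ω : ℕ → Round d n m) : ∫⁻ r, ENNReal.ofReal (Real.exp (∑ i, inner ℝ (w i)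
          (A.noiseMomentum i (t + 1) (Function.update ω (t + 1) r)))) ∂A.roundLaw
        ≤ ENNReal.ofReal (Real.exp (∑ i, inner ℝ (A.β t • w i) (A.noiseMomentum i t ω)))
          * ENNReal.ofReal (Real.exp c) := by
      have h1 (r : Round d n m) : ∑ i, inner ℝ (w i)
          (A.noiseMomentum i (t + 1) (Function.update ω (t + 1) r))
          = ∑ i, inner ℝ (A.β t • w i) (A.noiseMomentum i t ω)
            + ∑ i, inner ℝ ((1 - A.β t) • w i) (dpNoise i r) := by
        rw [← Finset.sum_add_distrib]
        refine Finset.sum_congr rfl fun i _ => ?_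
        rw [noiseMomentum_update, inner_add_right, inner_smul_right, inner_smul_right,
          real_inner_smul_left, real_inner_smul_left]
      have hmd : Measurable fun r : Round d n m =>
          ENNReal.ofReal (Real.exp (∑ i, inner ℝ ((1 - A.β t) • w i) (dpNoise i r))) := by
        have := fun i => measurable_dpNoise (d := d) (n := n) (m := m) i
        fun_prop
      simp only [h1, Real.exp_add, ENNReal.ofReal_mul (Real.exp_pos _).le]
      rw [lintegral_const_mul _ hmd,
        A.lintegral_exp_inner_dpNoise hA.v_pos hA.varCor_eq hA.varInd_eq]
      gcongr
      rw [hc]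
      gcongr
      exact sub_le_self _ (sq_nonneg _)
    refine (lintegral_mono hstep).trans ?_
    rw [lintegral_mul_const _ (hm t _)]
    refine (mul_le_mul_left (ih _) _).trans_eq ?_
    rw [← ENNReal.ofReal_mul (Real.exp_pos _).le, ← Real.exp_add, hc, momentumWeight,
      hA.one_sub_β]
    simp only [norm_smul, mul_pow, ← Finset.mul_sum, Real.norm_eq_abs, sq_abs]
    rw [hA.β_eq]
    congr 2
    ring

end CafCor

/-! ### Aggregation error and decrease of the Lyapunov function. -/

namespace CafCor

variable {X : Type u} {d n m : ℕ} {A : CafCor X d n m} {f : ℕ} {L μ v : ℝ} {H : Finset (Fin n)}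
  {D : Fin n → Fin m → X}

theorem IsTuned.sum_inner_heterogeneityMomentum_sq_le (hA : A.IsTuned f L μ v) (hH : 0 < H.card)
    {G : ℝ} (hG : BoundedHeterogeneity A.loss H D G) (a : Adversary d n m) (t : ℕ)
    (ω : ℕ → Round d n m) {w : Vec d} (hw : ‖w‖ ≤ 1) :
    ∑ i ∈ H, inner ℝ w (A.heterogeneityMomentum H D a i t ω) ^ 2 ≤ H.card * G ^ 2 := by
  have hh : (0 : ℝ) < H.card := by exact_mod_cast hH
  have h (i : Fin n) : inner ℝ w (A.heterogeneityMomentum H D a i t ω)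
      = momentum A.β (fun s => inner ℝ w
          (gradient (localLoss A.loss (D i)) (A.runAgainst H D a ω s).θ
            - gradient (honestLoss A.loss H D) (A.runAgainst H D a ω s).θ)) t :=
    map_momentum (innerSL ℝ w).toLinearMap A.β _ t
  simp only [h]
  refine sum_momentum_sq_le hA.β_nonneg hA.β_le_one H (fun s => ?_) t
  have := hG (A.runAgainst H D a ω s).θ w hw
  rwa [inv_mul_le_iff₀ hh] at this

theorem sum_inner_received_sub_sq_le (A : CafCor X d n m) (H : Finset (Fin n))
    (D : Fin n → Fin m → X) (a : Adversary d n m) (t : ℕ) (ω : ℕ → Round d n m) {w : Vec d}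
    (hw : ‖w‖ = 1) :
    ∑ i ∈ H, inner ℝ w (A.received H D a ω t i - honestMean H (A.received H D a ω t)) ^ 2
      ≤ 3 * (∑ i ∈ H, inner ℝ w (A.heterogeneityMomentum H D a i t ω) ^ 2
        + ∑ i ∈ H, ‖A.batchMomentum H D a i t ω‖ ^ 2
        + ∑ i, inner ℝ w (A.noiseMomentum i t ω) ^ 2) := by
  refine (sum_inner_sub_honestMean_sq_le H _ (momentum A.β (fun s =>
    gradient (honestLoss A.loss H D) (A.runAgainst H D a ω s).θ) t) w).trans ?_
  have hle : ∑ i ∈ H, inner ℝ w (A.noiseMomentum i t ω) ^ 2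
      ≤ ∑ i, inner ℝ w (A.noiseMomentum i t ω) ^ 2 :=
    Finset.sum_le_sum_of_subset_of_nonneg (Finset.subset_univ _) fun _ _ _ => sq_nonneg _
  refine le_trans ?_ (mul_le_mul_of_nonneg_left (add_le_add_right hle _) zero_le_three)
  rw [← Finset.sum_add_distrib, ← Finset.sum_add_distrib, Finset.mul_sum]
  refine Finset.sum_le_sum fun i hi => ?_
  have hrec : A.received H D a ω t i = (A.runAgainst H D a ω t).mom i := if_pos hi
  rw [hrec, mom_eq_add]
  have h1 : |inner ℝ w (A.batchMomentum H D a i t ω)| ≤ ‖A.batchMomentum H D a i t ω‖ := by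
    simpa [hw] using abs_real_inner_le_norm w (A.batchMomentum H D a i t ω)
  have h2 : inner ℝ w (A.batchMomentum H D a i t ω) ^ 2 ≤ ‖A.batchMomentum H D a i t ω‖ ^ 2 :=
    sq_le_sq' (abs_le.1 h1).1 (abs_le.1 h1).2
  generalize momentum A.β (fun s =>
    gradient (honestLoss A.loss H D) (A.runAgainst H D a ω s).θ) t = c
  generalize A.heterogeneityMomentum H D a i t ω = x at *
  generalize A.batchMomentum H D a i t ω = y at *
  generalize A.noiseMomentum i t ω = z at *
  have h3 : c + x + y + z - c = x + y + z := by abel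
  rw [h3, inner_add_right, inner_add_right]
  nlinarith [sq_nonneg (inner ℝ w x - inner ℝ w y), sq_nonneg (inner ℝ w x - inner ℝ w z),
    sq_nonneg (inner ℝ w y - inner ℝ w z)]

/-- CAF is applied with a random S collecting the three sources of scatter. Heterogeneity is not
damped by momentum; the other two carry the factor 48Lγ_t, which gives 3·48 = 144 and 3·162·48 =
23328. -/
theorem IsTuned.lintegral_norm_caf_sub_sq_le (hA : A.IsTuned f L μ v) (hμL : μ ≤ L) {η : ℝ}
    (hη : 0 < η) (hd : 0 < d) (hn : 0 < n) (hnf : (2 + η) * f ≤ n) (hH : H.card + f = n)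
    (hH0 : 0 < H.card) {G σ : ℝ} (hG : BoundedHeterogeneity A.loss H D G)
    (hσ : BoundedVariance A.loss H D σ) (a : Adversary d n m) (t : ℕ) :
    ∫⁻ ω, ENNReal.ofReal (‖caf A.eig A.f (A.received H D a ω t)
        - honestMean H (A.runAgainst H D a ω t).mom‖ ^ 2) ∂A.law
      ≤ ENNReal.ofReal (cafConst η * (f / n) * (3 * G ^ 2 + stepSize L μ t
        * (L * (144 * σ ^ 2 + 23328 * (n + d) * (n + 1) * v / n)))) := by
  have hL := hA.L_pos
  have hv := hA.v_pos
  have hγ := stepSize_pos hA.L_pos hA.μ_pos t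
  have hn' : (0 : ℝ) < n := by exact_mod_cast hn
  have hh' : (0 : ℝ) < H.card := by exact_mod_cast hH0
  have hhn : (H.card : ℝ) ≤ n := by exact_mod_cast (by lia : H.card ≤ n)
  have hκ := cafConst_pos hη
  set p : ℝ := 48 * L * stepSize L μ t with hp
  have hp0 : 0 < p := by positivity
  set q : ℝ := p * (v * (n + 1)) with hq
  have hq0 : 0 < q := by positivity
  have hwp := momentumWeight_le hA.μ_pos hμL t
  obtain ⟨Z, hZm, hZ0, hZle, hZ⟩ := exists_integral_sum_inner_sq_le (P := A.law) hd
    (fun i => A.measurable_noiseMomentum i t) hq0 fun w =>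
      (hA.lintegral_exp_noiseMomentum_le t w).trans (by
        rw [hq]
        gcongr)
  have hbm (i : Fin n) : Measurable fun ω =>
      ENNReal.ofReal (‖A.batchMomentum H D a i t ω‖ ^ 2) := by
    have := A.measurable_batchMomentum hA.isTopEigensolver H D a i t
    fun_prop
  set S : (ℕ → Round d n m) → ℝ := fun ω => 3 / n * (H.card * G ^ 2
    + ∑ i ∈ H, ‖A.batchMomentum H D a i t ω‖ ^ 2 + Z ω) with hS
  have hS0 (ω : ℕ → Round d n m) : 0 ≤ S ω := by
    have := hZ0 ω
    have : 0 ≤ ∑ i ∈ H, ‖A.batchMomentum H D a i t ω‖ ^ 2 :=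
      Finset.sum_nonneg fun i _ => sq_nonneg _
    positivity
  have hmean (ω : ℕ → Round d n m) : honestMean H (A.received H D a ω t)
      = honestMean H (A.runAgainst H D a ω t).mom := by
    unfold honestMean
    congr 1
    exact Finset.sum_congr rfl fun i hi => if_pos hi
  have hpt : ∀ᵐ ω ∂A.law, ENNReal.ofReal (‖caf A.eig A.f (A.received H D a ω t)
        - honestMean H (A.runAgainst H D a ω t).mom‖ ^ 2)
      ≤ ENNReal.ofReal (cafConst η * (f / n)) * ENNReal.ofReal (S ω) := by
    filter_upwards [hZ] with ω hω
    rw [← ENNReal.ofReal_mul (by positivity), ← hmean, hA.f_eq]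
    refine ENNReal.ofReal_le_ofReal ?_
    refine norm_caf_sub_sq_le hη hn hnf hH hA.isTopEigensolver _ (hS0 ω) fun w hw => ?_
    refine (A.sum_inner_received_sub_sq_le H D a t ω hw).trans ?_
    have h1 := hA.sum_inner_heterogeneityMomentum_sq_le hH0 hG a t ω hw.le
    have h2 := hω w hw
    have h3 : n * S ω = 3 * (H.card * G ^ 2
        + ∑ i ∈ H, ‖A.batchMomentum H D a i t ω‖ ^ 2 + Z ω) := by
      simp only [hS]; field_simp
    rw [h3]
    gcongr
  have hSint : ∫⁻ ω, ENNReal.ofReal (S ω) ∂A.law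
      ≤ ENNReal.ofReal (3 / n * (H.card * G ^ 2 + H.card * (p * σ ^ 2) + 162 * (n + d) * q)) := by
    have h1 (ω : ℕ → Round d n m) : ENNReal.ofReal (S ω) = ENNReal.ofReal (3 / n) *
        (ENNReal.ofReal (H.card * G ^ 2)
          + ∑ i ∈ H, ENNReal.ofReal (‖A.batchMomentum H D a i t ω‖ ^ 2)
          + ENNReal.ofReal (Z ω)) := by
      have h2 : 0 ≤ ∑ i ∈ H, ‖A.batchMomentum H D a i t ω‖ ^ 2 :=
        Finset.sum_nonneg fun i _ => sq_nonneg _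
      simp only [hS]
      rw [ENNReal.ofReal_mul (by positivity), ENNReal.ofReal_add (by positivity) (hZ0 ω),
        ENNReal.ofReal_add (by positivity) h2,
        ENNReal.ofReal_sum_of_nonneg fun i _ => sq_nonneg _]
    have hm1 : Measurable fun ω =>
        ∑ i ∈ H, ENNReal.ofReal (‖A.batchMomentum H D a i t ω‖ ^ 2) := by fun_prop
    have hm2 : Measurable fun ω => ENNReal.ofReal (Z ω) := by fun_prop
    simp only [h1]
    rw [lintegral_const_mul _ ((measurable_const.fun_add hm1).fun_add hm2),
      lintegral_add_right _ hm2, lintegral_add_right _ hm1, lintegral_finsetSum _ fun i _ => hbm i,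
      lintegral_const, measure_univ, mul_one,
      ENNReal.ofReal_mul (p := 3 / (n : ℝ)) (by positivity),
      ENNReal.ofReal_add (by positivity) (by positivity),
      ENNReal.ofReal_add (by positivity) (by positivity)]
    gcongr
    rw [← nsmul_eq_mul, ENNReal.ofReal_nsmul]
    refine Finset.sum_le_card_nsmul _ _ _ fun i hi => ?_
    exact (hA.lintegral_norm_batchMomentum_sq_le hσ a hi t).trans
      (ENNReal.ofReal_le_ofReal (by gcongr))
  calc _ ≤ ∫⁻ ω, ENNReal.ofReal (cafConst η * (f / n)) * ENNReal.ofReal (S ω) ∂A.law :=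
        lintegral_mono_ae hpt
    _ ≤ ENNReal.ofReal (cafConst η * (f / n)) * ENNReal.ofReal
        (3 / n * (H.card * G ^ 2 + H.card * (p * σ ^ 2) + 162 * (n + d) * q)) := by
        rw [lintegral_const_mul' _ _ ENNReal.ofReal_ne_top]
        gcongr
    _ ≤ _ := by
        rw [← ENNReal.ofReal_mul (by positivity)]
        refine ENNReal.ofReal_le_ofReal (mul_le_mul_of_nonneg_left ?_ (by positivity))
        have h1 : 3 / n * (H.card * G ^ 2 + H.card * (p * σ ^ 2) + 162 * (n + d) * q)
            ≤ 3 / n * (n * G ^ 2 + n * (p * σ ^ 2) + 162 * (n + d) * q) := by gcongr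
        refine h1.trans (le_of_eq ?_)
        rw [hq, hp]
        field_simp
        ring

/-- The Lyapunov function of the analysis. -/
noncomputable def lyapunov (A : CafCor X d n m) (L : ℝ) (H : Finset (Fin n))
    (D : Fin n → Fin m → X) (a : Adversary d n m) (t : ℕ) (ω : ℕ → Round d n m) : ℝ :=
  honestLoss A.loss H D (A.runAgainst H D a ω t).θ - (⨅ θ : Vec d, honestLoss A.loss H D θ)
    + L⁻¹ * ‖honestMean H (A.runAgainst H D a ω t).mom
      - gradient (honestLoss A.loss H D) (A.runAgainst H D a ω t).θ‖ ^ 2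

theorem measurable_honestMean {Ω : Type*} [MeasurableSpace Ω] {x : Ω → Fin n → Vec d}
    (hx : ∀ i, Measurable fun ω => x ω i) (H : Finset (Fin n)) :
    Measurable fun ω => honestMean H (x ω) := by
  unfold honestMean
  fun_prop

theorem IsTuned.measurable_honestLoss (hA : A.IsTuned f L μ v) (H : Finset (Fin n))
    (D : Fin n → Fin m → X) : Measurable (honestLoss A.loss H D) := by
  have h (i : Fin n) : Differentiable ℝ (localLoss A.loss (D i)) :=
    differentiable_localLoss hA.differentiable (D i)
  have : Differentiable ℝ (honestLoss A.loss H D) :=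
    (Differentiable.fun_sum fun i _ => h i).const_mul _
  exact this.continuous.measurable

theorem IsTuned.measurable_lyapunov (hA : A.IsTuned f L μ v) (a : Adversary d n m) (t : ℕ) :
    Measurable (A.lyapunov L H D a t) := by
  obtain ⟨h1, h2⟩ := A.measurable_runAgainst hA.isTopEigensolver H D a t
  have h3 := (hA.measurable_honestLoss H D).comp h1
  have h4 := (measurable_gradient (honestLoss A.loss H D)).comp h1
  have h5 := measurable_honestMean h2 H
  exact (h3.sub_const _).add (((h5.sub h4).norm.pow_const 2).const_mul _)

/-- Given the past, the new mean momentum deviates from the gradient by β(m̄ - ∇F(θ')) plus (1-β)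
times centred noise. `lyapunov_step` handles the first part, and the second adds L⁻¹(24Lγ)² = 576Lγ²
times its variance. -/
theorem IsTuned.lintegral_lyapunov_update_le (hA : A.IsTuned f L μ v) (hd : 0 < d)
    (hH : H.card + f = n) (hH0 : 0 < H.card) {σ : ℝ} (hσ : BoundedVariance A.loss H D σ)
    (hsm : IsSmooth L (honestLoss A.loss H D)) (hsc : IsStronglyConvex μ (honestLoss A.loss H D))
    (a : Adversary d n m) (t : ℕ) (ω : ℕ → Round d n m) :
    ∫⁻ r, ENNReal.ofReal (A.lyapunov L H D a (t + 1) (Function.update ω (t + 1) r)) ∂A.roundLaw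
      ≤ ENNReal.ofReal (1 - μ * stepSize L μ t) * ENNReal.ofReal (A.lyapunov L H D a t ω)
        + ENNReal.ofReal (stepSize L μ t) * ENNReal.ofReal (‖caf A.eig A.f (A.received H D a ω t)
          - honestMean H (A.runAgainst H D a ω t).mom‖ ^ 2)
        + ENNReal.ofReal (stepSize L μ t ^ 2
          * (L * (576 * (2 * σ ^ 2 + 16 * d * v * (f + 1) / H.card)))) := by
  have hL := hA.L_pos
  have hv := hA.v_pos
  have hγ := stepSize_pos hA.L_pos hA.μ_pos t
  set γ := stepSize L μ t with hγdef
  set F := honestLoss A.loss H D with hF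
  set V : ℝ := 2 * σ ^ 2 + 16 * d * v * (f + 1) / H.card with hV
  have hV0 : 0 ≤ V := by positivity
  set θ' := (A.runAgainst H D a ω (t + 1)).θ with hθ'
  have hF0 := hsc.sub_iInf_nonneg hA.μ_pos
  have hβ := hA.one_sub_β t
  have hupd (r : Round d n m) : A.lyapunov L H D a (t + 1) (Function.update ω (t + 1) r)
      = F θ' - (⨅ θ, F θ) + L⁻¹ * ‖A.β t • (honestMean H (A.runAgainst H D a ω t).mom
        - gradient F θ') + (1 - A.β t) • A.meanNoise H D r θ'‖ ^ 2 := by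
    rw [lyapunov, A.honestMean_mom_succ hA.differentiable, runAgainst_update_θ,
      Function.update_self,
      (A.runAgainst_congr H D a (update_eq_of_le ω t r)).2]
    congr 4
    module
  have hmn : Measurable fun r => A.meanNoise H D r θ' := by
    have h1 (i : Fin n) : Measurable fun r : Round d n m => A.batchNoise (D i) (r.2.2 i) θ' :=
      A.measurable_batchNoise (D i) (by fun_prop) measurable_const
    have h2 := fun i => measurable_dpNoise (d := d) (n := n) (m := m) i
    unfold meanNoise
    fun_prop
  have hnoise := lintegral_norm_add_smul_sq_le (A.memLp_meanNoise H D θ')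
    (A.integral_meanNoise hA.b_pos hA.clip_eq hA.differentiable H D θ')
    (A.integral_norm_meanNoise_sq_le hA.b_pos hA.clip_eq hv hA.varCor_eq hA.varInd_eq hH hH0 hσ θ')
    (A.β t • (honestMean H (A.runAgainst H D a ω t).mom - gradient F θ')) (1 - A.β t)
  have hlyap := lyapunov_step hsm hsc hL hA.μ_pos hd hγ
    (mul_stepSize_le_one hL hA.μ_pos t) (A.runAgainst H D a ω t).θ
    (caf A.eig A.f (A.received H D a ω t)) (honestMean H (A.runAgainst H D a ω t).mom)
  have hθγ : (A.runAgainst H D a ω t).θ - γ • caf A.eig A.f (A.received H D a ω t) = θ' := by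
    rw [hθ', runAgainst_succ_θ, hA.γ_eq]
  rw [hθγ] at hlyap
  have hγ1 : 0 ≤ 1 - μ * γ := by
    have h1 := mul_stepSize_le_one hL hA.μ_pos t
    have h2 := hsc.le_of_isSmooth hsm hd
    nlinarith
  have hW0 : 0 ≤ A.lyapunov L H D a t ω := by
    have := hF0 (A.runAgainst H D a ω t).θ
    unfold lyapunov
    positivity
  have hW : F (A.runAgainst H D a ω t).θ - (⨅ θ, F θ) + L⁻¹ *
      ‖honestMean H (A.runAgainst H D a ω t).mom - gradient F (A.runAgainst H D a ω t).θ‖ ^ 2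
      = A.lyapunov L H D a t ω := rfl
  rw [hW] at hlyap
  simp only [hupd, ENNReal.ofReal_add (hF0 θ') (mul_nonneg (inv_nonneg.2 hL.le) (sq_nonneg _)),
    ENNReal.ofReal_mul (inv_nonneg.2 hL.le)]
  generalize A.lyapunov L H D a t ω = W at *
  generalize ‖caf A.eig A.f (A.received H D a ω t)
    - honestMean H (A.runAgainst H D a ω t).mom‖ = e at *
  generalize honestMean H (A.runAgainst H D a ω t).mom - gradient F θ' = z at *
  rw [lintegral_add_left measurable_const, lintegral_const, measure_univ, mul_one,
    lintegral_const_mul' _ _ ENNReal.ofReal_ne_top]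
  refine (add_le_add_right (mul_le_mul_right hnoise _) _).trans ?_
  rw [← ENNReal.ofReal_mul (inv_nonneg.2 hL.le), ← ENNReal.ofReal_add (hF0 θ') (by positivity),
    ← ENNReal.ofReal_mul hγ1, ← ENNReal.ofReal_mul hγ.le,
    ← ENNReal.ofReal_add (by positivity) (by positivity),
    ← ENNReal.ofReal_add (by positivity) (by positivity)]
  refine ENNReal.ofReal_le_ofReal ?_
  have hβ' : A.β t = 1 - 24 * L * γ := by rw [hA.β_eq]
  rw [hβ', norm_smul, mul_pow, Real.norm_eq_abs, sq_abs]
  have h1 : L⁻¹ * ((1 - 24 * L * γ) ^ 2 * ‖z‖ ^ 2 + (1 - (1 - 24 * L * γ)) ^ 2 * V)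
      = L⁻¹ * ((1 - 24 * L * γ) ^ 2 * ‖z‖ ^ 2) + γ ^ 2 * (L * (576 * V)) := by
    field_simp
    ring
  rw [h1]
  linarith

end CafCor

/-! ### The expected excess loss after all rounds. -/

namespace CafCor

variable {X : Type u} {d n m : ℕ} {A : CafCor X d n m} {f : ℕ} {L μ v : ℝ} {H : Finset (Fin n)}
  {D : Fin n → Fin m → X}

theorem IsTuned.lintegral_lyapunov_le (hA : A.IsTuned f L μ v) {η : ℝ} (hη : 0 < η) (hd : 0 < d)
    (hn : 0 < n) (hnf : (2 + η) * f ≤ n) (hH : H.card + f = n) (hH0 : 0 < H.card) {G σ : ℝ}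
    (hG : BoundedHeterogeneity A.loss H D G) (hσ : BoundedVariance A.loss H D σ)
    (hsm : IsSmooth L (honestLoss A.loss H D)) (hsc : IsStronglyConvex μ (honestLoss A.loss H D))
    (a : Adversary d n m) {w₀ : ℝ} (hw₀ : ∀ ω, A.lyapunov L H D a 0 ω = w₀) (t : ℕ) :
    ∫⁻ ω, ENNReal.ofReal (A.lyapunov L H D a t ω) ∂A.law
      ≤ ENNReal.ofReal (cafConst η * (f / n) * (3 * G ^ 2) / μ + (240 * (L / μ) * w₀
        + 100 * (cafConst η * (f / n) * (L * (144 * σ ^ 2 + 23328 * (n + d) * (n + 1) * v / n))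
          + L * (576 * (2 * σ ^ 2 + 16 * d * v * (f + 1) / H.card))) / (9 * μ ^ 2))
        / (t + 240 * (L / μ))) := by
  have hL := hA.L_pos
  have hμ := hA.μ_pos
  have hv := hA.v_pos
  have hμL := hsc.le_of_isSmooth hsm hd
  have hκ := cafConst_pos hη
  obtain ⟨c, hc⟩ : ∃ c : ℝ, c = cafConst η * (f / n) * (3 * G ^ 2) := ⟨_, rfl⟩
  obtain ⟨B₁, hB₁⟩ : ∃ B₁ : ℝ, B₁ = cafConst η * (f / n)
    * (L * (144 * σ ^ 2 + 23328 * (n + d) * (n + 1) * v / n)) := ⟨_, rfl⟩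
  obtain ⟨B₂, hB₂⟩ : ∃ B₂ : ℝ, B₂ = L * (576 * (2 * σ ^ 2 + 16 * d * v * (f + 1) / H.card)) :=
    ⟨_, rfl⟩
  have hc0 : 0 ≤ c := by rw [hc]; positivity
  have hB₁0 : 0 ≤ B₁ := by rw [hB₁]; positivity
  have hB₂0 : 0 ≤ B₂ := by rw [hB₂]; positivity
  have hw₀0 : 0 ≤ w₀ := by
    rw [← hw₀ fun _ => ⟨0, 0, fun _ => ∅⟩]
    have := hsc.sub_iInf_nonneg hμ (A.runAgainst H D a (fun _ => ⟨0, 0, fun _ => ∅⟩) 0).θ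
    unfold lyapunov
    positivity
  -- The recursion is solved for a real sequence dominating the expectations, so their finiteness
  -- comes out of the induction.
  obtain ⟨w, hw0, hw⟩ : ∃ w : ℕ → ℝ, w 0 = w₀ ∧ ∀ t, w (t + 1)
      = (1 - μ * stepSize L μ t) * w t + stepSize L μ t * c + stepSize L μ t ^ 2 * (B₁ + B₂) :=
    ⟨fun t => Nat.rec w₀ (fun t x => (1 - μ * stepSize L μ t) * x + stepSize L μ t * c
      + stepSize L μ t ^ 2 * (B₁ + B₂)) t, rfl, fun t => rfl⟩
  have hγ0 (t : ℕ) := stepSize_pos hL hμ t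
  have hγ1 (t : ℕ) : 0 ≤ 1 - μ * stepSize L μ t := by
    have h1 := mul_stepSize_le_one hL hμ t
    have h2 := hγ0 t
    nlinarith
  have hwnn (t : ℕ) : 0 ≤ w t := by
    induction t with
    | zero => rw [hw0]; exact hw₀0
    | succ t ih =>
      have h1 := hγ0 t
      have h2 := mul_nonneg (hγ1 t) ih
      rw [hw]
      positivity
  have hle (t : ℕ) : ∫⁻ ω, ENNReal.ofReal (A.lyapunov L H D a t ω) ∂A.law
      ≤ ENNReal.ofReal (w t) := by
    induction t with
    | zero => simp [hw₀, hw0]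
    | succ t ih =>
      have h0 := hγ0 t
      have h1 := hγ1 t
      have hm (t : ℕ) : Measurable fun ω => ENNReal.ofReal (A.lyapunov L H D a t ω) :=
        (hA.measurable_lyapunov a t).ennreal_ofReal
      have hcaf := hA.lintegral_norm_caf_sub_sq_le hμL hη hd hn hnf hH hH0 hG hσ a t
      have hupd := hA.lintegral_lyapunov_update_le hd hH hH0 hσ hsm hsc a t
      rw [← hB₂] at hupd
      have hbound : cafConst η * (f / n) * (3 * G ^ 2 + stepSize L μ t
          * (L * (144 * σ ^ 2 + 23328 * (n + d) * (n + 1) * v / n)))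
          = c + stepSize L μ t * B₁ := by
        rw [hc, hB₁]; ring
      rw [hbound] at hcaf
      have hM : ∀ ω, ∫⁻ r, ENNReal.ofReal (A.lyapunov L H D a (t + 1)
            (Function.update ω (t + 1) r)) ∂A.roundLaw
          ≤ ENNReal.ofReal (1 - μ * stepSize L μ t) * ENNReal.ofReal (A.lyapunov L H D a t ω)
            + ENNReal.ofReal (stepSize L μ t) * ENNReal.ofReal (‖caf A.eig A.f
              (A.received H D a ω t) - honestMean H (A.runAgainst H D a ω t).mom‖ ^ 2)
            + ENNReal.ofReal (stepSize L μ t ^ 2 * B₂) := hupd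
      calc ∫⁻ ω, ENNReal.ofReal (A.lyapunov L H D a (t + 1) ω) ∂A.law
          = ∫⁻ ω, ∫⁻ r, ENNReal.ofReal (A.lyapunov L H D a (t + 1)
              (Function.update ω (t + 1) r)) ∂A.roundLaw ∂A.law := by
            rw [law_eq]
            exact lintegral_update_infinitePi _ (t + 1) (hm (t + 1))
        _ ≤ ∫⁻ ω, (ENNReal.ofReal (1 - μ * stepSize L μ t)
              * ENNReal.ofReal (A.lyapunov L H D a t ω)
            + ENNReal.ofReal (stepSize L μ t) * ENNReal.ofReal (‖caf A.eig A.f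
              (A.received H D a ω t) - honestMean H (A.runAgainst H D a ω t).mom‖ ^ 2)
            + ENNReal.ofReal (stepSize L μ t ^ 2 * B₂)) ∂A.law := lintegral_mono hM
        _ = ENNReal.ofReal (1 - μ * stepSize L μ t)
              * ∫⁻ ω, ENNReal.ofReal (A.lyapunov L H D a t ω) ∂A.law
            + ENNReal.ofReal (stepSize L μ t) * ∫⁻ ω, ENNReal.ofReal (‖caf A.eig A.f
              (A.received H D a ω t) - honestMean H (A.runAgainst H D a ω t).mom‖ ^ 2) ∂A.law
            + ENNReal.ofReal (stepSize L μ t ^ 2 * B₂) := by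
            rw [lintegral_add_right _ measurable_const,
              lintegral_add_left ((hm t).const_mul _),
              lintegral_const_mul' _ _ ENNReal.ofReal_ne_top,
              lintegral_const_mul' _ _ ENNReal.ofReal_ne_top, lintegral_const, measure_univ,
              mul_one]
        _ ≤ ENNReal.ofReal (1 - μ * stepSize L μ t) * ENNReal.ofReal (w t)
            + ENNReal.ofReal (stepSize L μ t) * ENNReal.ofReal (c + stepSize L μ t * B₁)
            + ENNReal.ofReal (stepSize L μ t ^ 2 * B₂) := by gcongr
        _ = ENNReal.ofReal (w (t + 1)) := by
            have h2 := mul_nonneg h1 (hwnn t)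
            rw [← ENNReal.ofReal_mul h1, ← ENNReal.ofReal_mul h0.le,
              ← ENNReal.ofReal_add h2 (by positivity),
              ← ENNReal.ofReal_add (by positivity) (by positivity), hw]
            congr 1
            ring
  refine (hle t).trans (ENNReal.ofReal_le_ofReal ?_)
  have := recursion_le hL hμ hμL (by positivity : 0 ≤ B₁ + B₂) hc0 (hw0 ▸ hw₀0)
    (fun t => (hw t).le) t
  rwa [hw0, hc, hB₁, hB₂] at this

theorem IsTuned.integrable_excessLoss (hA : A.IsTuned f L μ v)
    (hsc : IsStronglyConvex μ (honestLoss A.loss H D)) (a : Adversary d n m) {ϱ : ℝ}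
    (hϱ : 0 ≤ ϱ)
    (hle : ∫⁻ ω, ENNReal.ofReal (A.lyapunov L H D a A.T ω) ∂A.law ≤ ENNReal.ofReal ϱ) :
    Integrable (A.excessLoss H D a) A.law ∧ ∫ ω, A.excessLoss H D a ω ∂A.law ≤ ϱ := by
  have h0 (ω : ℕ → Round d n m) : 0 ≤ A.excessLoss H D a ω := hsc.sub_iInf_nonneg hA.μ_pos _
  have hm : Measurable (A.excessLoss H D a) :=
    ((hA.measurable_honestLoss H D).comp
      (A.measurable_runAgainst hA.isTopEigensolver H D a A.T).1).sub_const _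
  have hlyap (ω : ℕ → Round d n m) : A.excessLoss H D a ω ≤ A.lyapunov L H D a A.T ω := by
    have hL := hA.L_pos
    refine le_add_of_nonneg_right ?_
    positivity
  have h1 : ∫⁻ ω, ENNReal.ofReal (A.excessLoss H D a ω) ∂A.law ≤ ENNReal.ofReal ϱ :=
    (lintegral_mono fun ω => ENNReal.ofReal_le_ofReal (hlyap ω)).trans hle
  have hi : Integrable (A.excessLoss H D a) A.law :=
    ⟨hm.aestronglyMeasurable, (hasFiniteIntegral_iff_ofReal (ae_of_all _ h0)).2
      (h1.trans_lt ENNReal.ofReal_lt_top)⟩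
  refine ⟨hi, ?_⟩
  rw [integral_eq_lintegral_of_nonneg_ae (ae_of_all _ h0) hm.aestronglyMeasurable]
  exact ENNReal.toReal_le_of_le_ofReal hϱ h1

/-! ### Executions without active clipping -/

theorem measurableSet_unclipped (A : CafCor X d n m) (heig : IsTopEigensolver A.eig)
    (H : Finset (Fin n)) (D : Fin n → Fin m → X) (a : Adversary d n m) :
    MeasurableSet (A.unclipped H D a) := by
  have h : A.unclipped H D a = ⋂ t, ⋂ (_ : 1 ≤ t), ⋂ (_ : t < A.T), ⋂ i ∈ H, ⋂ k,
      ({ω : ℕ → Round d n m | k ∈ (ω t).2.2 i}ᶜ ∪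
        {ω | clipGrad A.clip (gradient (fun z => A.loss z (D i k)) (A.runAgainst H D a ω t).θ)
          = gradient (fun z => A.loss z (D i k)) (A.runAgainst H D a ω t).θ}) := by
    ext ω
    simp only [unclipped, Set.mem_iInter, Set.mem_union, Set.mem_compl_iff, Set.mem_ofPred_eq,
      imp_iff_not_or]
  rw [h]
  refine .iInter fun t => .iInter fun _ => .iInter fun _ => .iInter fun i => .iInter fun _ =>
    .iInter fun k => ?_
  have hB : Measurable fun ω : ℕ → Round d n m => (ω t).2.2 i := by fun_prop
  have hg : Measurable fun ω =>
      gradient (fun z => A.loss z (D i k)) (A.runAgainst H D a ω t).θ :=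
    (measurable_gradient _).comp (A.measurable_runAgainst heig H D a t).1
  exact (hB (measurableSet_mem_finset k)).compl.union
    (measurableSet_eq_fun ((measurable_clipGrad A.clip).comp hg) hg)

theorem runAgainst_eq_of_mem_unclipped (A : CafCor X d n m) (H : Finset (Fin n))
    (D : Fin n → Fin m → X) (a : Adversary d n m) {ω : ℕ → Round d n m}
    (hω : ω ∈ A.unclipped H D a) {t : ℕ} (ht : t < A.T) :
    ((A.runAgainst H D a ω t).θ = (({A with clip := none} : CafCor X d n m).runAgainst H D a ω t).θ)
      ∧ ∀ i ∈ H, (A.runAgainst H D a ω t).mom i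
        = (({A with clip := none} : CafCor X d n m).runAgainst H D a ω t).mom i := by
  induction t with
  | zero => exact ⟨rfl, fun i _ => rfl⟩
  | succ t ih =>
    obtain ⟨ih1, ih2⟩ := ih (by lia)
    have hrec : A.received H D a ω t
        = ({A with clip := none} : CafCor X d n m).received H D a ω t := by
      funext i
      unfold received
      split_ifs with hi
      · exact ih2 i hi
      · rfl
    have hθ : (A.runAgainst H D a ω (t + 1)).θ
        = (({A with clip := none} : CafCor X d n m).runAgainst H D a ω (t + 1)).θ := by
      rw [runAgainst_succ_θ, runAgainst_succ_θ, ih1, hrec]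
    refine ⟨hθ, fun i hi => ?_⟩
    rw [runAgainst_succ_mom, runAgainst_succ_mom, ih2 i hi, ← hθ]
    have hg : A.noisyGrad (D i) i (ω (t + 1)) (A.runAgainst H D a ω (t + 1)).θ
        = ({A with clip := none} : CafCor X d n m).noisyGrad (D i) i (ω (t + 1))
          (A.runAgainst H D a ω (t + 1)).θ := by
      unfold noisyGrad
      congr 3
      exact Finset.sum_congr rfl fun k hk => hω (t + 1) (by lia) ht i hi k hk
    rw [hg]

/-- θ_T uses only momenta of rounds before T, and those of round 0 vanish; this is why the event
need only constrain the rounds 1 ≤ t < T. -/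
theorem excessLoss_eq_of_mem_unclipped (A : CafCor X d n m) (H : Finset (Fin n))
    (D : Fin n → Fin m → X) (a : Adversary d n m) {ω : ℕ → Round d n m}
    (hω : ω ∈ A.unclipped H D a) :
    A.excessLoss H D a ω = ({A with clip := none} : CafCor X d n m).excessLoss H D a ω := by
  have h (s : ℕ) (hs : s ≤ A.T) : (A.runAgainst H D a ω s).θ
      = (({A with clip := none} : CafCor X d n m).runAgainst H D a ω s).θ := by
    cases s with
    | zero => rfl
    | succ t =>
      obtain ⟨h1, h2⟩ := A.runAgainst_eq_of_mem_unclipped H D a hω (t := t) (by lia)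
      have hrec : A.received H D a ω t
          = ({A with clip := none} : CafCor X d n m).received H D a ω t := by
        funext i
        unfold received
        split_ifs with hi
        · exact h2 i hi
        · rfl
      rw [runAgainst_succ_θ, runAgainst_succ_θ, h1, hrec]
  unfold excessLoss
  rw [h A.T le_rfl]

theorem IsRobust.isRobustWhenUnclipped (heig : IsTopEigensolver A.eig)
    (hsc : IsStronglyConvex μ (honestLoss A.loss H D)) (hμ : 0 < μ) {ϱ : ℝ}
    (h : ({A with clip := none} : CafCor X d n m).IsRobust H D ϱ) :
    A.IsRobustWhenUnclipped H D ϱ := by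
  intro a
  obtain ⟨h1, h2⟩ := h a
  have hE := A.measurableSet_unclipped heig H D a
  have hlaw : ({A with clip := none} : CafCor X d n m).law = A.law := rfl
  rw [hlaw] at h1 h2
  have heq : Set.EqOn (A.excessLoss H D a)
      (({A with clip := none} : CafCor X d n m).excessLoss H D a) (A.unclipped H D a) :=
    fun ω hω => A.excessLoss_eq_of_mem_unclipped H D a hω
  refine ⟨(integrableOn_congr_fun heq hE).2 h1.integrableOn, ?_⟩
  rw [setIntegral_congr_fun hE heq]
  refine (setIntegral_le_integral h1 (ae_of_all _ fun ω => ?_)).trans h2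
  exact hsc.sub_iInf_nonneg hμ _

end CafCor

/-! ### The constants -/

/-- With v of order QT/n, the aggregation error (f/n)(n+d)v yields both Q f/n and Q d f/n², and the
mean noise d v(f+1)/n yields Q d(f+1)/n², all times T. The estimates 1/h ≤ 2/n and n+1 ≤ 2n produce
the constants. -/
theorem privacyNoise_error_le {κ Q d n f h T : ℝ} (hκ : 0 < κ) (hQ : 0 ≤ Q) (hd : 0 ≤ d)
    (hn : 1 ≤ n) (hf : 0 ≤ f) (hh : 0 < h) (hnh : n ≤ 2 * h) (hT : 0 ≤ T) :
    κ * (f / n) * (23328 * (n + d) * (n + 1) * (32 * Q * T / h) / n)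
        + 576 * (16 * d * (32 * Q * T / h) * (f + 1) / h)
      ≤ T * (64 * (46656 * κ + 18432)) * (Q * d / n * ((f + 1) / n) + Q * (f / n)) := by
  have hn0 : 0 < n := by linarith
  have h1 : 1 / h ≤ 2 / n := by rw [div_le_div_iff₀ hh hn0]; linarith
  have hv : 32 * Q * T / h ≤ 64 * Q * T / n := by
    calc 32 * Q * T / h = 32 * Q * T * (1 / h) := by ring
      _ ≤ 32 * Q * T * (2 / n) := by gcongr
      _ = _ := by ring
  have h2 : n + 1 ≤ 2 * n := by linarith
  have e1 : κ * (f / n) * (23328 * (n + d) * (n + 1) * (32 * Q * T / h) / n)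
      ≤ κ * (f / n) * (23328 * (n + d) * (2 * n) * (64 * Q * T / n) / n) := by gcongr
  have e2 : 576 * (16 * d * (32 * Q * T / h) * (f + 1) / h)
      ≤ 576 * (16 * d * (64 * Q * T / n) * (f + 1)) * (2 / n) := by
    calc 576 * (16 * d * (32 * Q * T / h) * (f + 1) / h)
        = 576 * (16 * d * (32 * Q * T / h) * (f + 1)) * (1 / h) := by ring
      _ ≤ _ := by gcongr
  have e3 : κ * (f / n) * (23328 * (n + d) * (2 * n) * (64 * Q * T / n) / n)
      = T * (64 * (46656 * κ)) * (Q * d / n * (f / n) + Q * (f / n)) := by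
    field_simp
    ring
  have e4 : 576 * (16 * d * (64 * Q * T / n) * (f + 1)) * (2 / n)
      = T * (64 * 18432) * (Q * d / n * ((f + 1) / n)) := by
    field_simp
    ring
  have e5 : T * (64 * (46656 * κ)) * (Q * d / n * (f / n) + Q * (f / n))
      ≤ T * (64 * (46656 * κ)) * (Q * d / n * ((f + 1) / n) + Q * (f / n)) := by
    gcongr
    linarith
  have e6 : 0 ≤ T * (64 * 18432) * (Q * (f / n)) := by positivity
  rw [e3] at e1
  rw [e4] at e2
  linarith

/-- The constant of the trade-off. -/
noncomputable def tradeoffConst (η : ℝ) : ℝ :=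
  -- The summands pay for heterogeneity, for the privacy noise (12 ≥ 100/9), and for the transient
  -- terms once T is large.
  3 * cafConst η + 12 * (64 * (46656 * cafConst η + 18432)) + 1

theorem tradeoffConst_pos {η : ℝ} (hη : 0 < η) : 0 < tradeoffConst η := by
  have := cafConst_pos hη
  unfold tradeoffConst
  positivity

/-- The numerator splits into a part independent of T (initial error and σ²), which `hT` bounds, and
a part linear in T from the noise variance, which the denominator cancels. -/
theorem rate_le_tradeoffError {η : ℝ} (hη : 0 < η) {d n f h : ℕ} (hn : 0 < n)
    (hnf : (2 + η) * f ≤ n) (hh : h + f = n) (hh0 : 0 < h) {C ε δ L μ G σ w₀ : ℝ}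
    (hε : 0 < ε) (hl : 0 ≤ Real.log (1 / δ)) (hL : 0 < L) (hμ : 0 < μ) (hw₀ : 0 ≤ w₀) {T : ℕ}
    (hT : (240 * (L / μ) * w₀
        + 100 * (L * (144 * cafConst η * (f / n) + 1152) * σ ^ 2) / (9 * μ ^ 2)) ≤
      L / μ ^ 2 * (C ^ 2 * d * Real.log (1 / δ) / (ε ^ 2 * n) * ((f + 1) / n)
        + C ^ 2 * Real.log (1 / δ) / ε ^ 2 * (f / n)) * T) :
    cafConst η * (f / n) * (3 * G ^ 2) / μ + (240 * (L / μ) * w₀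
        + 100 * (cafConst η * (f / n) * (L * (144 * σ ^ 2
            + 23328 * (n + d) * (n + 1) * noiseVar C T δ ε n f / n))
          + L * (576 * (2 * σ ^ 2 + 16 * d * noiseVar C T δ ε n f * (f + 1) / h))) / (9 * μ ^ 2))
        / (T + 240 * (L / μ)) ≤ tradeoffConst η * tradeoffError d n f C ε δ L μ G := by
  have hκ := cafConst_pos hη
  set κ := cafConst η with hκdef
  set ℓ := Real.log (1 / δ) with hℓ
  set Q : ℝ := C ^ 2 * ℓ / ε ^ 2 with hQ
  have hQ0 : 0 ≤ Q := by positivity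
  have hn1 : (1 : ℝ) ≤ n := by exact_mod_cast hn
  have hnn : (0 : ℝ) < n := by linarith
  have hhn : (n : ℝ) - f = h := by rw [← hh]; push_cast; ring
  have hh' : (0 : ℝ) < h := by exact_mod_cast hh0
  have hnh : (n : ℝ) ≤ 2 * h := by
    have : (0 : ℝ) ≤ η * f := by positivity
    linarith
  have hv : noiseVar C T δ ε n f = 32 * Q * T / h := by
    rw [noiseVar, hhn, hQ, ← hℓ]
    field_simp
  set E := Q * d / n * ((f + 1) / n) + Q * (f / n) with hE
  have hE0 : 0 ≤ E := by positivity
  have hEeq : C ^ 2 * d * ℓ / (ε ^ 2 * n) * ((f + 1) / n) + C ^ 2 * ℓ / ε ^ 2 * (f / n) = E := by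
    rw [hE, hQ]
    field_simp
  have hnoise := privacyNoise_error_le (T := T) hκ hQ0 (Nat.cast_nonneg d) hn1 (Nat.cast_nonneg f)
    hh' hnh (Nat.cast_nonneg T)
  rw [hEeq] at hT
  rw [tradeoffError, ← hℓ, hEeq, hv]
  set N := κ * (f / n) * (23328 * (n + d) * (n + 1) * (32 * Q * T / h) / n)
    + 576 * (16 * d * (32 * Q * T / h) * (f + 1) / h) with hN
  set M := 240 * (L / μ) * w₀ + 100 * (L * (144 * κ * (f / n) + 1152) * σ ^ 2) / (9 * μ ^ 2)
    with hM
  have hM0 : 0 ≤ M := by positivity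
  have hnum : 240 * (L / μ) * w₀ + 100 * (κ * (f / n) * (L * (144 * σ ^ 2
        + 23328 * (n + d) * (n + 1) * (32 * Q * T / h) / n))
      + L * (576 * (2 * σ ^ 2 + 16 * d * (32 * Q * T / h) * (f + 1) / h))) / (9 * μ ^ 2)
      = M + 100 / 9 * (L / μ ^ 2) * N := by
    rw [hM, hN]
    ring
  have hq : 0 < 240 * (L / μ) := by positivity
  have hT0 : (0 : ℝ) ≤ T := Nat.cast_nonneg T
  have hb : M + 100 / 9 * (L / μ ^ 2) * N
      ≤ (12 * (64 * (46656 * κ + 18432)) + 1) * (L / μ ^ 2 * E) * (T + 240 * (L / μ)) := by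
    have h1 : 100 / 9 * (L / μ ^ 2) * N
        ≤ 12 * (L / μ ^ 2) * (T * (64 * (46656 * κ + 18432)) * E) := by
      have hN0 : 0 ≤ T * (64 * (46656 * κ + 18432)) * E := by positivity
      calc 100 / 9 * (L / μ ^ 2) * N
          ≤ 100 / 9 * (L / μ ^ 2) * (T * (64 * (46656 * κ + 18432)) * E) := by gcongr
        _ ≤ _ := by gcongr; norm_num
    have h2 : 0 ≤ (12 * (64 * (46656 * κ + 18432)) + 1) * (L / μ ^ 2 * E) * (240 * (L / μ)) := by
      positivity
    linarith
  have hfrac : (M + 100 / 9 * (L / μ ^ 2) * N) / (T + 240 * (L / μ))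
      ≤ (12 * (64 * (46656 * κ + 18432)) + 1) * (L / μ ^ 2 * E) :=
    (div_le_iff₀ (by linarith)).2 hb
  have hG : κ * (f / n) * (3 * G ^ 2) / μ = 3 * κ * (f * G ^ 2 / (n * μ)) := by field_simp
  have hx : 0 ≤ f * G ^ 2 / (n * μ) := by positivity
  have hy : 0 ≤ L / μ ^ 2 * E := by positivity
  rw [hnum, hG, tradeoffConst, ← hκdef]
  have h3 : 0 ≤ (12 * (64 * (46656 * κ + 18432)) + 1) * (f * G ^ 2 / (n * μ)) := by positivity
  have h4 : 0 ≤ 3 * κ * (L / μ ^ 2 * E) := by positivity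
  linarith

theorem tunedCafCor_isRobust {X : Type u} {η : ℝ} (hη : 0 < η) {d n m f b : ℕ} (hd : 0 < d)
    (hn : 0 < n) (hb : 0 < b) (hbm : b ≤ m) (hnf : (2 + η) * f ≤ n) {H : Finset (Fin n)}
    (hH : H.card + f = n) (hH0 : 0 < H.card) {loss : Vec d → X → ℝ}
    (hloss : ∀ x, Differentiable ℝ fun θ => loss θ x) {C ε δ L μ : ℝ} (hC : 0 < C) (hε : 0 < ε)
    (hl : 0 < Real.log (1 / δ)) (hL : 0 < L) (hμ : 0 < μ) (θ₀ : Vec d) {D : Fin n → Fin m → X}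
    {G σ : ℝ} (hG : BoundedHeterogeneity loss H D G) (hσ : BoundedVariance loss H D σ)
    (hsm : IsSmooth L (honestLoss loss H D)) (hsc : IsStronglyConvex μ (honestLoss loss H D)) :
    ∃ T₀ : ℕ, ∀ T : ℕ, T₀ ≤ T → ∀ eig : Matrix (Fin d) (Fin d) ℝ → Vec d, IsTopEigensolver eig →
      (tunedCafCor loss f b hbm none C ε δ L μ T θ₀ eig : CafCor X d n m).IsRobust H D
        (tradeoffConst η * tradeoffError d n f C ε δ L μ G) := by
  have hκ := cafConst_pos hη
  have hh' : (0 : ℝ) < H.card := by exact_mod_cast hH0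
  have hhn : (n : ℝ) - f = H.card := by
    have : (H.card : ℝ) + f = n := by exact_mod_cast hH
    linarith
  have hnn : (0 : ℝ) < n := by exact_mod_cast hn
  obtain ⟨w₀, hw₀⟩ : ∃ w₀ : ℝ, w₀ = honestLoss loss H D θ₀ - (⨅ θ : Vec d, honestLoss loss H D θ)
    + L⁻¹ * ‖honestMean H (0 : Fin n → Vec d) - gradient (honestLoss loss H D) θ₀‖ ^ 2 :=
    ⟨_, rfl⟩
  have hw₀0 : 0 ≤ w₀ := by
    have := hsc.sub_iInf_nonneg hμ θ₀
    rw [hw₀]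
    positivity
  obtain ⟨M, hM⟩ : ∃ M : ℝ, M = 240 * (L / μ) * w₀
    + 100 * (L * (144 * cafConst η * (f / n) + 1152) * σ ^ 2) / (9 * μ ^ 2) := ⟨_, rfl⟩
  obtain ⟨E, hE⟩ : ∃ E : ℝ, E = L / μ ^ 2 * (C ^ 2 * d * Real.log (1 / δ) / (ε ^ 2 * n)
    * ((f + 1) / n) + C ^ 2 * Real.log (1 / δ) / ε ^ 2 * (f / n)) := ⟨_, rfl⟩
  have hE0 : 0 < E := by
    have hd' : (0 : ℝ) < d := by exact_mod_cast hd
    rw [hE]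
    positivity
  -- The ceiling makes the transient M at most E T; the extra 1 ensures T > 0, hence a positive
  -- noise variance.
  refine ⟨⌈M / E⌉₊ + 1, fun T hT eig heig => ?_⟩
  have hT0 : (0 : ℝ) < T := by exact_mod_cast (by lia : 0 < T)
  have hMT : M ≤ E * T := by
    have h1 : M / E ≤ T := (Nat.le_ceil _).trans (by exact_mod_cast (by lia : ⌈M / E⌉₊ ≤ T))
    rwa [div_le_iff₀' hE0] at h1
  have hϱ0 : 0 ≤ tradeoffConst η * tradeoffError d n f C ε δ L μ G := by
    have := tradeoffConst_pos hη
    unfold tradeoffError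
    positivity
  have hv : 0 < noiseVar C T δ ε n f := by
    unfold noiseVar
    rw [hhn]
    positivity
  have hA : (tunedCafCor loss f b hbm none C ε δ L μ T θ₀ eig : CafCor X d n m).IsTuned f L μ
      (noiseVar C T δ ε n f) :=
    ⟨hloss, heig, rfl, rfl, hb, rfl, rfl, rfl, rfl, hL, hμ, hv⟩
  have hrate := rate_le_tradeoffError (G := G) hη hn hnf hH hH0 hε hl.le hL hμ hw₀0 (hM ▸ hE ▸ hMT)
  intro a
  have h0 (ω : ℕ → Round d n m) :
      (tunedCafCor loss f b hbm none C ε δ L μ T θ₀ eig : CafCor X d n m).lyapunov L H D a 0 ω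
        = w₀ := hw₀.symm
  have h1 := hA.lintegral_lyapunov_le hη hd hn hnf hH hH0 hG hσ hsm hsc a h0 T
  exact hA.integrable_excessLoss hsc a hϱ0 (h1.trans (ENNReal.ofReal_le_ofReal hrate))

theorem mainTheorem4 (η : ℝ) (hη : 0 < η) :
    ∃ K : ℝ, 0 < K ∧
      ∀ (X : Type u) (d n m f b : ℕ) (_hd : 0 < d) (_hn : 0 < n) (_hb : 0 < b) (hbm : b ≤ m)
        (_hnf : (2 + η) * (f : ℝ) ≤ (n : ℝ))
        (H : Finset (Fin n)) (_hH : H.card + f = n)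
        (loss : Vec d → X → ℝ) (_hloss : ∀ x, Differentiable ℝ fun θ => loss θ x)
        (C ε δ L μ : ℝ) (_hC : 0 < C) (_hε : 0 < ε) (_hδ : 0 < δ) (_hδ1 : δ < 1)
        (_hεδ : ε ≤ Real.log (1 / δ)) (_hL : 0 < L) (_hμ : 0 < μ) (θ₀ : Vec d),
        -- privacy, against the server colluding with all malicious workers
        (∀ (T : ℕ) (eig : Matrix (Fin d) (Fin d) ℝ → Vec d), IsTopEigensolver eig →
          (tunedCafCor loss f b hbm (some C) C ε δ L μ T θ₀ eig : CafCor X d n m).SecLDP H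
            (CafCor.maliciousSecrets H) ε δ) ∧
        -- robustness, asymptotically in the number of rounds
        (∀ (D : Fin n → Fin m → X) (G σ : ℝ), 0 ≤ G → 0 ≤ σ →
          BoundedHeterogeneity loss H D G → BoundedVariance loss H D σ →
          IsSmooth L (honestLoss loss H D) → IsStronglyConvex μ (honestLoss loss H D) →
          ∃ T₀ : ℕ, ∀ T : ℕ, T₀ ≤ T →
            ∀ eig : Matrix (Fin d) (Fin d) ℝ → Vec d, IsTopEigensolver eig →
              (tunedCafCor loss f b hbm none C ε δ L μ T θ₀ eig : CafCor X d n m).IsRobust H D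
                (K * tradeoffError d n f C ε δ L μ G) ∧
              (tunedCafCor loss f b hbm (some C) C ε δ L μ T θ₀ eig :
                CafCor X d n m).IsRobustWhenUnclipped H D
                (K * tradeoffError d n f C ε δ L μ G)) := by
  refine ⟨tradeoffConst η, tradeoffConst_pos hη, ?_⟩
  intro X d n m f b hd hn hb hbm hnf H hH loss hloss C ε δ L μ hC hε hδ hδ1 hεδ hL hμ θ₀
  have hl : 0 < Real.log (1 / δ) := hε.trans_le hεδ
  have hnn : (0 : ℝ) < n := by exact_mod_cast hn
  have hH0 : 0 < H.card := by
    by_contra h0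
    have h1 : f = n := by lia
    rw [h1] at hnf
    nlinarith
  refine ⟨fun T eig heig =>
    tunedCafCor_secLDP hb hbm hH hH0 loss L μ hC hε hδ hεδ θ₀ T heig, ?_⟩
  intro D G σ _ _ hG hσ hsm hsc
  obtain ⟨T₀, hT₀⟩ := tunedCafCor_isRobust hη hd hn hb hbm hnf hH hH0 hloss hC hε hl hL hμ θ₀ hG hσ
    hsm hsc
  refine ⟨T₀, fun T hT eig heig => ⟨hT₀ T hT eig heig, ?_⟩⟩
  exact CafCor.IsRobust.isRobustWhenUnclipped
    (A := tunedCafCor loss f b hbm (some C) C ε δ L μ T θ₀ eig) heig hsc hμ (hT₀ T hT eig heig)
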